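/- **Conventions.** Let $R$ be a commutative ring (for example $R=\mathbb Z$), $B$ an ungraded bialgebra over $R$ (a unital algebra with coproduct $\nabla$ and counit $\epsilon$ that are algebra maps, $\nabla$ coassociative and counital), and $C$ a left $B$-comodule in unital $R$-algebras, i.e. a unital $R$-algebra with a coassociative and counital algebra map $\nabla_C:C\to B\otimes C$. All tensor products of modules are over $R$. There are two colours, $\mathfrak c$ (closed) and $\mathfrak o$ (open). **The operad $\mathcal{RL}_2$.** It is a coloured operad in sets with colours $(n,c)$, $n\in\mathbb N$, $c\in\{\mathfrak c,\mathfrak o\}$. An element of $\mathcal{RL}((n_1,c_1),\dots,(n_k,c_k);(m,c))$ is a word in the letters $1,\dots,k$ and $m$ bars in which the letter $i$ occurs exactly $n_i+1$ times (a lattice path with $m$ marked points); if $c=\mathfrak c$ and some $c_i=\mathfrak o$, there are none. Composition replaces the $r$-th occurrence of the letter $i$ by the $r$-th of the segments into which the bars cut the word plugged in at $i$. Unary operations $(n,c)\to(m,c)$ are the monotone maps $[n]\to[m]$. For $i\ne j$ let $c_{ij}$ be the number of changes between $i$ and $j$ in the word obtained by deleting all other letters and the bars; for $c_i=\mathfrak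 c$, $c_j=\mathfrak o$ let $c'_{ij}=c_{ij}$ if the first $i$ precedes the first $j$, and $c'_{ij}=c_{ij}+1$ otherwise. $\mathcal{RL}_2$ consists of the words with $c_{ij}\le 2$ for two closed letters, $c_{ij}\le 1$ for two open ones, and $c'_{ij}\le 2$ for a closed $i$ and an open $j$. **The operad $\mathrm{Coend}_{\mathcal{RL}_2}(\delta_{\mathbb Z})$.** Let $\delta_{\mathbb Z}$ be the cosimplicial chain complex $n\mapsto C_*(\Delta^n;\mathbb Z)$ of (unnormalized) simplicial chains. For colours $c_1,\dots,c_k;c$ let $\xi(m)$ be the coend $$\int^{[n_1],\dots,[n_k]}\mathbb Z\big[\mathcal{RL}_2((n_1,c_1),\dots,(n_k,c_k);(m,c))\big]\otimes\delta_{\mathbb Z}(n_1)\otimes\cdots\otimes\delta_{\mathbb Z}(n_k).$$ Then $\mathrm{Coend}_{\mathcal{RL}_2}(\delta_{\mathbb Z})(c_1,\dots,c_k;c)$ is the complex $\mathrm{Hom}_\Delta(\delta_{\mathbb Z},\xi)$ of natural transformations, with composition $f\otimes g_1\otimes\cdots\otimes g_k\mapsto \pm\,\xi(g_1,\dots,g_k)\circ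 f$ followed by the composition of $\mathcal{RL}_2$, with Koszul signs; this is a dg operad with two colours. If $X=(X_{\mathfrak c},X_{\mathfrak o})$ is an $\mathcal{RL}_2$-algebra in $R$-modules, each $X_c$ is cosimplicial through the unary operations, and $\mathrm{Coend}_{\mathcal{RL}_2}(\delta_{\mathbb Z})$ acts on the pair of totalizations $\mathrm{Tot}\,X_c=\mathrm{Hom}_\Delta(\delta_{\mathbb Z},X_c)$ by sending $f\otimes g_1\otimes\cdots\otimes g_k$ to $\delta_{\mathbb Z}\xrightarrow{f}\xi\xrightarrow{g_1,\dots,g_k}X_c$ (Koszul signs). **The cobar constructions.** $\underline\Omega_uB=(TB,D)$ and $\underline\Omega_u(B,C)=(TB\otimes C,D')$, graded by the tensor degree in $B$, where $$D(b_1\otimes\cdots\otimes b_n)=1\otimes b_1\otimes\cdots\otimes b_n+\sum_{i=1}^n(-1)^ib_1\otimes\cdots\otimes\nabla(b_i)\otimes\cdots\otimes b_n+(-1)^{n+1}b_1\otimes\cdots\otimes b_n\otimes1,$$ $$D'(b_1\otimes\cdots\otimes b_n\otimes c)=1\otimes b_1\otimes\cdots\otimes b_n\otimes c+\sum_{i=1}^n(-1)^ib_1\otimes\cdots\otimes\nabla(b_i)\otimes\cdots\otimes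 b_n\otimes c+(-1)^{n+1}b_1\otimes\cdots\otimes b_n\otimes\nabla_C(c).$$ **The couple $(\mathcal M_B,\mathcal Z_{B,C})$.** $\mathcal M_B(k)=B^{\otimes k}$ and $\mathcal Z_{B,C}(k)=B^{\otimes k}\otimes C$, with the following structure. Write $\nabla^{(l-1)}:B\to B^{\otimes l}$ for the iterated coproduct ($\epsilon$ if $l=0$). (a) $\gamma(f;g_1,\dots,g_k)=(\nabla^{(l_1-1)}\otimes\cdots\otimes\nabla^{(l_k-1)})(f)\cdot(g_1\otimes\cdots\otimes g_k)$ for $f\in B^{\otimes k}$, $g_j\in B^{\otimes l_j}$. (b) The map $\mathcal As\to\mathcal M_B$ given by $1\otimes\cdots\otimes1\in B^{\otimes N}$; in particular the multiplication is $\mu=1\otimes1$. (c) For $0\le s\le k$ and a strictly increasing $\beta:\{1,\dots,s\}\to\{1,\dots,k\}$, the wide left action $\lambda'_\beta(f;x_1,\dots,x_s)\in B^{\otimes N}\otimes C$, $N=l_1+\cdots+l_s+k-s$, for $f\in B^{\otimes k}$ and $x_r\in B^{\otimes l_r}\otimes C$: the product in the algebra $B^{\otimes N}\otimes C$ of $(\nabla^{(w_1-1)}\otimes\cdots\otimes\nabla^{(w_k-1)})(f)\otimes1$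 and of $\tilde x_s,\tilde x_{s-1},\dots,\tilde x_1$, in this order. Here $w_{\beta(r)}=l_r$, $w_j=1$ for $j$ not in the image of $\beta$, and, for $x_r=g\otimes c$, $\tilde x_r=1\otimes\cdots\otimes1\otimes g\otimes(\nabla^{(t-1)}\otimes\mathrm{id})\nabla_C(c)$ (which means $1\otimes\cdots\otimes 1\otimes g\otimes c$ if $t=0$), with $g$ in the block $\beta(r)$ and $t$ the number of positions after that block. For $s=0$ this is the inclusion $f\mapsto f\otimes1$. (d) The right action of $\mathcal As$: $f\otimes c\mapsto(\nabla^{(l_1-1)}\otimes\cdots\otimes\nabla^{(l_k-1)})(f)\otimes c$. **Theorem.** There is an $\mathcal{RL}_2$-algebra with underlying modules $(\mathcal M_B,\mathcal Z_{B,C})$ whose structure extends (a)–(d): the operations of $\mathcal{RL}_2$ act by (a) for the words $t\,w_1\,t\,w_2\cdots t\,w_k\,t$ with closed $t$ and closed $w_j=j|j|\cdots|j$ ($l_j$ bars), by (b) for the words consisting of $N$ bars (closed output), by (c) for the words $t\,w_1\,t\cdots t\,w_k\,t$ (open output) with closed $t$, with $w_{\beta(r)}=r|r|\cdots|r$ ($l_r$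 bars) for an open letter $r$, and with $w_j=|$ for the other $j$, and by (d) for the words $t\,w_1\,t\cdots t\,w_k\,t$ with open $t$ and $w_j$ consisting of $l_j$ bars. For its cosimplicial structure the maps $g\mapsto(-1)^{p(p+1)/2}g(\mathrm{id}_{[p]})$ in degrees $p\ge 0$ are isomorphisms of complexes $\mathrm{Tot}\,\mathcal M_B\cong\underline\Omega_uB$ and $\mathrm{Tot}\,\mathcal Z_{B,C}\cong\underline\Omega_u(B,C)$. The couple $(\underline\Omega_uB,\underline\Omega_u(B,C))$ is an algebra over the two-coloured dg operad $\mathrm{Coend}_{\mathcal{RL}_2}(\delta_{\mathbb Z})$, by an action which corresponds under these isomorphisms to the action on the totalizations described above. -/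

import Mathlib

namespace SwissCheese

/-- The two colours of a Swiss-Cheese type operad. -/
inductive Clr : Type
  | closed : Clr
  | opn : Clr

section Words
variable {ι : Type} [LinearOrder ι]

/-- The number of maximal blocks of equal letters in the word obtained from `w` by deleting all
letters other than `i` and `j`. -/
def runs (i j : ι) (w : List ι) : ℕ :=
  ((w.filter fun a => a = i ∨ a = j).destutter (· ≠ ·)).length

/-- The number `c_{ij}` of changes of direction between `i` and `j` in the word `w`. -/
def turns (i j : ι) (w : List ι) : ℕ := runs i j w - 1

/-- The number `c'_{ij}`, for a closed direction `i` and an open direction `j`: it is `c_{ij}` if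
the first occurrence of `i` precedes the first one of `j`, and `c_{ij} + 1` otherwise. -/
def turns' (i j : ι) (w : List ι) : ℕ :=
  if (w.filter fun a => a = i ∨ a = j).head? = some i then turns i j w else turns i j w + 1

theorem runs_le_iff (i j : ι) (w : List ι) (L : ℕ) :
    runs i j w ≤ L ↔ ∀ s : List ι, s.Sublist w → s.IsChain (· ≠ ·) →
      (∀ a ∈ s, a = i ∨ a = j) → s.length ≤ L := by
  constructor
  · intro h s hs hc hm
    refine le_trans ?_ h
    refine List.IsChain.length_le_length_destutter_ne ?_ hc
    have : s.filter (fun a => a = i ∨ a = j) = s := by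
      rw [List.filter_eq_self]; simpa using hm
    rw [← this]
    exact hs.filter _
  · intro h
    refine h _ ((List.destutter_sublist _ _).trans List.filter_sublist)
      (List.isChain_destutter _ _) ?_
    intro a ha
    have := (List.destutter_sublist _ _).subset ha
    simpa using (List.mem_filter.1 this).2

theorem runs_pos (i j : ι) (w : List ι) (h : i ∈ w) : 0 < runs i j w := by
  rw [runs, List.length_pos_iff, Ne, List.destutter_eq_nil]
  intro h'
  have : i ∈ w.filter (fun a => a = i ∨ a = j) := by simp [h]
  rw [h'] at this
  simp at this

theorem destutter_head? (w : List ι) : (w.destutter (· ≠ ·)).head? = w.head? := by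
  cases w with
  | nil => rfl
  | cons a l =>
    rw [List.destutter_cons']
    induction l with
    | nil => simp
    | cons b l ih =>
      rw [List.destutter'_cons]
      split_ifs with h
      · rfl
      · simpa using ih

theorem turns'_le_iff (i j : ι) (hij : i ≠ j) (w : List ι) (hi : i ∈ w) (L : ℕ) :
    turns' i j w ≤ L ↔ ∀ s : List ι, s.Sublist w → s.IsChain (· ≠ ·) →
      (∀ a ∈ s, a = i ∨ a = j) → s.head? = some j → s.length ≤ L := by
  have hpos := runs_pos i j w hi
  unfold turns' turns
  split_ifs with h
  · constructor
    · intro hL s hs hc hm hh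
      have h1 : runs i j w ≤ L + 1 := by omega
      have hf : s.Sublist (w.filter fun a => a = i ∨ a = j) := by
        have : s.filter (fun a => a = i ∨ a = j) = s := by
          rw [List.filter_eq_self]; simpa using hm
        rw [← this]
        exact hs.filter _
      have h2 := (runs_le_iff i j w (L + 1)).1 h1 (i :: s) ?_ ?_ ?_
      · simpa using h2
      · refine List.Sublist.trans ?_ (List.filter_sublist (p := fun a => decide (a = i ∨ a = j)))
        cases hw : w.filter fun a => a = i ∨ a = j with
        | nil => rw [hw] at h; simp at h
        | cons a l =>
          rw [hw] at h hf
          have ha : a = i := by simpa using h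
          subst ha
          refine List.Sublist.cons_cons _ ?_
          cases s with
          | nil => simp
          | cons b s =>
            have hb : b = j := by simpa using hh
            subst hb
            cases hf with
            | cons _ h => exact h
            | cons_cons _ h => exact absurd rfl hij
      · cases s with
        | nil => simp
        | cons b s =>
          have hb : b = j := by simpa using hh
          subst hb
          exact List.isChain_cons_cons.2 ⟨hij, hc⟩
      · intro a ha
        rcases List.mem_cons.1 ha with rfl | ha
        · exact Or.inl rfl
        · exact hm a ha
    · intro hL
      have hd := destutter_head? (w.filter fun a => a = i ∨ a = j)
      rw [h] at hd
      have hsub := (List.destutter_sublist (· ≠ ·) (w.filter fun a => a = i ∨ a = j))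
      have hch := List.isChain_destutter (· ≠ ·) (w.filter fun a => a = i ∨ a = j)
      unfold runs
      cases ht : (w.filter fun a => a = i ∨ a = j).destutter (· ≠ ·) with
      | nil => simp
      | cons a t =>
        rw [ht] at hd hsub hch
        have ha : a = i := by simpa using hd
        subst ha
        cases t with
        | nil => simp
        | cons b t =>
          have hmem : ∀ x ∈ a :: b :: t, x = a ∨ x = j := by
            intro x hx
            simpa using (List.mem_filter.1 (hsub.subset hx)).2
          have hne := (List.isChain_cons_cons.1 hch).1
          have := hL (b :: t) (((List.sublist_cons_self _ _).trans hsub).trans List.filter_sublist)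
            (List.isChain_cons_cons.1 hch).2 (fun x hx => hmem x (List.mem_cons_of_mem _ hx)) (by
              rcases hmem b (by simp) with rfl | rfl
              · exact absurd rfl hne
              · rfl)
          simpa using this
  · have h1 : runs i j w - 1 + 1 = runs i j w := by omega
    rw [h1]
    constructor
    · intro hL s hs hc hm _
      exact (runs_le_iff i j w L).1 hL s hs hc hm
    · intro hL
      refine hL _ ((List.destutter_sublist _ _).trans List.filter_sublist)
        (List.isChain_destutter _ _) ?_ ?_
      · intro a ha
        have := (List.destutter_sublist _ _).subset ha
        simpa using (List.mem_filter.1 this).2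
      · rw [destutter_head?]
        cases hw : w.filter fun a => a = i ∨ a = j with
        | nil =>
          have : i ∈ w.filter (fun a => a = i ∨ a = j) := by simp [hi]
          rw [hw] at this
          simp at this
        | cons a l =>
          rw [hw] at h
          have : a ∈ w.filter (fun a => a = i ∨ a = j) := by rw [hw]; simp
          have := (List.mem_filter.1 this).2
          simp only [decide_eq_true_eq] at this
          rcases this with rfl | rfl
          · simp at h
          · rfl

end Words

/-- The conditions which define the `d`-th filtration stage on words in letters with colours `c`:
`c_{ij} ≤ d` for two closed letters, `c_{ij} ≤ d - 1` for two open ones, and `c'_{ij} ≤ d` for a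
closed and an open one. -/
structure Filtered {ι : Type} [LinearOrder ι] (d : ℕ) (c : ι → Clr) (w : List ι) : Prop where
  closed_closed : ∀ i j, i ≠ j → c i = .closed → c j = .closed → turns i j w ≤ d
  open_open : ∀ i j, i ≠ j → c i = .opn → c j = .opn → turns i j w + 1 ≤ d
  closed_open : ∀ i j, i ≠ j → c i = .closed → c j = .opn → turns' i j w ≤ d

theorem filtered_iff {ι : Type} [LinearOrder ι] (d : ℕ) (c : ι → Clr) (w : List ι)
    (hw : ∀ i, i ∈ w) :
    Filtered d c w ↔ ∀ i j, i ≠ j → ∀ s : List ι, s.Sublist w → s.IsChain (· ≠ ·) →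
      (∀ a ∈ s, a = i ∨ a = j) →
      (c i = .closed → c j = .closed → s.length ≤ d + 1) ∧
      (c i = .opn → c j = .opn → s.length ≤ d) ∧
      (c i = .closed → c j = .opn → s.head? = some j → s.length ≤ d) := by
  constructor
  · intro h i j hij s hs hc hm
    have hp := runs_pos i j w (hw i)
    refine ⟨fun hi hj => ?_, fun hi hj => ?_, fun hi hj hh => ?_⟩
    · have := h.closed_closed i j hij hi hj
      exact (runs_le_iff i j w (d + 1)).1 (by unfold turns at this; omega) s hs hc hm
    · have := h.open_open i j hij hi hj
      exact (runs_le_iff i j w d).1 (by unfold turns at this; omega) s hs hc hm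
    · exact (turns'_le_iff i j hij w (hw i) d).1 (h.closed_open i j hij hi hj) s hs hc hm hh
  · intro h
    refine ⟨fun i j hij hi hj => ?_, fun i j hij hi hj => ?_, fun i j hij hi hj => ?_⟩
    · have := (runs_le_iff i j w (d + 1)).2 fun s hs hc hm => (h i j hij s hs hc hm).1 hi hj
      unfold turns; omega
    · have := (runs_le_iff i j w d).2 fun s hs hc hm => (h i j hij s hs hc hm).2.1 hi hj
      have hp := runs_pos i j w (hw i)
      unfold turns; omega
    · exact (turns'_le_iff i j hij w (hw i) d).2 fun s hs hc hm hh =>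
        (h i j hij s hs hc hm).2.2 hi hj hh

theorem map_sublist_of_flatMap {α β ι : Type} (p : α → ι) (Y : α → List β) (f : β → ι)
    (hf : ∀ a, ∀ b ∈ Y a, f b = p a) (E : List α) (u : List ι)
    (hu : u.Sublist ((E.flatMap Y).map f)) (hc : u.IsChain (· ≠ ·)) :
    u.Sublist (E.map p) := by
  induction E generalizing u with
  | nil => simpa using hu
  | cons a E ih =>
    rw [List.flatMap_cons, List.map_append, List.sublist_append_iff] at hu
    obtain ⟨u1, u2, rfl, h1, h2⟩ := hu
    have h2' := ih u2 h2 hc.right_of_append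
    have hall : ∀ x ∈ u1, x = p a := by
      intro x hx
      obtain ⟨b, hb, rfl⟩ := List.mem_map.1 (h1.subset hx)
      exact hf a b hb
    have hc1 := hc.left_of_append
    rcases u1 with _ | ⟨x, _ | ⟨y, u1⟩⟩
    · simpa using h2'.trans (List.sublist_cons_self _ _)
    · have hx := hall x (by simp)
      subst hx
      simpa using h2'
    · exact absurd ((hall x (by simp)).trans (hall y (by simp)).symm)
        (List.isChain_cons_cons.1 hc1).1

theorem Filtered.subst {ι τ α β : Type} [LinearOrder ι] [LinearOrder τ] {d : ℕ} {c : ι → Clr}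
    {c' : τ → Clr} (p : α → ι) (q : β → τ) (π : τ → ι) (Y : α → List β)
    (hY : ∀ a, ∀ b ∈ Y a, π (q b) = p a) (E : List α) (hW : ∀ i, i ∈ E.map p)
    (hW' : ∀ t, t ∈ (E.flatMap Y).map q) (h : Filtered d c (E.map p))
    (hcol : ∀ t, c (π t) = .closed → c' t = .closed)
    (hin : ∀ t t', t ≠ t' → π t = π t' → ∀ s : List τ,
      s.Sublist (((E.filter fun a => p a = π t).flatMap Y).map q) → s.IsChain (· ≠ ·) →
      (∀ a ∈ s, a = t ∨ a = t') →
      (c' t = .closed → c' t' = .closed → s.length ≤ d + 1) ∧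
      (c' t = .opn → c' t' = .opn → s.length ≤ d) ∧
      (c' t = .closed → c' t' = .opn → s.head? = some t' → s.length ≤ d)) :
    Filtered d c' ((E.flatMap Y).map q) := by
  have hopn : ∀ t, c' t = .opn → c (π t) = .opn := by
    intro t ht
    cases hc : c (π t) with
    | closed => rw [hcol t hc] at ht; cases ht
    | opn => rfl
  rw [filtered_iff d c _ hW] at h
  rw [filtered_iff d c' _ hW']
  intro t t' htt s hs hc hm
  by_cases hπ : π t = π t'
  · refine hin t t' htt hπ s ?_ hc hm
    have hs2 := hs.filter (fun a => π a = π t)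
    have e1 : s.filter (fun a => π a = π t) = s := by
      rw [List.filter_eq_self]
      intro a ha
      rcases hm a ha with rfl | rfl <;> simp [hπ]
    rw [e1] at hs2
    have e2 : ((E.flatMap Y).map q).filter (fun a => π a = π t) =
        ((E.filter fun a => p a = π t).flatMap Y).map q := by
      clear hs2 hs hW' hW h hin
      induction E with
      | nil => simp
      | cons a E ih =>
        rw [List.flatMap_cons, List.map_append, List.filter_append, ih]
        by_cases ha : p a = π t
        · rw [List.filter_cons_of_pos (by simpa using ha), List.flatMap_cons, List.map_append]
          congr 1
          rw [List.filter_eq_self]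
          intro x hx
          obtain ⟨b, hb, rfl⟩ := List.mem_map.1 hx
          simpa [hY a b hb] using ha
        · rw [List.filter_cons_of_neg (by simpa using ha)]
          have : ((Y a).map q).filter (fun a => π a = π t) = [] := by
            rw [List.filter_eq_nil_iff]
            intro x hx
            obtain ⟨b, hb, rfl⟩ := List.mem_map.1 hx
            simpa [hY a b hb] using ha
          rw [this, List.nil_append]
    rw [e2] at hs2
    exact hs2
  · have hcm : (s.map π).IsChain (· ≠ ·) := by
      rw [List.isChain_map]
      have : ∀ l : List τ, (∀ a ∈ l, a = t ∨ a = t') → l.IsChain (· ≠ ·) →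
          l.IsChain (fun a b => π a ≠ π b) := by
        intro l
        induction l with
        | nil => intros; exact List.IsChain.nil
        | cons a l ih =>
          intro hm hc
          cases l with
          | nil => exact List.IsChain.singleton _
          | cons b l =>
            rw [List.isChain_cons_cons] at hc ⊢
            refine ⟨?_, ih (fun x hx => hm x (List.mem_cons_of_mem _ hx)) hc.2⟩
            rcases hm a (by simp) with rfl | rfl <;> rcases hm b (by simp) with rfl | rfl
            · exact absurd rfl hc.1
            · exact hπ
            · exact fun h => hπ h.symm
            · exact absurd rfl hc.1
      exact this s hm hc
    have hsm : (s.map π).Sublist (E.map p) := by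
      refine map_sublist_of_flatMap p Y (fun b => π (q b)) hY E _ ?_ hcm
      have := hs.map π
      rwa [List.map_map] at this
    have hmm : ∀ a ∈ s.map π, a = π t ∨ a = π t' := by
      intro a ha
      obtain ⟨b, hb, rfl⟩ := List.mem_map.1 ha
      rcases hm b hb with rfl | rfl <;> simp
    have A := h (π t) (π t') hπ _ hsm hcm hmm
    have B := h (π t') (π t) (fun h => hπ h.symm) _ hsm hcm fun a ha => (hmm a ha).symm
    have A' := h (π t) (π t') hπ (s.map π).tail ((List.tail_sublist _).trans hsm) hcm.tail
      fun a ha => hmm a (List.mem_of_mem_tail ha)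
    have B' := h (π t') (π t) (fun h => hπ h.symm) (s.map π).tail
      ((List.tail_sublist _).trans hsm) hcm.tail fun a ha => (hmm a (List.mem_of_mem_tail ha)).symm
    have hhead : (s.map π).head? = some (π t') ∨ (s.map π).length ≤ 1 ∨
        (s.map π).tail.head? = some (π t') := by
      rcases s with _ | ⟨x, _ | ⟨y, s⟩⟩
      · simp
      · simp
      · rcases hm x (by simp) with rfl | rfl
        · rcases hm y (by simp) with rfl | rfl
          · exact absurd rfl (List.isChain_cons_cons.1 hc).1
          · simp
        · simp
    have hhead' : (s.map π).head? = some (π t) ∨ (s.map π).length ≤ 1 ∨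
        (s.map π).tail.head? = some (π t) := by
      rcases s with _ | ⟨x, _ | ⟨y, s⟩⟩
      · simp
      · simp
      · rcases hm x (by simp) with rfl | rfl
        · simp
        · rcases hm y (by simp) with rfl | rfl
          · simp
          · exact absurd rfl (List.isChain_cons_cons.1 hc).1
    simp only [List.length_map, List.length_tail] at A B A' B' hhead hhead'
    refine ⟨fun h1 h2 => ?_, fun h1 h2 => A.2.1 (hopn t h1) (hopn t' h2), fun h1 h2 h3 => ?_⟩
    · cases e1 : c (π t) <;> cases e2 : c (π t')
      · exact A.1 e1 e2
      · rcases hhead with h | h | h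
        · have := A.2.2 e1 e2 h; omega
        · omega
        · have := A'.2.2 e1 e2 h; omega
      · rcases hhead' with h | h | h
        · have := B.2.2 e2 e1 h; omega
        · omega
        · have := B'.2.2 e2 e1 h; omega
      · have := A.2.1 e1 e2; omega
    · cases e1 : c (π t)
      · refine A.2.2 e1 (hopn t' h2) ?_
        rw [List.head?_map, h3]; rfl
      · exact A.2.1 e1 (hopn t' h2)

/-- A lattice path, from the origin to the opposite corner, in the grid which has `n i + 1` edges in
the direction `i`, together with `m` marked points on it. It is given by the lists of its edges:
`seg j` lists the edges after the `j`-th and before the `(j + 1)`-th marked point, and `⟨i, r⟩` is the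
`r`-th edge in the direction `i`. In every direction, the edges occur in their natural order. -/
structure LatticePath {ι : Type} [LinearOrder ι] (n : ι → ℕ) (m : ℕ) where
  seg : Fin (m + 1) → List (Σ i, Fin (n i + 1))
  edges : ∀ i, (((List.finRange (m + 1)).flatMap seg).filter fun a => a.1 = i) =
    (List.finRange (n i + 1)).map (Sigma.mk i)

namespace LatticePath
variable {ι : Type} [LinearOrder ι] {n : ι → ℕ} {m : ℕ}

/-- The sequence of directions of the edges. -/
def letters (x : LatticePath n m) : List ι :=
  ((List.finRange (m + 1)).flatMap x.seg).map Sigma.fst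

/-- The string of the path: the sequence of directions, with a bar `none` for each marked point. -/
def word (x : LatticePath n m) : List (Option ι) :=
  [none].intercalate (List.ofFn fun j => (x.seg j).map fun a => some a.1)

theorem mem_letters (x : LatticePath n m) (i : ι) : i ∈ x.letters := by
  have h : (⟨i, 0⟩ : Σ i, Fin (n i + 1)) ∈
      (((List.finRange (m + 1)).flatMap x.seg).filter fun a => a.1 = i) := by
    rw [x.edges i]
    exact List.mem_map.2 ⟨0, List.mem_finRange _, rfl⟩
  exact List.mem_map.2 ⟨_, (List.mem_filter.1 h).1, rfl⟩

end LatticePath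

/-- The operations of the coloured operad `RL_d`, with inputs of colours `(n i, c i)` indexed by the
linearly ordered set `ι` and with an output of colour `(m, c₀)`: lattice paths in the `d`-th
filtration stage. There are none if the output is closed and one of the inputs is open. -/
structure RL {ι : Type} [LinearOrder ι] (d : ℕ) (c : ι → Clr) (n : ι → ℕ) (c₀ : Clr) (m : ℕ)
    extends LatticePath n m where
  split : c₀ = .closed → ∀ i, c i = .closed
  filtered : Filtered d c toLatticePath.letters

namespace RL
variable {ι : Type} [LinearOrder ι] {d : ℕ} {c : ι → Clr} {n : ι → ℕ} {c₀ : Clr} {m : ℕ}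

theorem edges_flatMap {ι τ : Type} [LinearOrder ι] [LinearOrder τ] {n : ι → ℕ} {ν : τ → ℕ}
    (E : List (Σ i, Fin (n i + 1))) (i : ι)
    (hE : (E.filter fun a => a.1 = i) = (List.finRange (n i + 1)).map (Sigma.mk i))
    (Y : (Σ i, Fin (n i + 1)) → List (Σ t, Fin (ν t + 1))) (t : τ)
    (hY : ∀ a, a.1 ≠ i → ((Y a).filter fun b => b.1 = t) = []) :
    (E.flatMap Y).filter (fun b => b.1 = t) =
      ((List.finRange (n i + 1)).flatMap fun r => Y ⟨i, r⟩).filter (fun b => b.1 = t) := by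
  have h1 : (E.flatMap Y).filter (fun b => b.1 = t) =
      ((E.filter fun a => a.1 = i).flatMap Y).filter (fun b => b.1 = t) := by
    clear hE
    induction E with
    | nil => simp
    | cons a E ih =>
      rw [List.flatMap_cons, List.filter_append, ih]
      by_cases ha : a.1 = i
      · rw [List.filter_cons_of_pos (by simpa using ha), List.flatMap_cons, List.filter_append]
      · rw [List.filter_cons_of_neg (by simpa using ha), hY a ha, List.nil_append]
  rw [h1, hE, List.flatMap_map]

/-- Replace each edge `a` of the path `o` by the list of edges `Y a`. -/
def subst {τ : Type} [LinearOrder τ] (o : RL d c n c₀ m) (π : τ → ι) (ν : τ → ℕ) (c' : τ → Clr)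
    (Y : (Σ i, Fin (n i + 1)) → List (Σ t, Fin (ν t + 1)))
    (hY : ∀ a, ∀ b ∈ Y a, π b.1 = a.1)
    (hord : ∀ t, (((List.finRange (n (π t) + 1)).flatMap fun r => Y ⟨π t, r⟩).filter
      fun b => b.1 = t) = (List.finRange (ν t + 1)).map (Sigma.mk t))
    (hcol : ∀ t, c (π t) = .closed → c' t = .closed)
    (hin : ∀ t t', t ≠ t' → π t = π t' → ∀ s : List τ,
      s.Sublist (((List.finRange (n (π t) + 1)).flatMap fun r => Y ⟨π t, r⟩).map Sigma.fst) →
      s.IsChain (· ≠ ·) → (∀ a ∈ s, a = t ∨ a = t') →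
      (c' t = .closed → c' t' = .closed → s.length ≤ d + 1) ∧
      (c' t = .opn → c' t' = .opn → s.length ≤ d) ∧
      (c' t = .closed → c' t' = .opn → s.head? = some t' → s.length ≤ d)) :
    RL d c' ν c₀ m :=
  have he : ∀ t, (((List.finRange (m + 1)).flatMap fun j => (o.seg j).flatMap Y).filter
      fun b => b.1 = t) = (List.finRange (ν t + 1)).map (Sigma.mk t) := by
    intro t
    rw [← List.flatMap_assoc, edges_flatMap _ (π t) (o.edges (π t)) Y t, hord]
    intro a ha
    rw [List.filter_eq_nil_iff]
    intro b hb hbt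
    simp only [decide_eq_true_eq] at hbt
    exact ha (by rw [← hY a b hb, hbt])
  let P : LatticePath ν m := ⟨fun j => (o.seg j).flatMap Y, he⟩
  { toLatticePath := P
    split := fun h t => hcol t (o.split h (π t))
    filtered := by
      have hP : P.letters = ((((List.finRange (m + 1)).flatMap o.seg).flatMap Y).map Sigma.fst) := by
        rw [List.flatMap_assoc]; rfl
      rw [hP]
      refine Filtered.subst Sigma.fst Sigma.fst π Y hY _ o.mem_letters ?_ o.filtered hcol ?_
      · rw [← hP]; exact P.mem_letters
      · intro t t' htt hπ s hs
        rw [o.edges, List.flatMap_map] at hs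
        exact hin t t' htt hπ s hs }

theorem subst_seg {τ : Type} [LinearOrder τ] (o : RL d c n c₀ m) (π : τ → ι) (ν : τ → ℕ)
    (c' : τ → Clr) (Y) (hY) (hord) (hcol) (hin) (j) :
    (o.subst π ν c' Y hY hord hcol hin).seg j = (o.seg j).flatMap Y := rfl

theorem flatMap_fiber {k l : ℕ} (f : Fin (k + 1) →o Fin (l + 1)) :
    ((List.finRange (l + 1)).flatMap fun j => (List.finRange (k + 1)).filter fun r => f r = j) =
      List.finRange (k + 1) := by
  have hs : ((List.finRange (l + 1)).flatMap fun j =>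
      (List.finRange (k + 1)).filter fun r => f r = j).Pairwise (· < ·) := by
    rw [List.pairwise_flatMap]
    refine ⟨fun j _ => (List.pairwise_lt_finRange _).filter _, ?_⟩
    refine (List.pairwise_lt_finRange _).imp ?_
    intro i j hij a ha b hb
    have ha := (List.mem_filter.1 ha).2
    have hb := (List.mem_filter.1 hb).2
    simp only [decide_eq_true_eq] at ha hb
    by_contra hab
    have := f.monotone (not_lt.1 hab)
    rw [ha, hb] at this
    exact absurd hij (not_lt.2 this)
  refine List.Perm.eq_of_pairwise (le := (· < ·)) (fun a b _ _ h1 h2 => absurd h1 h2.asymm) hs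
    (List.pairwise_lt_finRange _) ?_
  rw [List.perm_ext_iff_of_nodup hs.nodup (List.nodup_finRange _)]
  intro a
  simp

/-- The unary operation given by a monotone map `f`: there are `f r` marked points before the `r`-th
edge. All unary operations with equal input and output type are of this form. -/
def unary (d : ℕ) (c₀ : Clr) {k l : ℕ} (f : Fin (k + 1) →o Fin (l + 1)) :
    RL d (fun _ : Unit => c₀) (fun _ => k) c₀ l where
  seg j := ((List.finRange (k + 1)).filter fun r => f r = j).map (Sigma.mk ())
  edges i := by
    rw [← List.map_flatMap, flatMap_fiber, List.filter_eq_self]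
    intro a _
    simp [Subsingleton.elim a.1 i]
  split h _ := h
  filtered :=
    ⟨fun i j h => absurd (Subsingleton.elim i j) h, fun i j h => absurd (Subsingleton.elim i j) h,
      fun i j h => absurd (Subsingleton.elim i j) h⟩

/-- The action of permutations, or renaming of the inputs. -/
def reindex {ι' : Type} [LinearOrder ι'] (e : ι' ≃ ι) (o : RL d c n c₀ m) :
    RL d (fun i => c (e i)) (fun i => n (e i)) c₀ m :=
  o.subst e _ _ (fun a => [(Equiv.sigmaCongrLeft (β := fun i => Fin (n i + 1)) e).symm a])
    (by
      intro a b hb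
      rw [List.mem_singleton] at hb
      subst hb
      conv_rhs => rw [← (Equiv.sigmaCongrLeft (β := fun i => Fin (n i + 1)) e).apply_symm_apply a]
      rfl)
    (by
      intro t
      have h : ∀ r, (Equiv.sigmaCongrLeft (β := fun i => Fin (n i + 1)) e).symm ⟨e t, r⟩ =
          ⟨t, r⟩ := fun r => (Equiv.symm_apply_eq _).2 rfl
      simp only [h]
      rw [← List.map_eq_flatMap, List.filter_eq_self]
      intro a ha
      obtain ⟨r, _, rfl⟩ := List.mem_map.1 ha
      simp)
    (fun _ h => h)
    (fun t t' h h' => absurd (e.injective h') h)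

/-- The composite `o(f_1, …, f_k)` with unary operations at the inputs. -/
def pre {n' : ι → ℕ} (o : RL d c n c₀ m) (f : ∀ i, Fin (n' i + 1) →o Fin (n i + 1)) :
    RL d c n' c₀ m :=
  o.subst (fun i => i) n' c
    (fun a => ((List.finRange (n' a.1 + 1)).filter fun r => f a.1 r = a.2).map (Sigma.mk a.1))
    (by
      intro a b hb
      obtain ⟨r, _, rfl⟩ := List.mem_map.1 hb
      rfl)
    (by
      intro t
      change (List.flatMap (fun r => ((List.finRange (n' t + 1)).filter fun k => f t k = r).map
        (Sigma.mk t : _ → Σ i, Fin (n' i + 1))) (List.finRange (n t + 1))).filter _ = _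
      rw [← List.map_flatMap, flatMap_fiber (f t), List.filter_eq_self]
      intro a ha
      obtain ⟨r, _, rfl⟩ := List.mem_map.1 ha
      simp)
    (fun _ h => h)
    (fun t t' h h' => absurd h' h)

/-- The composite `f(o)` with a unary operation at the output. -/
def post {m' : ℕ} (f : Fin (m + 1) →o Fin (m' + 1)) (o : RL d c n c₀ m) : RL d c n c₀ m' :=
  have h : ((List.finRange (m' + 1)).flatMap fun j =>
      ((List.finRange (m + 1)).filter fun r => f r = j).flatMap o.seg) =
      (List.finRange (m + 1)).flatMap o.seg := by
    rw [← List.flatMap_assoc, flatMap_fiber]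
  { seg := fun j => ((List.finRange (m + 1)).filter fun r => f r = j).flatMap o.seg
    edges := fun i => by rw [h, o.edges]
    split := o.split
    filtered := by
      have := o.filtered
      unfold LatticePath.letters at this ⊢
      rw [← h] at this
      exact this }

/-- The edge number `b.2` in the direction `b.1` of the `i`-th inner grid, as an edge of the grid
with directions `Σₗ i, κ i`. -/
def lexEdge {ι : Type} {κ : ι → Type} {n' : ∀ i, κ i → ℕ} (i : ι) (b : Σ j, Fin (n' i j + 1)) :
    Σ t : Σₗ i, κ i, Fin (n' (ofLex t).1 (ofLex t).2 + 1) :=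
  ⟨toLex ⟨i, b.1⟩, b.2⟩

theorem lexEdge_fst_eq {ι : Type} {κ : ι → Type} {n' : ∀ i, κ i → ℕ} (i : ι) (b : Σ j, Fin (n' i j + 1))
    (j : κ i) : (lexEdge i b).1 = toLex ⟨i, j⟩ ↔ b.1 = j := by
  constructor
  · intro h
    have h' : (⟨i, b.1⟩ : Σ i, κ i) = ⟨i, j⟩ := toLex.injective h
    simpa using h'
  · rintro rfl
    rfl

/-- The composition of the operad `RL_d`: the `r`-th edge of `o` in the direction `i` is replaced by
the `r`-th segment of `y i`. The inputs are ordered lexicographically. -/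
def comp {κ : ι → Type} [∀ i, LinearOrder (κ i)] {c' : ∀ i, κ i → Clr} {n' : ∀ i, κ i → ℕ}
    (o : RL d c n c₀ m) (y : ∀ i, RL d (c' i) (n' i) (c i) (n i)) :
    RL d (fun t : Σₗ i, κ i => c' (ofLex t).1 (ofLex t).2) (fun t => n' (ofLex t).1 (ofLex t).2)
      c₀ m :=
  o.subst (fun t => (ofLex t).1) _ _ (fun a => ((y a.1).seg a.2).map (lexEdge a.1))
    (by
      intro a b hb
      obtain ⟨r, _, rfl⟩ := List.mem_map.1 hb
      rfl)
    (by
      rintro ⟨i, j⟩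
      change (List.flatMap (fun r => ((y i).seg r).map (lexEdge i)) (List.finRange (n i + 1))).filter
        (fun b => b.1 = toLex ⟨i, j⟩) = (List.finRange (n' i j + 1)).map (Sigma.mk (toLex ⟨i, j⟩))
      rw [← List.map_flatMap, List.filter_map]
      have h : ((fun b => decide (b.1 = toLex ⟨i, j⟩)) ∘ lexEdge (n' := n') i) =
          fun b => decide (b.1 = j) := by
        funext b
        exact decide_eq_decide.2 (lexEdge_fst_eq i b j)
      rw [h, (y i).edges j, List.map_map]
      rfl)
    (fun t h => (y _).split h _)
    (by
      rintro ⟨i, j⟩ ⟨i', j'⟩ htt h s hs hc hm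
      have hi : i = i' := h
      subst hi
      have hjj : j ≠ j' := by rintro rfl; exact htt rfl
      change s.Sublist ((List.flatMap (fun r => ((y i).seg r).map (lexEdge i))
        (List.finRange (n i + 1))).map Sigma.fst) at hs
      have hl : (List.flatMap (fun r => ((y i).seg r).map (lexEdge i))
          (List.finRange (n i + 1))).map Sigma.fst =
          (y i).letters.map fun j => (toLex ⟨i, j⟩ : Σₗ i, κ i) := by
        rw [← List.map_flatMap, List.map_map, LatticePath.letters, List.map_map]
        rfl
      rw [hl, List.sublist_map_iff] at hs
      obtain ⟨s, hs, rfl⟩ := hs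
      have hinj : ∀ a b : κ i, (toLex ⟨i, a⟩ : Σₗ i, κ i) = toLex ⟨i, b⟩ ↔ a = b := by
        intro a b
        constructor
        · intro h
          have h' : (⟨i, a⟩ : Σ i, κ i) = ⟨i, b⟩ := toLex.injective h
          simpa using h'
        · rintro rfl; rfl
      have hc' : s.IsChain (· ≠ ·) := by
        rw [List.isChain_map] at hc
        exact hc.imp fun a b hab h => hab ((hinj a b).2 h)
      have hm' : ∀ a ∈ s, a = j ∨ a = j' := by
        intro a ha
        rcases hm _ (List.mem_map.2 ⟨a, ha, rfl⟩) with h | h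
        · exact Or.inl ((hinj a j).1 h)
        · exact Or.inr ((hinj a j').1 h)
      have := (filtered_iff d (c' i) _ (y i).mem_letters).1 (y i).filtered j j' hjj s hs hc' hm'
      rw [List.length_map]
      refine ⟨this.1, this.2.1, fun h1 h2 h3 => this.2.2 h1 h2 ?_⟩
      cases s with
      | nil => simp at h3
      | cons a s =>
        have h3' : (toLex ⟨i, a⟩ : Σₗ i, κ i) = toLex ⟨i, j'⟩ := Option.some.inj h3
        rw [(hinj _ _).1 h3']
        rfl)

end RL

namespace RL
section
variable {ι : Type} [LinearOrder ι] {d : ℕ} {c : ι → Clr} {n : ι → ℕ} {c₀ : Clr} {m : ℕ}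

theorem ext_seg {o o' : RL d c n c₀ m} (h : ∀ j, o.seg j = o'.seg j) : o = o' := by
  obtain ⟨⟨s, _⟩, _, _⟩ := o
  obtain ⟨⟨s', _⟩, _, _⟩ := o'
  obtain rfl : s = s' := funext h
  rfl

theorem seg_pre {n' : ι → ℕ} (o : RL d c n c₀ m) (f : ∀ i, Fin (n' i + 1) →o Fin (n i + 1)) (j) :
    (o.pre f).seg j = (o.seg j).flatMap fun a =>
      ((List.finRange (n' a.1 + 1)).filter fun r => f a.1 r = a.2).map (Sigma.mk a.1) := rfl

theorem seg_post {m' : ℕ} (f : Fin (m + 1) →o Fin (m' + 1)) (o : RL d c n c₀ m) (j) :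
    (o.post f).seg j = ((List.finRange (m + 1)).filter fun r => f r = j).flatMap o.seg := rfl

theorem seg_comp {κ : ι → Type} [∀ i, LinearOrder (κ i)] {c' : ∀ i, κ i → Clr}
    {n' : ∀ i, κ i → ℕ} (o : RL d c n c₀ m) (y : ∀ i, RL d (c' i) (n' i) (c i) (n i)) (j) :
    (o.comp y).seg j = (o.seg j).flatMap fun a => ((y a.1).seg a.2).map (lexEdge a.1) := rfl

theorem seg_reindex {ι' : Type} [LinearOrder ι'] (e : ι' ≃ ι) (o : RL d c n c₀ m) (j) :
    (o.reindex e).seg j = (o.seg j).flatMap fun a =>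
      [(Equiv.sigmaCongrLeft (β := fun i => Fin (n i + 1)) e).symm a] := rfl

theorem filter_eq_singleton {k : ℕ} (r : Fin k) :
    (List.finRange k).filter (fun s => s = r) = [r] := by
  refine List.Perm.eq_of_pairwise (le := (· < ·)) (fun a b _ _ h1 h2 => absurd h1 h2.asymm)
    ((List.pairwise_lt_finRange _).filter _) (by simp) ?_
  rw [List.perm_ext_iff_of_nodup ((List.nodup_finRange _).filter _) (by simp)]
  simp

theorem pre_id (o : RL d c n c₀ m) : o.pre (fun _ => OrderHom.id) = o := by
  refine ext_seg fun j => ?_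
  rw [seg_pre]
  simp [filter_eq_singleton]

theorem post_id (o : RL d c n c₀ m) : o.post OrderHom.id = o := by
  refine ext_seg fun j => ?_
  rw [seg_post]
  simp [filter_eq_singleton]

theorem post_pre {n' : ι → ℕ} {m' : ℕ} (o : RL d c n c₀ m)
    (f : ∀ i, Fin (n' i + 1) →o Fin (n i + 1)) (g : Fin (m + 1) →o Fin (m' + 1)) :
    (o.pre f).post g = (o.post g).pre f := by
  refine ext_seg fun j => ?_
  simp only [seg_post, seg_pre, List.flatMap_assoc]
  rfl

theorem reindex_pre {ι' : Type} [LinearOrder ι'] (e : ι' ≃ ι) {n' : ι → ℕ} (o : RL d c n c₀ m)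
    (f : ∀ i, Fin (n' i + 1) →o Fin (n i + 1)) :
    (o.pre f).reindex e = (o.reindex e).pre fun i => f (e i) := by
  refine ext_seg fun j => ?_
  simp only [seg_pre, seg_reindex, List.flatMap_assoc]
  refine congrArg (fun F => List.flatMap F (o.seg j)) (funext ?_)
  intro a
  obtain ⟨⟨i, r⟩, rfl⟩ := (Equiv.sigmaCongrLeft (β := fun i => Fin (n i + 1)) e).surjective a
  rw [Equiv.symm_apply_apply, List.flatMap_singleton, List.flatMap_map, ← List.map_eq_flatMap]
  refine List.map_congr_left fun s _ => ?_
  exact (Equiv.symm_apply_eq _).2 rfl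

theorem reindex_post {ι' : Type} [LinearOrder ι'] (e : ι' ≃ ι) {m' : ℕ} (o : RL d c n c₀ m)
    (g : Fin (m + 1) →o Fin (m' + 1)) : (o.post g).reindex e = (o.reindex e).post g := by
  refine ext_seg fun j => ?_
  simp only [seg_post, seg_reindex, List.flatMap_assoc]
  rfl

variable {κ : ι → Type} [∀ i, LinearOrder (κ i)] {c' : ∀ i, κ i → Clr} {n' : ∀ i, κ i → ℕ}

theorem comp_post {m' : ℕ} (o : RL d c n c₀ m) (y : ∀ i, RL d (c' i) (n' i) (c i) (n i))
    (g : Fin (m + 1) →o Fin (m' + 1)) : (o.post g).comp y = (o.comp y).post g := by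
  refine ext_seg fun j => ?_
  simp only [seg_post, seg_comp, List.flatMap_assoc]
  rfl

theorem comp_pre_left {k : ι → ℕ} (o : RL d c n c₀ m) (f : ∀ i, Fin (k i + 1) →o Fin (n i + 1))
    (y : ∀ i, RL d (c' i) (n' i) (c i) (k i)) :
    (o.pre f).comp y = o.comp fun i => (y i).post (f i) := by
  refine ext_seg fun j => ?_
  simp only [seg_pre, seg_comp, List.flatMap_assoc, seg_post, List.map_flatMap, List.flatMap_map]

theorem comp_pre_right {k : ∀ i, κ i → ℕ} (o : RL d c n c₀ m)
    (y : ∀ i, RL d (c' i) (n' i) (c i) (n i))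
    (f : ∀ i j, Fin (k i j + 1) →o Fin (n' i j + 1)) :
    (o.comp fun i => (y i).pre (f i)) = (o.comp y).pre fun t => f (ofLex t).1 (ofLex t).2 := by
  refine ext_seg fun j => ?_
  simp only [seg_pre, seg_comp, List.flatMap_assoc, List.map_flatMap, List.flatMap_map,
    List.map_map]
  rfl

theorem unary_post_pre (d : ℕ) (c₀ : Clr) {k l : ℕ} (f : Fin (k + 1) →o Fin (l + 1)) :
    (unary d c₀ (OrderHom.id : Fin (k + 1) →o _)).post f =
      (unary d c₀ OrderHom.id).pre fun _ => f := by
  refine ext_seg fun j => ?_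
  simp only [seg_post, seg_pre, unary, OrderHom.id_coe, id_eq, filter_eq_singleton]
  simp [List.map_eq_flatMap]

end
end RL

noncomputable section Coend
open CategoryTheory

/-- The sign `(-1) ^ k`. -/
def sgn (k : ℤ) : ℤ := (Int.negOnePow k : ℤˣ)

variable (δ : SimplexCategory ⥤ ChainComplex (ModuleCat.{0} ℤ) ℕ)

/-- The group of elements of degree `p` of the chain complex `δ k`. -/
abbrev El (k p : ℕ) : Type := (δ.obj (SimplexCategory.mk k)).X p

/-- The map `δ k → δ l` induced by a monotone map, in degree `p`. -/
def coMap {k l : ℕ} (f : Fin (k + 1) →o Fin (l + 1)) (p : ℕ) : El δ k p →ₗ[ℤ] El δ l p :=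
  ((δ.map (SimplexCategory.mkHom f)).f p).hom

/-- The differential of `δ k`, from degree `p` to degree `p - 1`; it is zero for `p = 0`. -/
def coD (k p : ℕ) : El δ k p →ₗ[ℤ] El δ k (p - 1) :=
  ((δ.obj (SimplexCategory.mk k)).d p (p - 1)).hom

theorem coMap_id (k p : ℕ) : coMap δ (OrderHom.id : Fin (k + 1) →o _) p = LinearMap.id := by
  have : SimplexCategory.mkHom (OrderHom.id : Fin (k + 1) →o _) = 𝟙 (SimplexCategory.mk k) := rfl
  unfold coMap
  rw [this, δ.map_id]
  rfl

theorem coD_zero (k : ℕ) : coD δ k 0 = 0 := by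
  unfold coD
  rw [(δ.obj (SimplexCategory.mk k)).shape]
  · rfl
  · simp

theorem coMap_coD {k l : ℕ} (f : Fin (k + 1) →o Fin (l + 1)) (p : ℕ) (x : El δ k p) :
    coMap δ f (p - 1) (coD δ k p x) = coD δ l p (coMap δ f p x) := by
  have := (δ.map (SimplexCategory.mkHom f)).comm p (p - 1)
  have := congrArg (fun h => h.hom x) this
  exact this.symm

/-- Homogeneous elements of the chain complex `δ k`, with their degrees. -/
structure HomEl (k : ℕ) : Type where
  deg : ℕ
  val : El δ k deg

variable {δ}

/-- The action of a monotone map on homogeneous elements. -/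
def HomEl.map {k l : ℕ} (f : Fin (k + 1) →o Fin (l + 1)) (x : HomEl δ k) : HomEl δ l :=
  ⟨x.deg, coMap δ f x.deg x.val⟩

/-- The differential on homogeneous elements. -/
def HomEl.diff {k : ℕ} (x : HomEl δ k) : HomEl δ k := ⟨x.deg - 1, coD δ k x.deg x.val⟩

theorem HomEl.map_id {k : ℕ} (x : HomEl δ k) : x.map OrderHom.id = x := by
  unfold HomEl.map
  rw [coMap_id]
  rfl

theorem HomEl.map_diff {k l : ℕ} (f : Fin (k + 1) →o Fin (l + 1)) (x : HomEl δ k) :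
    x.diff.map f = (x.map f).diff := by
  unfold HomEl.map HomEl.diff
  rw [coMap_coD]

section
variable {ι : Type} [LinearOrder ι] {d : ℕ} {c : ι → Clr} {c₀ : Clr} {m : ℕ}

variable (δ d c c₀ m)

/-- A generator `o ⊗ x_1 ⊗ ⋯ ⊗ x_k` of the coend below. -/
structure Gen where
  n : ι → ℕ
  op : RL d c n c₀ m
  x : ∀ i, HomEl δ (n i)

variable {δ d c c₀ m}

/-- The generator `o ⊗ x_1 ⊗ ⋯ ⊗ x_k` of the free abelian group on all generators. -/
def gen {n : ι → ℕ} (o : RL d c n c₀ m) (x : ∀ i, HomEl δ (n i)) : Gen δ d c c₀ m →₀ ℤ :=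
  Finsupp.single ⟨n, o, x⟩ 1

/-- The relations of the coend: additivity in each entry, and naturality. -/
inductive Rel : (Gen δ d c c₀ m →₀ ℤ) → Prop
  | add {n : ι → ℕ} (o : RL d c n c₀ m) (x : ∀ i, HomEl δ (n i)) (i : ι) (p : ℕ)
      (a b : El δ (n i) p) :
      Rel (gen o (Function.update x i ⟨p, a + b⟩) - gen o (Function.update x i ⟨p, a⟩) -
        gen o (Function.update x i ⟨p, b⟩))
  | nat {n n' : ι → ℕ} (o : RL d c n c₀ m) (f : ∀ i, Fin (n' i + 1) →o Fin (n i + 1))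
      (x : ∀ i, HomEl δ (n' i)) :
      Rel (gen (o.pre f) x - gen o fun i => (x i).map (f i))

variable (δ d c c₀ m)

/-- The object `m` of the cosimplicial module `ξ(RL_d)_{c; c₀}(δ, …, δ)`: the coend
`∫^{n_1,…,n_k} ℤ[RL_d((n_1,c_1),…,(n_k,c_k); (m,c₀))] ⊗ δ(n_1) ⊗ ⋯ ⊗ δ(n_k)`, presented by
generators `o ⊗ x_1 ⊗ ⋯ ⊗ x_k` with `x_i` homogeneous, and relations. -/
abbrev Xi : Type :=
  (Gen δ d c c₀ m →₀ ℤ) ⧸ Submodule.span ℤ {r : Gen δ d c c₀ m →₀ ℤ | Rel r}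

variable {δ d c c₀ m}

namespace Xi

/-- The class of a generator. -/
def mk {n : ι → ℕ} (o : RL d c n c₀ m) (x : ∀ i, HomEl δ (n i)) : Xi δ d c c₀ m :=
  Submodule.Quotient.mk (gen o x)

theorem mk_add {n : ι → ℕ} (o : RL d c n c₀ m) (x : ∀ i, HomEl δ (n i)) (i : ι) (p : ℕ)
    (a b : El δ (n i) p) :
    mk o (Function.update x i ⟨p, a + b⟩) =
      mk o (Function.update x i ⟨p, a⟩) + mk o (Function.update x i ⟨p, b⟩) := by
  unfold mk
  rw [← Submodule.Quotient.mk_add, Submodule.Quotient.eq, ← sub_sub]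
  exact Submodule.subset_span (Rel.add o x i p a b)

theorem mk_nat {n n' : ι → ℕ} (o : RL d c n c₀ m) (f : ∀ i, Fin (n' i + 1) →o Fin (n i + 1))
    (x : ∀ i, HomEl δ (n' i)) : mk (o.pre f) x = mk o fun i => (x i).map (f i) := by
  unfold mk
  rw [Submodule.Quotient.eq]
  exact Submodule.subset_span (Rel.nat o f x)

theorem mk_zero {n : ι → ℕ} (o : RL d c n c₀ m) (x : ∀ i, HomEl δ (n i)) (i : ι) (p : ℕ) :
    mk o (Function.update x i ⟨p, 0⟩) = 0 := by
  have := mk_add o x i p 0 0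
  rw [add_zero] at this
  simpa using this

theorem mk_add_of_eq {n : ι → ℕ} (o : RL d c n c₀ m) (x y z : ∀ i, HomEl δ (n i)) (i : ι) (p : ℕ)
    (a b : El δ (n i) p) (hx : x i = ⟨p, a + b⟩) (hy : y i = ⟨p, a⟩) (hz : z i = ⟨p, b⟩)
    (hy' : ∀ j, j ≠ i → y j = x j) (hz' : ∀ j, j ≠ i → z j = x j) :
    mk o x = mk o y + mk o z := by
  have h1 : x = Function.update x i ⟨p, a + b⟩ := by rw [← hx, Function.update_eq_self]
  have h2 : y = Function.update x i ⟨p, a⟩ := Function.eq_update_iff.2 ⟨hy, hy'⟩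
  have h3 : z = Function.update x i ⟨p, b⟩ := Function.eq_update_iff.2 ⟨hz, hz'⟩
  rw [h2, h3, ← mk_add, ← h1]

/-- The universal property of the coend. -/
def lift {M : Type*} [AddCommGroup M]
    (F : ∀ {n : ι → ℕ}, RL d c n c₀ m → (∀ i, HomEl δ (n i)) → M)
    (hadd : ∀ {n : ι → ℕ} (o : RL d c n c₀ m) (x : ∀ i, HomEl δ (n i)) i p a b,
      F o (Function.update x i ⟨p, a + b⟩) =
        F o (Function.update x i ⟨p, a⟩) + F o (Function.update x i ⟨p, b⟩))
    (hnat : ∀ {n n' : ι → ℕ} (o : RL d c n c₀ m) (f : ∀ i, Fin (n' i + 1) →o Fin (n i + 1))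
      (x : ∀ i, HomEl δ (n' i)), F (o.pre f) x = F o fun i => (x i).map (f i)) :
    Xi δ d c c₀ m →ₗ[ℤ] M :=
  Submodule.liftQ _ (Finsupp.linearCombination ℤ fun g => F g.op g.x) (by
    rw [Submodule.span_le]
    rintro _ (⟨o, x, i, p, a, b⟩ | ⟨o, f, x⟩)
    · simp [gen, hadd]
    · simp [gen, hnat])

@[simp] theorem lift_mk {M : Type*} [AddCommGroup M]
    (F : ∀ {n : ι → ℕ}, RL d c n c₀ m → (∀ i, HomEl δ (n i)) → M) (hadd) (hnat) {n : ι → ℕ}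
    (o : RL d c n c₀ m) (x : ∀ i, HomEl δ (n i)) : lift F hadd hnat (mk o x) = F o x := by
  simp [lift, mk, gen]

theorem span_mk :
    Submodule.span ℤ {z : Xi δ d c c₀ m | ∃ n, ∃ o : RL d c n c₀ m, ∃ x, z = mk o x} = ⊤ := by
  rw [eq_top_iff]
  rintro x -
  obtain ⟨u, rfl⟩ := Submodule.Quotient.mk_surjective _ x
  induction u using Finsupp.induction_linear with
  | zero => exact Submodule.zero_mem _
  | add u v hu hv => exact Submodule.add_mem _ hu hv
  | single g k =>
    have : (Submodule.Quotient.mk (Finsupp.single g k) : Xi δ d c c₀ m) = k • mk g.op g.x := by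
      rw [mk, gen, ← Submodule.Quotient.mk_smul]
      simp
    rw [this]
    exact Submodule.smul_mem _ _ (Submodule.subset_span ⟨g.n, g.op, g.x, rfl⟩)

theorem hom_ext {M : Type*} [AddCommGroup M] {F G : Xi δ d c c₀ m →ₗ[ℤ] M}
    (h : ∀ {n} (o : RL d c n c₀ m) x, F (mk o x) = G (mk o x)) : F = G := by
  refine LinearMap.ext_on span_mk ?_
  rintro _ ⟨n, o, x, rfl⟩
  exact h o x

/-- A representative of a class. -/
def rep (z : Xi δ d c c₀ m) : Gen δ d c c₀ m →₀ ℤ :=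
  Function.surjInv (Submodule.Quotient.mk_surjective _) z

theorem mk_rep (z : Xi δ d c c₀ m) : Submodule.Quotient.mk (rep z) = z :=
  Function.surjInv_eq _ _

/-- The cosimplicial structure. -/
def map {m' : ℕ} (f : Fin (m + 1) →o Fin (m' + 1)) : Xi δ d c c₀ m →ₗ[ℤ] Xi δ d c c₀ m' :=
  lift (fun o x => mk (o.post f) x) (fun o x i p a b => mk_add (o.post f) x i p a b)
    (fun o g x => by rw [RL.post_pre, mk_nat])

@[simp] theorem map_mk {m' : ℕ} (f : Fin (m + 1) →o Fin (m' + 1)) {n : ι → ℕ}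
    (o : RL d c n c₀ m) (x : ∀ i, HomEl δ (n i)) : map f (mk o x) = mk (o.post f) x :=
  lift_mk _ _ _ _ _

/-- The submodule of elements of total degree `k`. -/
def deg [Fintype ι] (k : ℤ) : Submodule ℤ (Xi δ d c c₀ m) :=
  Submodule.span ℤ {z | ∃ n, ∃ o : RL d c n c₀ m, ∃ x : ∀ i, HomEl δ (n i),
    ∑ i, ((x i).deg : ℤ) = k ∧ z = mk o x}

theorem mk_mem_deg [Fintype ι] {n : ι → ℕ} (o : RL d c n c₀ m) (x : ∀ i, HomEl δ (n i)) {k : ℤ}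
    (h : ∑ i, ((x i).deg : ℤ) = k) : mk o x ∈ (deg k : Submodule ℤ (Xi δ d c c₀ m)) :=
  Submodule.subset_span ⟨n, o, x, h, rfl⟩

theorem map_deg {ι' : Type} [LinearOrder ι'] [Fintype ι] [Fintype ι'] {c' : ι' → Clr} {c₀' : Clr}
    {m' : ℕ} (F : Xi δ d c c₀ m →ₗ[ℤ] Xi δ d c' c₀' m') {k k' : ℤ}
    (h : ∀ {n} (o : RL d c n c₀ m) (x : ∀ i, HomEl δ (n i)), ∑ i, ((x i).deg : ℤ) = k →
      F (mk o x) ∈ (deg k' : Submodule ℤ (Xi δ d c' c₀' m')))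
    {z : Xi δ d c c₀ m} (hz : z ∈ (deg k : Submodule ℤ (Xi δ d c c₀ m))) :
    F z ∈ (deg k' : Submodule ℤ (Xi δ d c' c₀' m')) := by
  have : deg k ≤ (deg k').comap F := by
    refine Submodule.span_le.2 ?_
    rintro _ ⟨n, o, x, hx, rfl⟩
    exact h o x hx
  exact this hz

/-- The degrees of the entries only depend on the degree of the `i`-th one. -/
theorem deg_update {n : ι → ℕ} (x : ∀ i, HomEl δ (n i)) (i : ι) (y : HomEl δ (n i)) (j : ι) :
    (Function.update x i y j).deg = if j = i then y.deg else (x j).deg := by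
  split_ifs with h
  · subst h; simp
  · simp [h]

/-- The differential: `∂ (o ⊗ x) = ∑ i, (-1) ^ (|x_1| + ⋯ + |x_{i-1}|) o ⊗ x_1 ⊗ ⋯ ⊗ d x_i ⊗ ⋯`. -/
def diff [Fintype ι] : Xi δ d c c₀ m →ₗ[ℤ] Xi δ d c c₀ m :=
  lift (fun o x => ∑ i, sgn (∑ j with j < i, ((x j).deg : ℤ)) •
      mk o (Function.update x i (x i).diff))
    (by
      intro n o x k p a b
      rw [← Finset.sum_add_distrib]
      refine Finset.sum_congr rfl fun i _ => ?_
      simp only [deg_update]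
      rw [← smul_add]
      congr 1
      by_cases h : i = k
      · subst h
        have e : (HomEl.mk p (a + b)).diff = ⟨p - 1, coD δ (n i) p a + coD δ (n i) p b⟩ := by
          rw [← map_add]; rfl
        rw [Function.update_self, Function.update_self, Function.update_self, Function.update_idem,
          Function.update_idem, Function.update_idem, e, mk_add o x i (p - 1)]
        rfl
      · simp only [Function.update_of_ne h, Function.update_comm (Ne.symm h)]
        exact mk_add o _ k p a b)
    (by
      intro n n' o f x
      refine Finset.sum_congr rfl fun i _ => ?_
      congr 1
      rw [mk_nat]
      congr 1
      funext j
      by_cases h : j = i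
      · subst h; simp [HomEl.map_diff]
      · simp [h])

@[simp] theorem diff_mk [Fintype ι] {n : ι → ℕ} (o : RL d c n c₀ m) (x : ∀ i, HomEl δ (n i)) :
    diff (mk o x) = ∑ i, sgn (∑ j with j < i, ((x j).deg : ℤ)) •
      mk o (Function.update x i (x i).diff) :=
  lift_mk _ _ _ _ _

theorem diff_deg [Fintype ι] {k : ℤ} {z : Xi δ d c c₀ m}
    (hz : z ∈ (deg k : Submodule ℤ (Xi δ d c c₀ m))) :
    diff z ∈ (deg (k - 1) : Submodule ℤ (Xi δ d c c₀ m)) := by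
  refine map_deg diff (fun {n} o x h => ?_) hz
  rw [diff_mk]
  refine Submodule.sum_mem _ fun i _ => Submodule.smul_mem _ _ ?_
  rcases hx : x i with ⟨p, v⟩
  cases p with
  | zero =>
    have : (HomEl.mk 0 v).diff = ⟨0, 0⟩ := by
      unfold HomEl.diff
      simp only [coD_zero]
      rfl
    rw [this, mk_zero]
    exact Submodule.zero_mem _
  | succ p =>
    refine mk_mem_deg _ _ ?_
    rw [← Finset.add_sum_erase _ _ (Finset.mem_univ i)] at h ⊢
    have h2 : ∀ j ∈ Finset.univ.erase i,
        ((Function.update x i (HomEl.mk (p + 1) v).diff j).deg : ℤ) = (x j).deg := by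
      intro j hj
      rw [Function.update_of_ne (Finset.ne_of_mem_erase hj)]
    rw [Finset.sum_congr rfl h2, ← h, Function.update_self, hx]
    simp only [HomEl.diff]
    push_cast
    simp
    ring

theorem map_diff [Fintype ι] {m' : ℕ} (f : Fin (m + 1) →o Fin (m' + 1)) (z : Xi δ d c c₀ m) :
    map f (diff z) = diff (map f z) := by
  have : (map f).comp diff = (diff : Xi δ d c c₀ m' →ₗ[ℤ] _).comp (map f) := by
    refine hom_ext fun o x => ?_
    simp only [LinearMap.comp_apply, diff_mk, map_mk, map_sum, map_smul]
  exact congrArg (fun F => F z) this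

end Xi

/-- The sign by which the permutation `e` acts on elements of degrees `p i`. -/
def koszul {ι ι' : Type} [LinearOrder ι] [LinearOrder ι'] [Fintype ι'] (e : ι' ≃ ι) (p : ι → ℤ) :
    ℤ :=
  sgn (∑ ij : ι' × ι' with ij.1 < ij.2 ∧ e ij.2 < e ij.1, p (e ij.1) * p (e ij.2))

namespace Xi
variable {ι' : Type} [LinearOrder ι'] [Fintype ι'] (e : ι' ≃ ι)

/-- The action of permutations. -/
def symm : Xi δ d c c₀ m →ₗ[ℤ] Xi δ d (fun i => c (e i)) c₀ m :=
  lift (fun o x => koszul e (fun i => (x i).deg) • mk (o.reindex e) fun i => x (e i))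
    (by
      intro n o x k p a b
      simp only [deg_update]
      rw [← smul_add]
      congr 1
      obtain ⟨k, rfl⟩ := e.surjective k
      have h : ∀ y : HomEl δ (n (e k)), (fun i => Function.update x (e k) y (e i)) =
          Function.update (fun i => x (e i)) k y := by
        intro y
        funext i
        by_cases h : i = k
        · subst h; simp
        · rw [Function.update_of_ne (fun h' => h (e.injective h')), Function.update_of_ne h]
      rw [h, h, h, mk_add (o.reindex e) (fun i => x (e i)) k p a b])
    (by
      intro n n' o f x
      congr 1
      rw [RL.reindex_pre, mk_nat])

@[simp] theorem symm_mk {n : ι → ℕ} (o : RL d c n c₀ m) (x : ∀ i, HomEl δ (n i)) :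
    symm e (mk o x) = koszul e (fun i => (x i).deg) • mk (o.reindex e) fun i => x (e i) :=
  lift_mk _ _ _ _ _

theorem symm_deg [Fintype ι] {k : ℤ} {z : Xi δ d c c₀ m}
    (hz : z ∈ (deg k : Submodule ℤ (Xi δ d c c₀ m))) :
    symm e z ∈ (deg k : Submodule ℤ (Xi δ d (fun i => c (e i)) c₀ m)) := by
  refine map_deg (symm e) (fun {n} o x h => ?_) hz
  rw [symm_mk]
  refine Submodule.smul_mem _ _ (mk_mem_deg _ _ ?_)
  rw [← h]
  exact Equiv.sum_comp e fun i => ((x i).deg : ℤ)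

theorem map_symm {m' : ℕ} (f : Fin (m + 1) →o Fin (m' + 1)) (z : Xi δ d c c₀ m) :
    map f (symm e z) = symm e (map f z) := by
  have : (map f).comp (symm e) =
      (symm e : Xi δ d c c₀ m' →ₗ[ℤ] _).comp (map f) := by
    refine hom_ext fun o x => ?_
    simp only [LinearMap.comp_apply, symm_mk, map_mk, map_smul, RL.reindex_post]
  exact congrArg (fun F => F z) this

end Xi
end
end Coend

noncomputable section CoendOperad
open CategoryTheory

theorem multilinear_mem_of_span {ι : Type} [Fintype ι] {M : ι → Type*} {N : Type*}
    [∀ i, AddCommGroup (M i)] [AddCommGroup N] (F : MultilinearMap ℤ M N) (s : ∀ i, Set (M i))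
    (S : Submodule ℤ N) (h : ∀ u, (∀ i, u i ∈ s i) → F u ∈ S) (u : ∀ i, M i)
    (hu : ∀ i, u i ∈ Submodule.span ℤ (s i)) : F u ∈ S := by
  classical
  have key : ∀ t : Finset ι, ∀ u : ∀ i, M i, (∀ i ∈ t, u i ∈ Submodule.span ℤ (s i)) →
      (∀ i ∉ t, u i ∈ s i) → F u ∈ S := by
    intro t
    induction t using Finset.induction_on with
    | empty => intro u _ h2; exact h u fun i => h2 i (by simp)
    | insert j t hj ih =>
      intro u h1 h2
      have hle : Submodule.span ℤ (s j) ≤ S.comap (F.toLinearMap u j) := by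
        refine Submodule.span_le.2 fun z hz => ?_
        refine ih (Function.update u j z) (fun i hi => ?_) (fun i hi => ?_)
        · have : i ≠ j := fun h => hj (h ▸ hi)
          rw [Function.update_of_ne this]
          exact h1 i (Finset.mem_insert_of_mem hi)
        · by_cases hij : i = j
          · subst hij; simpa using hz
          · rw [Function.update_of_ne hij]
            exact h2 i (by simp [hij, hi])
      have := hle (h1 j (Finset.mem_insert_self _ _))
      simpa using this
  exact key Finset.univ u (fun i _ => hu i) (fun i hi => absurd (Finset.mem_univ i) hi)

variable {δ : SimplexCategory ⥤ ChainComplex (ModuleCat.{0} ℤ) ℕ}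
variable {ι : Type} [LinearOrder ι] [Fintype ι] {d : ℕ} {c : ι → Clr} {c₀ : Clr} {m : ℕ}
variable {κ : ι → Type} [∀ i, LinearOrder (κ i)] {c' : ∀ i, κ i → Clr}

/-- Auxiliary form of the substitution below. -/
def substGen {n : ι → ℕ} (o : RL d c n c₀ m) :
    MultilinearMap ℤ (fun i => Gen δ d (c' i) (c i) (n i) →₀ ℤ)
      (Xi δ d (fun t : Σₗ i, κ i => c' (ofLex t).1 (ofLex t).2) c₀ m) :=
  ((Basis.piTensorProduct fun i => (Finsupp.basisSingleOne (R := ℤ)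
      (ι := Gen δ d (c' i) (c i) (n i)))).constr ℤ fun a =>
    Xi.mk (o.comp fun i => (a i).op) fun t => (a (ofLex t).1).x (ofLex t).2).compMultilinearMap
    (PiTensorProduct.tprod ℤ)

theorem substGen_gen {n : ι → ℕ} (o : RL d c n c₀ m) {k : ∀ i, κ i → ℕ}
    (y : ∀ i, RL d (c' i) (k i) (c i) (n i)) (x : ∀ i j, HomEl δ (k i j)) :
    substGen o (fun i => gen (y i) (x i)) =
      Xi.mk (o.comp y) fun t => x (ofLex t).1 (ofLex t).2 := by
  unfold substGen
  rw [LinearMap.compMultilinearMap_apply]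
  have : PiTensorProduct.tprod ℤ (fun i => gen (y i) (x i)) =
      Basis.piTensorProduct (fun i => (Finsupp.basisSingleOne (R := ℤ)
      (ι := Gen δ d (c' i) (c i) (n i)))) fun i => ⟨k i, y i, x i⟩ := by
    rw [Basis.piTensorProduct_apply]
    rfl
  rw [this, Module.Basis.constr_basis]

theorem lex_update {ι : Type} [DecidableEq ι] {κ : ι → Type} [∀ i, DecidableEq (κ i)]
    [DecidableEq (Σₗ i, κ i)] {β : ∀ i, κ i → Type} (F : ∀ i j, β i j) (i₀ : ι) (j₀ : κ i₀)
    (v : β i₀ j₀) :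
    (fun t : Σₗ i, κ i => Function.update F i₀ (Function.update (F i₀) j₀ v) (ofLex t).1
      (ofLex t).2) =
    Function.update (β := fun t : Σₗ i, κ i => β (ofLex t).1 (ofLex t).2)
      (fun t => F (ofLex t).1 (ofLex t).2) (toLex ⟨i₀, j₀⟩) v := by
  refine Function.eq_update_iff.2 ⟨?_, ?_⟩
  · change Function.update F i₀ (Function.update (F i₀) j₀ v) i₀ j₀ = v
    simp
  · rintro ⟨i, j⟩ h
    change Function.update F i₀ (Function.update (F i₀) j₀ v) i j = F i j
    by_cases hi : i = i₀
    · subst hi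
      rw [Function.update_self, Function.update_of_ne]
      rintro rfl
      exact h rfl
    · rw [Function.update_of_ne hi]

/-- Data for a naturality relation. -/
structure NatGen (δ : SimplexCategory ⥤ ChainComplex (ModuleCat.{0} ℤ) ℕ) {ι : Type}
    [LinearOrder ι] (d : ℕ) (c : ι → Clr) (c₀ : Clr) (m : ℕ) where
  n : ι → ℕ
  n' : ι → ℕ
  op : RL d c n c₀ m
  f : ∀ i, Fin (n' i + 1) →o Fin (n i + 1)
  x : ∀ i, HomEl δ (n' i)

theorem substGen_rel {n : ι → ℕ} (o : RL d c n c₀ m)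
    (u : ∀ i, Gen δ d (c' i) (c i) (n i) →₀ ℤ) (i₀ : ι)
    (hu : u i₀ ∈ Submodule.span ℤ {r : Gen δ d (c' i₀) (c i₀) (n i₀) →₀ ℤ | Rel r}) :
    substGen o u = 0 := by
  classical
  have key := multilinear_mem_of_span (substGen (δ := δ) (c' := c') o)
    (fun i => {r | (i = i₀ → Rel r) ∧ (i ≠ i₀ → ∃ a, r = Finsupp.single a 1)}) ⊥ ?_ u ?_
  · simpa using key
  · intro u hu
    rw [Submodule.mem_bot]
    have h0 : Rel (u i₀) := (hu i₀).1 rfl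
    have h1 : ∀ i, i ≠ i₀ → ∃ a, u i = Finsupp.single a 1 := fun i => (hu i).2
    clear hu
    generalize hr : u i₀ = r at h0
    have hur : u = Function.update u i₀ r := by rw [← hr, Function.update_eq_self]
    rw [hur]
    have hr' : (∃ g : Gen δ d (c' i₀) (c i₀) (n i₀), ∃ j p a b,
        r = gen g.op (Function.update g.x j ⟨p, a + b⟩) -
          gen g.op (Function.update g.x j ⟨p, a⟩) - gen g.op (Function.update g.x j ⟨p, b⟩)) ∨
        ∃ g : NatGen δ d (c' i₀) (c i₀) (n i₀),
          r = gen (g.op.pre g.f) g.x - gen g.op fun i => (g.x i).map (g.f i) := by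
      cases h0 with
      | add y x j p a b => exact Or.inl ⟨⟨_, y, x⟩, j, p, a, b, rfl⟩
      | nat y f x => exact Or.inr ⟨⟨_, _, y, f, x⟩, rfl⟩
    rcases hr' with ⟨g, j, p, a, b, rfl⟩ | ⟨g, rfl⟩
    · have hA : ∀ i, ∃ A : Gen δ d (c' i) (c i) (n i),
          (i ≠ i₀ → u i = Finsupp.single A 1) ∧ (i = i₀ → HEq A g) := by
        intro i
        by_cases h : i = i₀
        · subst h; exact ⟨g, fun h => absurd rfl h, fun _ => HEq.rfl⟩
        · obtain ⟨A, hA⟩ := h1 i h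
          exact ⟨A, fun _ => hA, fun h' => absurd h' h⟩
      choose A hA hA0 using hA
      obtain rfl : A i₀ = g := eq_of_heq (hA0 i₀ rfl)
      have e : ∀ v : HomEl δ ((A i₀).n j),
          substGen o (Function.update u i₀ (gen (A i₀).op (Function.update (A i₀).x j v))) =
          Xi.mk (o.comp fun i => (A i).op) (Function.update
            (fun t : Σₗ i, κ i => (A (ofLex t).1).x (ofLex t).2) (toLex ⟨i₀, j⟩) v) := by
        intro v
        have h2 : Function.update u i₀ (gen (A i₀).op (Function.update (A i₀).x j v)) =
            fun i => gen (A i).op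
              (Function.update (fun i => (A i).x) i₀ (Function.update (A i₀).x j v) i) := by
          funext i
          by_cases h : i = i₀
          · subst h; simp
          · rw [Function.update_of_ne h, Function.update_of_ne h, hA i h]
            rfl
        rw [h2, substGen_gen]
        congr 1
        exact lex_update (fun i => (A i).x) i₀ j v
      rw [MultilinearMap.map_update_sub, MultilinearMap.map_update_sub, e, e, e, sub_sub,
        sub_eq_zero]
      exact Xi.mk_add _ _ _ _ _ _
    · have hA : ∀ i, ∃ A : NatGen δ d (c' i) (c i) (n i),
          (i ≠ i₀ → u i = gen (A.op.pre A.f) A.x ∧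
            u i = gen A.op fun j => (A.x j).map (A.f j)) ∧ (i = i₀ → HEq A g) := by
        intro i
        by_cases h : i = i₀
        · subst h; exact ⟨g, fun h => absurd rfl h, fun _ => HEq.rfl⟩
        · obtain ⟨A, hA⟩ := h1 i h
          refine ⟨⟨A.n, A.n, A.op, fun _ => OrderHom.id, A.x⟩, fun _ => ⟨?_, ?_⟩,
            fun h' => absurd h' h⟩
          · rw [RL.pre_id, hA]; rfl
          · simp only [HomEl.map_id]; rw [hA]; rfl
      choose A hA hA0 using hA
      obtain rfl : A i₀ = g := eq_of_heq (hA0 i₀ rfl)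
      have e1 : Function.update u i₀ (gen ((A i₀).op.pre (A i₀).f) (A i₀).x) =
          fun i => gen ((A i).op.pre (A i).f) (A i).x := by
        funext i
        by_cases h : i = i₀
        · subst h; simp
        · rw [Function.update_of_ne h, (hA i h).1]
      have e2 : Function.update u i₀ (gen (A i₀).op fun j => ((A i₀).x j).map ((A i₀).f j)) =
          fun i => gen (A i).op fun j => ((A i).x j).map ((A i).f j) := by
        funext i
        by_cases h : i = i₀
        · subst h; simp
        · rw [Function.update_of_ne h, (hA i h).2]
      rw [MultilinearMap.map_update_sub, e1, e2, substGen_gen, substGen_gen, RL.comp_pre_right,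
        Xi.mk_nat, sub_eq_zero]
  · intro i
    by_cases h : i = i₀
    · subst h
      refine Submodule.span_mono ?_ hu
      intro r hr
      exact ⟨fun _ => hr, fun h => absurd rfl h⟩
    · have : u i ∈ Submodule.span ℤ (Set.range fun a => Finsupp.single a (1 : ℤ)) := by
        have h2 := (Finsupp.basisSingleOne (R := ℤ) (ι := Gen δ d (c' i) (c i) (n i))).span_eq
        rw [Finsupp.coe_basisSingleOne] at h2
        rw [h2]
        trivial
      refine Submodule.span_mono ?_ this
      rintro _ ⟨a, rfl⟩
      exact ⟨fun h' => absurd h' h, fun _ => ⟨a, rfl⟩⟩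

theorem substGen_congr {n : ι → ℕ} (o : RL d c n c₀ m)
    (u v : ∀ i, Gen δ d (c' i) (c i) (n i) →₀ ℤ)
    (h : ∀ i, (Submodule.Quotient.mk (u i) : Xi δ d (c' i) (c i) (n i)) =
      Submodule.Quotient.mk (v i)) : substGen o u = substGen o v := by
  have key : ∀ t : Finset ι, substGen o (t.piecewise u v) = substGen o v := by
    intro t
    induction t using Finset.induction_on with
    | empty => rw [Finset.piecewise_empty]
    | insert j t hj ih =>
      rw [Finset.piecewise_insert, ← ih]
      set w := t.piecewise u v with hw
      have hwj : w j = v j := Finset.piecewise_eq_of_notMem _ _ _ hj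
      rw [← sub_eq_zero]
      conv_lhs => rw [← Function.update_eq_self j w]
      rw [Function.update_idem, ← MultilinearMap.map_update_sub]
      refine substGen_rel o _ j ?_
      rw [Function.update_self, hwj]
      exact (Submodule.Quotient.eq _).1 (h j)
  have := key Finset.univ
  rwa [Finset.piecewise_univ] at this

namespace Xi

/-- The multilinear substitution of elements of the coends for the inputs of an operation,
`(o; (o_i ⊗ x_{i,1} ⊗ ⋯)_i) ↦ o(o_1, …, o_k) ⊗ x_{1,1} ⊗ ⋯`. -/
def subst {n : ι → ℕ} (o : RL d c n c₀ m) :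
    MultilinearMap ℤ (fun i => Xi δ d (c' i) (c i) (n i))
      (Xi δ d (fun t : Σₗ i, κ i => c' (ofLex t).1 (ofLex t).2) c₀ m) :=
  MultilinearMap.mk' (fun z => substGen o fun i => rep (z i))
    (by
      intro z i a b
      have h : ∀ w, (substGen o fun j => rep (Function.update z i w j)) =
          substGen o (Function.update (fun j => rep (z j)) i (rep w)) := by
        intro w
        congr 1
        funext j
        by_cases h : j = i
        · subst h; simp
        · simp [h]
      rw [h, h, h, ← MultilinearMap.map_update_add]
      refine substGen_congr o _ _ fun j => ?_
      by_cases h : j = i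
      · subst h; simp only [Function.update_self, Submodule.Quotient.mk_add, mk_rep]
      · simp [h])
    (by
      intro z i k a
      have h : ∀ w, (substGen o fun j => rep (Function.update z i w j)) =
          substGen o (Function.update (fun j => rep (z j)) i (rep w)) := by
        intro w
        congr 1
        funext j
        by_cases h : j = i
        · subst h; simp
        · simp [h]
      rw [h, h, ← MultilinearMap.map_update_smul]
      refine substGen_congr o _ _ fun j => ?_
      by_cases h : j = i
      · subst h; simp only [Function.update_self, Submodule.Quotient.mk_smul, mk_rep]
      · simp [h])

theorem subst_mk {n : ι → ℕ} (o : RL d c n c₀ m) {k : ∀ i, κ i → ℕ}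
    (y : ∀ i, RL d (c' i) (k i) (c i) (n i)) (x : ∀ i j, HomEl δ (k i j)) :
    subst o (fun i => mk (y i) (x i)) = mk (o.comp y) fun t => x (ofLex t).1 (ofLex t).2 := by
  rw [← substGen_gen]
  exact substGen_congr o _ _ fun i => mk_rep _

theorem subst_ext {ι : Type} [LinearOrder ι] [Fintype ι] {c : ι → Clr} {κ : ι → Type}
    [∀ i, LinearOrder (κ i)] {c' : ∀ i, κ i → Clr} {N : Type*} [AddCommGroup N] {n : ι → ℕ}
    (F G : MultilinearMap ℤ (fun i => Xi δ d (c' i) (c i) (n i)) N)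
    (h : ∀ {k : ∀ i, κ i → ℕ} (y : ∀ i, RL d (c' i) (k i) (c i) (n i))
      (x : ∀ i j, HomEl δ (k i j)), F (fun i => mk (y i) (x i)) = G fun i => mk (y i) (x i)) :
    F = G := by
  ext u
  have := multilinear_mem_of_span (F - G)
    (fun i => {z | ∃ k, ∃ o : RL d (c' i) k (c i) (n i), ∃ x, z = mk o x}) ⊥ ?_ u
    (fun i => by rw [span_mk]; trivial)
  · simpa [sub_eq_zero] using this
  · intro u hu
    choose k y x hu using hu
    obtain rfl : u = fun i => mk (y i) (x i) := funext hu
    simp [h]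

theorem subst_post {n : ι → ℕ} {m' : ℕ} (o : RL d c n c₀ m) (f : Fin (m + 1) →o Fin (m' + 1))
    (z : ∀ i, Xi δ d (c' i) (c i) (n i)) : subst (o.post f) z = map f (subst o z) := by
  have : subst (δ := δ) (c' := c') (o.post f) = (map f).compMultilinearMap (subst o) := by
    refine subst_ext _ _ fun y x => ?_
    rw [LinearMap.compMultilinearMap_apply, subst_mk, subst_mk, map_mk, RL.comp_post]
  rw [this]
  rfl

theorem subst_pre {n n' : ι → ℕ} (o : RL d c n c₀ m) (f : ∀ i, Fin (n' i + 1) →o Fin (n i + 1))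
    (z : ∀ i, Xi δ d (c' i) (c i) (n' i)) :
    subst (o.pre f) z = subst o fun i => map (f i) (z i) := by
  have : subst (δ := δ) (c' := c') (o.pre f) =
      (subst o).compLinearMap fun i => map (f i) := by
    refine subst_ext _ _ fun y x => ?_
    rw [MultilinearMap.compLinearMap_apply, subst_mk]
    simp only [map_mk]
    rw [subst_mk, RL.comp_pre_left]
  rw [this]
  rfl

theorem subst_deg [∀ i, Fintype (κ i)] {n : ι → ℕ} (o : RL d c n c₀ m) (e : ι → ℤ)
    (z : ∀ i, Xi δ d (c' i) (c i) (n i))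
    (hz : ∀ i, z i ∈ (deg (e i) : Submodule ℤ (Xi δ d (c' i) (c i) (n i)))) :
    subst o z ∈ (deg (∑ i, e i) :
      Submodule ℤ (Xi δ d (fun t : Σₗ i, κ i => c' (ofLex t).1 (ofLex t).2) c₀ m)) := by
  refine multilinear_mem_of_span (subst o) _ _ ?_ z hz
  intro u hu
  choose k y x hx hu using hu
  obtain rfl : u = fun i => mk (y i) (x i) := funext hu
  rw [subst_mk]
  refine mk_mem_deg _ _ ?_
  rw [← Finset.sum_congr rfl fun i _ => hx i]
  have := Fintype.sum_equiv (toLex : (Σ i, κ i) ≃ _root_.Lex (Σ i, κ i))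
    (fun t : Σ i, κ i => ((x t.1 t.2).deg : ℤ))
    (fun t => ((x (ofLex t).1 (ofLex t).2).deg : ℤ)) (fun t => rfl)
  rw [← this, Fintype.sum_sigma]

end Xi

variable (δ d c c₀) in
/-- The homogeneous part of degree `m` of the complex `Coend_{RL_d}(δ)(c; c₀)`, that is of
`Hom_Δ(δ, ξ(RL_d)_{c; c₀}(δ, …, δ))`: families of linear maps from `δ n` to the coend, natural
in `n`, which raise degrees by `m`. -/
def Coend (m : ℤ) : Submodule ℤ (∀ n p : ℕ, El δ n p →ₗ[ℤ] Xi δ d c c₀ n) where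
  carrier := {f | (∀ (n p : ℕ) x, f n p x ∈ (Xi.deg (p + m) : Submodule ℤ (Xi δ d c c₀ n))) ∧
    ∀ k l (ψ : Fin (k + 1) →o Fin (l + 1)) (p : ℕ) x, f l p (coMap δ ψ p x) = Xi.map ψ (f k p x)}
  zero_mem' := by
    refine ⟨fun n p x => Submodule.zero_mem _, fun k l ψ p x => ?_⟩
    simp
  add_mem' := by
    rintro f g ⟨h1, h2⟩ ⟨h3, h4⟩
    refine ⟨fun n p x => Submodule.add_mem _ (h1 n p x) (h3 n p x), fun k l ψ p x => ?_⟩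
    simp [h2, h4]
  smul_mem' := by
    rintro a f ⟨h1, h2⟩
    refine ⟨fun n p x => Submodule.smul_mem _ _ (h1 n p x), fun k l ψ p x => ?_⟩
    simp only [Pi.smul_apply, LinearMap.smul_apply, h2, map_smul]

namespace Coend

/-- The differential `f ↦ ∂ ∘ f - (-1) ^ |f| f ∘ d`. -/
def diff {m : ℤ} (f : Coend δ d c c₀ m) : Coend δ d c c₀ (m - 1) :=
  ⟨fun n p => Xi.diff ∘ₗ f.1 n p - sgn m • (f.1 n (p - 1) ∘ₗ coD δ n p), by
    obtain ⟨f, h1, h2⟩ := f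
    refine ⟨fun n p x => ?_, fun k l ψ p x => ?_⟩
    · refine Submodule.sub_mem _ ?_ (Submodule.smul_mem _ _ ?_)
      · have := Xi.diff_deg (h1 n p x)
        rwa [add_sub_assoc] at this
      · cases p with
        | zero =>
          rw [coD_zero, LinearMap.comp_zero]
          exact Submodule.zero_mem _
        | succ p =>
          have := h1 n p (coD δ n (p + 1) x)
          have e : (((p + 1 : ℕ) : ℤ) + (m - 1)) = p + m := by push_cast; ring
          rw [e]
          exact this
    · simp only [LinearMap.sub_apply, LinearMap.comp_apply, LinearMap.smul_apply, h2, map_sub,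
        map_smul, Xi.map_diff, ← coMap_coD]⟩

/-- The action of permutations. -/
def symm {ι' : Type} [LinearOrder ι'] [Fintype ι'] {m : ℤ} (f : Coend δ d c c₀ m) (e : ι' ≃ ι) :
    Coend δ d (fun i => c (e i)) c₀ m :=
  ⟨fun n p => Xi.symm e ∘ₗ f.1 n p, fun n p x => Xi.symm_deg e (f.2.1 n p x), fun k l ψ p x => by
    rw [LinearMap.comp_apply, f.2.2, LinearMap.comp_apply, Xi.map_symm]⟩

theorem one_add (δ : SimplexCategory ⥤ ChainComplex (ModuleCat.{0} ℤ) ℕ) (d : ℕ) (c₀ : Clr)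
    (n p : ℕ) (a b : El δ n p) :
    Xi.mk (n := fun _ : Unit => n) (RL.unary d c₀ OrderHom.id) (fun _ => ⟨p, a + b⟩) =
      Xi.mk (n := fun _ : Unit => n) (RL.unary d c₀ OrderHom.id) (fun _ => ⟨p, a⟩) +
        Xi.mk (n := fun _ : Unit => n) (RL.unary d c₀ OrderHom.id) (fun _ => ⟨p, b⟩) :=
  Xi.mk_add_of_eq _ _ _ _ () p a b rfl rfl rfl
    (fun j h => absurd (Subsingleton.elim j ()) h) (fun j h => absurd (Subsingleton.elim j ()) h)

/-- The unit `x ↦ id ⊗ x`, as a family of maps. -/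
def oneFun (δ : SimplexCategory ⥤ ChainComplex (ModuleCat.{0} ℤ) ℕ) (d : ℕ) (c₀ : Clr)
    (n p : ℕ) : El δ n p →ₗ[ℤ] Xi δ d (fun _ : Unit => c₀) c₀ n where
  toFun x := Xi.mk (n := fun _ : Unit => n) (RL.unary d c₀ OrderHom.id) fun _ => ⟨p, x⟩
  map_add' := one_add δ d c₀ n p
  map_smul' k a := by
    simpa using map_intCast_smul (AddMonoidHom.mk' (fun x : El δ n p =>
      Xi.mk (n := fun _ : Unit => n) (RL.unary d c₀ OrderHom.id) fun _ => ⟨p, x⟩)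
      (one_add δ d c₀ n p)) ℤ ℤ k a

/-- The unit `x ↦ id ⊗ x`. -/
def one (δ : SimplexCategory ⥤ ChainComplex (ModuleCat.{0} ℤ) ℕ) (d : ℕ) (c₀ : Clr) :
    Coend δ d (fun _ : Unit => c₀) c₀ 0 :=
  ⟨oneFun δ d c₀, by
    refine ⟨fun n p x => ?_, fun k l ψ p x => ?_⟩
    · refine Xi.mk_mem_deg (ι := Unit) (n := fun _ => n) _ _ ?_
      simp
    · refine Eq.trans ?_ (Xi.map_mk (δ := δ) ψ (n := fun _ : Unit => k)
        (RL.unary d c₀ (OrderHom.id : Fin (k + 1) →o _)) (fun _ => ⟨p, x⟩)).symm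
      rw [RL.unary_post_pre, Xi.mk_nat]
      rfl⟩

/-- Evaluation on homogeneous elements. -/
def eval {m : ℤ} (f : Coend δ d c c₀ m) {n : ℕ} (x : HomEl δ n) : Xi δ d c c₀ n :=
  f.1 n x.deg x.val

theorem eval_add {m : ℤ} (f : Coend δ d c c₀ m) {n p : ℕ} (a b : El δ n p) :
    eval f ⟨p, a + b⟩ = eval f ⟨p, a⟩ + eval f ⟨p, b⟩ := map_add _ _ _

theorem eval_map {m : ℤ} (f : Coend δ d c c₀ m) {k l : ℕ} (ψ : Fin (k + 1) →o Fin (l + 1))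
    (x : HomEl δ k) : eval f (x.map ψ) = Xi.map ψ (eval f x) := f.2.2 _ _ _ _ _

variable [∀ i, Fintype (κ i)] {e : ι → ℤ}

theorem subst_eval_add (g : ∀ i, Coend δ d (c' i) (c i) (e i)) {m : ℕ} {n : ι → ℕ}
    (o : RL d c n c₀ m) (x : ∀ i, HomEl δ (n i)) (k : ι) (p : ℕ) (a b : El δ (n k) p) :
    Xi.subst o (fun i => eval (g i) (Function.update x k ⟨p, a + b⟩ i)) =
      Xi.subst o (fun i => eval (g i) (Function.update x k ⟨p, a⟩ i)) +
        Xi.subst o (fun i => eval (g i) (Function.update x k ⟨p, b⟩ i)) := by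
  have h : ∀ v, (fun i => eval (g i) (Function.update x k v i)) =
      Function.update (fun i => eval (g i) (x i)) k (eval (g k) v) := by
    intro v
    funext i
    by_cases h : i = k
    · subst h; simp
    · simp [h]
  rw [h, h, h, eval_add]
  exact (Xi.subst o).map_update_add _ k _ _

theorem subst_eval_map (g : ∀ i, Coend δ d (c' i) (c i) (e i)) {m : ℕ} {n n' : ι → ℕ}
    (o : RL d c n c₀ m) (f : ∀ i, Fin (n' i + 1) →o Fin (n i + 1)) (x : ∀ i, HomEl δ (n' i)) :
    Xi.subst (o.pre f) (fun i => eval (g i) (x i)) =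
      Xi.subst o fun i => eval (g i) ((x i).map (f i)) := by
  have h : (fun i => eval (g i) ((x i).map (f i))) = fun i => Xi.map (f i) (eval (g i) (x i)) :=
    funext fun i => eval_map _ _ _
  rw [h]
  exact Xi.subst_pre o f fun i => eval (g i) (x i)

/-- The map induced by `g_1, …, g_k` on coends:
`o ⊗ x_1 ⊗ ⋯ ⊗ x_k ↦ ± o(g_1(x_1), …, g_k(x_k))`, where the sign is the one of
`(g_1 ⊗ ⋯ ⊗ g_k)(x_1 ⊗ ⋯ ⊗ x_k)`. -/
def substMap (g : ∀ i, Coend δ d (c' i) (c i) (e i)) (n : ℕ) : Xi δ d c c₀ n →ₗ[ℤ]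
    Xi δ d (fun t : Σₗ i, κ i => c' (ofLex t).1 (ofLex t).2) c₀ n :=
  Xi.lift (fun o x => sgn (∑ i, ∑ j with j < i, e i * (x j).deg) •
      Xi.subst o fun i => eval (g i) (x i))
    (by
      intro n o x k p a b
      simp only [Xi.deg_update]
      rw [← smul_add, subst_eval_add])
    (by
      intro n n' o f x
      rw [subst_eval_map]
      rfl)

@[simp] theorem substMap_mk (g : ∀ i, Coend δ d (c' i) (c i) (e i)) {n : ℕ} {k : ι → ℕ}
    (o : RL d c k c₀ n) (x : ∀ i, HomEl δ (k i)) :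
    substMap g n (Xi.mk o x) = sgn (∑ i, ∑ j with j < i, e i * (x j).deg) •
      Xi.subst o fun i => eval (g i) (x i) := Xi.lift_mk _ _ _ _ _

/-- The composition `γ(f; g_1, …, g_k) = (-1) ^ (|f| (|g_1| + ⋯ + |g_k|)) ξ(g_1, …, g_k) ∘ f`. -/
def comp {m : ℤ} (f : Coend δ d c c₀ m) (g : ∀ i, Coend δ d (c' i) (c i) (e i)) :
    Coend δ d (fun t : Σₗ i, κ i => c' (ofLex t).1 (ofLex t).2) c₀ (m + ∑ i, e i) :=
  ⟨fun n p => sgn (m * ∑ i, e i) • (substMap g n ∘ₗ f.1 n p), by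
    refine ⟨fun n p x => Submodule.smul_mem _ _ ?_, fun k l ψ p x => ?_⟩
    · refine Xi.map_deg (substMap g n) (fun {k} o y h => ?_) (f.2.1 n p x)
      rw [substMap_mk]
      refine Submodule.smul_mem _ _ ?_
      have := Xi.subst_deg o (fun i => ((y i).deg : ℤ) + e i) (fun i => eval (g i) (y i))
        (fun i => (g i).2.1 _ _ _)
      rw [Finset.sum_add_distrib, h] at this
      rwa [← add_assoc]
    · simp only [LinearMap.smul_apply, LinearMap.comp_apply, f.2.2, map_smul]
      congr 1
      have : (substMap g l).comp (Xi.map ψ) = (Xi.map ψ).comp (substMap (c₀ := c₀) g k) := by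
        refine Xi.hom_ext fun o x => ?_
        simp only [LinearMap.comp_apply, substMap_mk, Xi.map_mk, map_smul, Xi.subst_post]
      exact congrArg (fun F => F (f.1 k p x)) this⟩

end Coend
end CoendOperad

noncomputable section Algebras
open CategoryTheory

universe u

/-- An algebra over the coloured operad `RL_d` in modules over `R`, with underlying modules
`X c n`. -/
structure RLAlg (R : Type u) [CommRing R] (d : ℕ) (X : Clr → ℕ → Type u)
    [∀ c n, AddCommGroup (X c n)] [∀ c n, Module R (X c n)] where
  act : ∀ {ι : Type} [LinearOrder ι] [Fintype ι] {c : ι → Clr} {n : ι → ℕ} {c₀ : Clr} {m : ℕ},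
    RL d c n c₀ m → MultilinearMap R (fun i => X (c i) (n i)) (X c₀ m)
  act_unit : ∀ (c₀ : Clr) (n : ℕ) (x : Unit → X c₀ n),
    act (RL.unary d c₀ (OrderHom.id : Fin (n + 1) →o Fin (n + 1))) x = x ()
  act_reindex : ∀ {ι ι' : Type} [LinearOrder ι] [Fintype ι] [LinearOrder ι'] [Fintype ι']
    {c : ι → Clr} {n : ι → ℕ} {c₀ : Clr} {m : ℕ} (e : ι' ≃ ι) (o : RL d c n c₀ m)
    (x : ∀ i, X (c i) (n i)), act (o.reindex e) (fun i => x (e i)) = act o x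
  act_comp : ∀ {ι : Type} [LinearOrder ι] [Fintype ι] {κ : ι → Type} [∀ i, LinearOrder (κ i)]
    [∀ i, Fintype (κ i)] {c : ι → Clr} {n : ι → ℕ} {c₀ : Clr} {m : ℕ} {c' : ∀ i, κ i → Clr}
    {n' : ∀ i, κ i → ℕ} (o : RL d c n c₀ m) (y : ∀ i, RL d (c' i) (n' i) (c i) (n i))
    (x : ∀ i j, X (c' i j) (n' i j)),
    act (o.comp y) (fun t => x (ofLex t).1 (ofLex t).2) = act o fun i => act (y i) (x i)

/-- An algebra over the dg operad `Coend_{RL_d}(δ)`, with underlying cochain complexes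
`(T c, D c)` of `R`-modules, graded by the submodules `gr c p`. An operation of degree `m` lowers
the cohomological degree by `m`. -/
structure CoendAlg (R : Type u) [CommRing R]
    (δ : SimplexCategory ⥤ ChainComplex (ModuleCat.{0} ℤ) ℕ) (d : ℕ) (T : Clr → Type u)
    [∀ c, AddCommGroup (T c)] [∀ c, Module R (T c)] (gr : ∀ c, ℤ → Submodule R (T c))
    (D : ∀ c, T c →ₗ[R] T c) where
  D_mem : ∀ c p x, x ∈ gr c p → D c x ∈ gr c (p + 1)
  D_D : ∀ c x, D c (D c x) = 0
  act : ∀ {ι : Type} [LinearOrder ι] [Fintype ι] {c : ι → Clr} {c₀ : Clr} {m : ℤ},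
    Coend δ d c c₀ m → MultilinearMap R (fun i => T (c i)) (T c₀)
  act_add : ∀ {ι : Type} [LinearOrder ι] [Fintype ι] {c : ι → Clr} {c₀ : Clr} {m : ℤ}
    (f g : Coend δ d c c₀ m), act (f + g) = act f + act g
  act_mem : ∀ {ι : Type} [LinearOrder ι] [Fintype ι] {c : ι → Clr} {c₀ : Clr} {m : ℤ}
    (f : Coend δ d c c₀ m) (p : ι → ℤ) (x : ∀ i, T (c i)), (∀ i, x i ∈ gr (c i) (p i)) →
    act f x ∈ gr c₀ (∑ i, p i - m)
  act_one : ∀ (c₀ : Clr) (x : Unit → T c₀), act (Coend.one δ d c₀) x = x ()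
  act_symm : ∀ {ι ι' : Type} [LinearOrder ι] [Fintype ι] [LinearOrder ι'] [Fintype ι']
    {c : ι → Clr} {c₀ : Clr} {m : ℤ} (f : Coend δ d c c₀ m) (e : ι' ≃ ι) (p : ι → ℤ)
    (x : ∀ i, T (c i)), (∀ i, x i ∈ gr (c i) (p i)) →
    act (Coend.symm f e) (fun i => x (e i)) = koszul e p • act f x
  act_comp : ∀ {ι : Type} [LinearOrder ι] [Fintype ι] {κ : ι → Type} [∀ i, LinearOrder (κ i)]
    [∀ i, Fintype (κ i)] {c : ι → Clr} {c₀ : Clr} {c' : ∀ i, κ i → Clr} {m : ℤ} {e : ι → ℤ}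
    (f : Coend δ d c c₀ m) (g : ∀ i, Coend δ d (c' i) (c i) (e i)) (p : ∀ i, κ i → ℤ)
    (x : ∀ i j, T (c' i j)), (∀ i j, x i j ∈ gr (c' i j) (p i j)) →
    act (Coend.comp f g) (fun t => x (ofLex t).1 (ofLex t).2) =
      sgn (∑ i, ∑ i' with i' < i, e i * ∑ j, p i' j) • act f fun i => act (g i) (x i)
  act_diff : ∀ {ι : Type} [LinearOrder ι] [Fintype ι] {c : ι → Clr} {c₀ : Clr} {m : ℤ}
    (f : Coend δ d c c₀ m) (p : ι → ℤ) (x : ∀ i, T (c i)), (∀ i, x i ∈ gr (c i) (p i)) →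
    D c₀ (act f x) = act (Coend.diff f) x +
      sgn m • ∑ i, sgn (∑ j with j < i, p j) • act f (Function.update x i (D (c i) (x i)))

section Tot
variable {R : Type u} [CommRing R] {d : ℕ} {X : Clr → ℕ → Type u}
  [∀ c n, AddCommGroup (X c n)] [∀ c n, Module R (X c n)]

/-- The cosimplicial structure on `X c` given by the unary operations of `RL_d`. -/
def RLAlg.cosimp (A : RLAlg R d X) (c : Clr) {k l : ℕ} (ψ : Fin (k + 1) →o Fin (l + 1)) :
    X c k →ₗ[R] X c l :=
  (A.act (RL.unary d c ψ)).toLinearMap 0 ()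

/-- The part of cohomological degree `p` of the `δ`-totalization `Hom_Δ(δ, X c)`, where the
cosimplicial module `X c` is placed in degree zero: families of maps from the elements of degree
`p` of `δ n` to `X c n`, natural in `n`. -/
def Tot (δ : SimplexCategory ⥤ ChainComplex (ModuleCat.{0} ℤ) ℕ) (A : RLAlg R d X) (c : Clr)
    (p : ℤ) : Submodule R (∀ n q : ℕ, El δ n q →ₗ[ℤ] X c n) where
  carrier := {f | (∀ n q : ℕ, (q : ℤ) ≠ p → f n q = 0) ∧
    ∀ k l (ψ : Fin (k + 1) →o Fin (l + 1)) (q : ℕ) x,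
      f l q (coMap δ ψ q x) = A.cosimp c ψ (f k q x)}
  zero_mem' := ⟨fun _ _ _ => rfl, fun _ _ _ _ _ => by simp⟩
  add_mem' := by
    rintro f g ⟨h1, h2⟩ ⟨h3, h4⟩
    refine ⟨fun n q hq => by simp [h1 n q hq, h3 n q hq], fun k l ψ q x => by simp [h2, h4]⟩
  smul_mem' := by
    rintro r f ⟨h1, h2⟩
    refine ⟨fun n q hq => by simp [h1 n q hq], fun k l ψ q x => by simp [h2]⟩

/-- The differential `g ↦ (-1) ^ (p + 1) g ∘ d` of the totalization, on elements `g` of degree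
`p`. -/
def totD {δ : SimplexCategory ⥤ ChainComplex (ModuleCat.{0} ℤ) ℕ} {Y : ℕ → Type u}
    [∀ n, AddCommGroup (Y n)] (p : ℤ) (g : ∀ n q : ℕ, El δ n q →ₗ[ℤ] Y n) :
    ∀ n q : ℕ, El δ n q →ₗ[ℤ] Y n :=
  fun n q => sgn (p + 1) • (g n (q - 1) ∘ₗ coD δ n q)

/-- The element `h` is the value of the operation `f` of `Coend_{RL_d}(δ)` on the elements
`g i`, of degrees `p i`, of the totalizations: on `ξ(RL_d)(δ, …, δ)` the `g i` induce the map
`E : o ⊗ x_1 ⊗ ⋯ ⊗ x_k ↦ ± o(g_1(x_1), …, g_k(x_k))`, and `h` is `± E ∘ f`. -/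
def IsTotAction {δ : SimplexCategory ⥤ ChainComplex (ModuleCat.{0} ℤ) ℕ} (A : RLAlg R d X)
    {ι : Type} [LinearOrder ι] [Fintype ι] {c : ι → Clr} {c₀ : Clr} {m : ℤ}
    (f : Coend δ d c c₀ m) (p : ι → ℤ) (g : ∀ i, ∀ n q : ℕ, El δ n q →ₗ[ℤ] X (c i) n)
    (h : ∀ n q : ℕ, El δ n q →ₗ[ℤ] X c₀ n) : Prop :=
  ∀ n, ∃ E : Xi δ d c c₀ n →ₗ[ℤ] X c₀ n,
    (∀ {k : ι → ℕ} (o : RL d c k c₀ n) (x : ∀ i, HomEl δ (k i)),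
      E (Xi.mk o x) = sgn (∑ i, ∑ j with j < i, p i * (x j).deg) •
        A.act o fun i => g i (k i) (x i).deg (x i).val) ∧
    ∀ (q : ℕ) (x : El δ n q), h n q x = sgn (m * ∑ i, p i) • E (f.1 n q x)

end Tot

section Chains

/-- The cosimplicial chain complex `δ_ℤ`: the chains of the standard simplices. -/
def δZ : SimplexCategory ⥤ ChainComplex (ModuleCat.{0} ℤ) ℕ :=
  SSet.stdSimplex.{0} ⋙ (SimplicialObject.whiskering _ _).obj (ModuleCat.free ℤ) ⋙
    AlgebraicTopology.alternatingFaceMapComplex (ModuleCat.{0} ℤ)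

/-- The generator of `δ_ℤ(p)_p` given by the identity of `[p]`. -/
def fund (p : ℕ) : El δZ p p :=
  (ModuleCat.freeMk (R := ℤ) (SSet.stdSimplex.objEquiv.symm (𝟙 (SimplexCategory.mk p)) :
    (SSet.stdSimplex.obj (SimplexCategory.mk p)).obj (Opposite.op (SimplexCategory.mk p))) :
    (ModuleCat.free ℤ).obj _)

/-- The comparison of the totalization at `δ_ℤ` of a cosimplicial module `Y` with `Y`, in
degree `p`: `g ↦ (-1) ^ (p (p + 1) / 2) g(id_[p])`. -/
def evalFund {Y : ℕ → Type u} [∀ n, AddCommGroup (Y n)] (p : ℕ)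
    (g : ∀ n q : ℕ, El δZ n q →ₗ[ℤ] Y n) : Y p :=
  sgn ((p * (p + 1) / 2 : ℕ) : ℤ) • g p p (fund p)

end Chains
end Algebras

noncomputable section Bialgebras
open TensorProduct

universe u

variable (R B C : Type u) [CommRing R] [Ring B] [Bialgebra R B] [Ring C] [Algebra R C]

/-- The structure of a left `B`-comodule on `C` in the category of unital algebras. -/
structure LeftCoaction where
  coact : C →ₐ[R] B ⊗[R] C
  coassoc : (TensorProduct.assoc R B B C).toLinearMap ∘ₗ
    (Coalgebra.comul (R := R) (A := B)).rTensor C ∘ₗ coact.toLinearMap =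
      coact.toLinearMap.lTensor B ∘ₗ coact.toLinearMap
  counit_coact : (TensorProduct.lid R C).toLinearMap ∘ₗ
    (Coalgebra.counit (R := R) (A := B)).rTensor C ∘ₗ coact.toLinearMap = LinearMap.id

/-- The modules `B^{⊗ n}` (closed) and `B^{⊗ n} ⊗ C` (open). -/
def Cobar : Clr → ℕ → Type u
  | .closed, n => ⨂[R]^n B
  | .opn, n => (⨂[R]^n B) ⊗[R] C

instance : ∀ c n, AddCommGroup (Cobar R B C c n)
  | .closed, n => inferInstanceAs (AddCommGroup (⨂[R]^n B))
  | .opn, n => inferInstanceAs (AddCommGroup ((⨂[R]^n B) ⊗[R] C))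

instance : ∀ c n, Module R (Cobar R B C c n)
  | .closed, n => inferInstanceAs (Module R (⨂[R]^n B))
  | .opn, n => inferInstanceAs (Module R ((⨂[R]^n B) ⊗[R] C))

variable {R B C}

/-- The map `b ↦ b^{(1)} ⊗ ⋯ ⊗ b^{(r)}` (iterated coproduct), with the factors placed at the
positions of the list `P` in `B^{⊗ N}` and with `1` at the other positions. It is the counit if
`P` is empty. -/
def spread {N : ℕ} : List (Fin N) → (B →ₗ[R] ⨂[R]^N B)
  | [] => Algebra.linearMap R _ ∘ₗ Coalgebra.counit
  | p :: P => LinearMap.mul' R _ ∘ₗ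
      TensorProduct.map (PiTensorProduct.singleAlgHom (R := R) (A := fun _ : Fin N => B) p).toLinearMap
        (spread P) ∘ₗ Coalgebra.comul

/-- The map `c ↦ z^{(1)} ⊗ ⋯ ⊗ z^{(r)} ⊗ c^{(r + 1)}` (iterated coaction), with the factors in `B`
placed at the positions of the list `P` and with `1` at the other positions. -/
def spreadC (S : LeftCoaction R B C) {N : ℕ} : List (Fin N) → (C →ₗ[R] (⨂[R]^N B) ⊗[R] C)
  | [] => Algebra.TensorProduct.includeRight.toLinearMap
  | p :: P => LinearMap.mul' R _ ∘ₗ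
      TensorProduct.map ((Algebra.TensorProduct.includeLeft (S := R)).comp
        (PiTensorProduct.singleAlgHom (R := R) (A := fun _ : Fin N => B) p)).toLinearMap
        (spreadC S P) ∘ₗ S.coact.toLinearMap

/-- The map `b_1 ⊗ ⋯ ⊗ b_k ↦ spread P_1 b_1 ⋯ spread P_k b_k`. -/
def distribute {k N : ℕ} (P : Fin k → List (Fin N)) : (⨂[R]^k B) →ₗ[R] ⨂[R]^N B :=
  PiTensorProduct.lift
    ((MultilinearMap.mkPiAlgebraFin R k (⨂[R]^N B)).compLinearMap fun j => spread (P j))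

/-- The positions `a, …, b - 1` (counted from zero) in `B^{⊗ N}`. -/
def interval {N : ℕ} (a b : ℕ) : List (Fin N) :=
  (List.finRange N).filter fun j => a ≤ j ∧ (j : ℕ) < b

/-- The map `B^{⊗ l} → B^{⊗ N}` which places the factors at the positions `a, …, a + l - 1`. -/
def place {N : ℕ} (a l : ℕ) : (⨂[R]^l B) →ₗ[R] ⨂[R]^N B :=
  distribute fun j => interval (a + j) (a + j + 1)

/-- The map `g ⊗ c ↦ 1 ⊗ g ⊗ z^{(1)} ⊗ ⋯ ⊗ z^{(r)} ⊗ c^{(r+1)}` with `g` at the positions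
`a, …, a + l - 1`, and the iterated coaction of `c` at all the later positions. -/
def placeC (S : LeftCoaction R B C) {N : ℕ} (a l : ℕ) :
    (⨂[R]^l B) ⊗[R] C →ₗ[R] (⨂[R]^N B) ⊗[R] C :=
  LinearMap.mul' R _ ∘ₗ TensorProduct.map
    (Algebra.TensorProduct.includeLeft.toLinearMap ∘ₗ place a l) (spreadC S (interval (a + l) N))

/-- The position at which the `j`-th block of a sequence of blocks of lengths `l` begins. -/
def offset {k : ℕ} (l : Fin k → ℕ) (j : Fin k) : ℕ := ∑ i with i < j, l i

/-- The map `b_1 ⊗ ⋯ ⊗ b_k ↦ Δ^{(l_1 - 1)} b_1 ⊗ ⋯ ⊗ Δ^{(l_k - 1)} b_k`. -/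
def blocks {k N : ℕ} (l : Fin k → ℕ) : (⨂[R]^k B) →ₗ[R] ⨂[R]^N B :=
  distribute fun j => interval (offset l j) (offset l j + l j)

/-- The `i`-th summand of the differential of `TB` without its sign: it is
`b ↦ 1 ⊗ b_1 ⊗ ⋯ ⊗ b_n` for `i = 0`, `b ↦ b_1 ⊗ ⋯ ⊗ Δ b_i ⊗ ⋯ ⊗ b_n` for `1 ≤ i ≤ n`, and
`b ↦ b_1 ⊗ ⋯ ⊗ b_n ⊗ 1` for `i = n + 1`. -/
def cobarFace (n i : ℕ) : (⨂[R]^n B) →ₗ[R] ⨂[R]^(n + 1) B :=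
  distribute fun j => if (j : ℕ) + 1 < i then [j.castSucc]
    else if (j : ℕ) + 1 = i then [j.castSucc, j.succ] else [j.succ]

/-- The differential of the unreduced cobar construction `Ω_u B = (TB, D)`, on `B^{⊗ n}`. -/
def cobarD (n : ℕ) : (⨂[R]^n B) →ₗ[R] ⨂[R]^(n + 1) B :=
  ∑ i ∈ Finset.range (n + 2), (-1 : ℤ) ^ i • cobarFace n i

/-- The differential of the unreduced relative cobar construction `Ω_u(B, C) = (TB ⊗ C, D')`, on
`B^{⊗ n} ⊗ C`; the last summand is `b ⊗ c ↦ (-1) ^ (n + 1) b_1 ⊗ ⋯ ⊗ b_n ⊗ ∇ c`. -/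
def relCobarD (S : LeftCoaction R B C) (n : ℕ) :
    (⨂[R]^n B) ⊗[R] C →ₗ[R] (⨂[R]^(n + 1) B) ⊗[R] C :=
  ∑ i ∈ Finset.range (n + 1), (-1 : ℤ) ^ i • (cobarFace n i).rTensor C +
    (-1 : ℤ) ^ (n + 1) • (LinearMap.mul' R _ ∘ₗ TensorProduct.map
      (Algebra.TensorProduct.includeLeft.toLinearMap ∘ₗ cobarFace n (n + 1))
      (spreadC S [Fin.last n]))

/-- The two differentials together. -/
def Cobar.D (S : LeftCoaction R B C) : ∀ c n, Cobar R B C c n →ₗ[R] Cobar R B C c (n + 1)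
  | .closed, n => cobarD n
  | .opn, n => relCobarD S n

variable (R B C) in
/-- The modules `TB` and `TB ⊗ C`. -/
abbrev CobarTotal (c : Clr) : Type u := DirectSum ℕ (Cobar R B C c)

/-- The homogeneous part of degree `p` of `TB` or `TB ⊗ C`. -/
def cobarGr (c : Clr) (p : ℤ) : Submodule R (CobarTotal R B C c) where
  carrier := {x | ∀ n : ℕ, (n : ℤ) ≠ p → x n = 0}
  zero_mem' := fun _ _ => rfl
  add_mem' := fun hx hy n hn => by rw [DirectSum.add_apply, hx n hn, hy n hn, add_zero]
  smul_mem' := fun r x hx n hn => by rw [DirectSum.smul_apply, hx n hn, smul_zero]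

/-- The inclusion of the elements of degree `p`. -/
def cobarIncl (c : Clr) (p : ℕ) : Cobar R B C c p →ₗ[R] CobarTotal R B C c :=
  DirectSum.lof R ℕ (Cobar R B C c) p

/-- The differentials of `Ω_u B = (TB, D)` and `Ω_u(B, C) = (TB ⊗ C, D')`. -/
def cobarTotalD (S : LeftCoaction R B C) (c : Clr) : CobarTotal R B C c →ₗ[R] CobarTotal R B C c :=
  DirectSum.toModule R ℕ _ fun n => cobarIncl c (n + 1) ∘ₗ Cobar.D S c n

/-- The word `t | t | ⋯ | t` with `l` bars. -/
def corolla {ι : Type} (t : ι) (l : ℕ) : List (Option ι) :=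
  some t :: (List.replicate l [none, some t]).flatten

/-- The word `t w_1 t w_2 ⋯ t w_k t`. -/
def graft {ι : Type} (t : ι) {k : ℕ} (w : Fin k → List (Option ι)) : List (Option ι) :=
  (List.finRange k).flatMap (fun j => some t :: w j) ++ [some t]

/-- The element of `Fin s` with image `j` under `β`, if there is one. -/
def preimg {s k : ℕ} (β : Fin s ↪o Fin k) (j : Fin k) : Option (Fin s) :=
  (List.finRange s).find? fun r => β r = j

/-- The number of inputs of the operation which is plugged in the `j`-th input: `l r` if
`j = β r`, and `1` if `j` is not in the image of `β`. -/
def wideLen {s k : ℕ} (β : Fin s ↪o Fin k) (l : Fin s → ℕ) (j : Fin k) : ℕ :=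
  (preimg β j).elim 1 l

/-- The `RL_2`-algebra `A` is the couple `(M_B, Z_{B,C})`: the operations of `RL_2` which are
given by the following words act by the structure maps of this couple. -/
structure IsCobarAlg (S : LeftCoaction R B C) (A : RLAlg R 2 (Cobar R B C)) : Prop where
  /-- The operadic composition `γ(f; g_1, …, g_k)` of `M_B`. -/
  gamma : ∀ {k N : ℕ} (l : Fin k → ℕ)
    (o : RL 2 (fun _ : Fin (k + 1) => Clr.closed) (Fin.cons k l) Clr.closed N),
    o.word = graft 0 (fun j => corolla j.succ (l j)) →
    ∀ (f : ⨂[R]^k B) (g : ∀ j, ⨂[R]^(l j) B),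
    A.act o (Fin.cons (α := fun i => Cobar R B C .closed (Fin.cons (α := fun _ => ℕ) k l i)) f g) =
      (blocks l f * (List.ofFn fun j => place (offset l j) (l j) (g j)).prod : ⨂[R]^N B)
  /-- The map from the associative operad to `M_B`; for `N = 2` it gives `μ = 1 ⊗ 1`. -/
  assoc : ∀ {N : ℕ} (c : Fin 0 → Clr) (n : Fin 0 → ℕ) (o : RL 2 c n Clr.closed N) (x),
    A.act o x = (1 : ⨂[R]^N B)
  /-- The wide left action of `M_B` on `Z_{B,C}`; for `s = 0` it is the inclusion `f ↦ f ⊗ 1`. -/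
  lambda : ∀ {k s N : ℕ} (β : Fin s ↪o Fin k) (l : Fin s → ℕ)
    (o : RL 2 (Fin.cons Clr.closed fun _ : Fin s => Clr.opn) (Fin.cons k l) Clr.opn N),
    o.word = graft 0 (fun j => (preimg β j).elim [none] fun r => corolla r.succ (l r)) →
    ∀ (f : ⨂[R]^k B) (g : ∀ r, (⨂[R]^(l r) B) ⊗[R] C),
    A.act o (Fin.cons (α := fun i => Cobar R B C
        (Fin.cons (α := fun _ => Clr) Clr.closed (fun _ : Fin s => Clr.opn) i)
        (Fin.cons (α := fun _ => ℕ) k l i)) f g) =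
      ((blocks (wideLen β l) f ⊗ₜ[R] (1 : C)) * (List.ofFn fun r =>
        placeC S (offset (wideLen β l) (β r)) (l r) (g r)).reverse.prod : (⨂[R]^N B) ⊗[R] C)
  /-- The right action on `Z_{B,C}` of the associative operad. -/
  rho : ∀ {k N : ℕ} (l : Fin k → ℕ)
    (o : RL 2 (fun _ : Unit => Clr.opn) (fun _ => k) Clr.opn N),
    o.word = graft () (fun j => List.replicate (l j) none) →
    ∀ x : (⨂[R]^k B) ⊗[R] C,
    A.act o (fun _ => x) = ((blocks l).rTensor C x : (⨂[R]^N B) ⊗[R] C)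

end Bialgebras

end SwissCheese

open SwissCheese

universe u

/-!
# The Swiss-Cheese action on the cobar constructions of a bialgebra and a comodule algebra

The algebras `B^{⊗ n}` form a cosimplicial algebra: a monotone map `ψ : [n] → [m]` places the
iterated coproduct of the `j`-th factor at the positions between `ψ (j - 1)` and `ψ j`, and `1` at
the positions outside the range of `ψ`. The algebras `B^{⊗ n} ⊗ C` do likewise, with the iterated
coaction of the factor in `C` placed after the last value of `ψ` (`cobarPair`). The maps are
functorial by coassociativity, and multiplicative because the coproduct and the coaction are maps
of algebras and elements at different positions commute.

A lattice path in the inputs `i` determines monotone maps `pos i : [n_i] → [m]`, which count the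
marked points before the edges in the direction `i`. It acts by the product of the elements
`X (pos i) (x i)`, where the closed inputs are taken first, in the order of their first occurrences
in the path, and then the open ones, in the reverse order. This order is not compatible with the
composition of paths, but by the filtration condition of `RL_2` any two factors whose order is
changed by a composition are such that one of them is closed and lies entirely to the left of the
other one (`RL.all_before`), and such factors commute. Hence every pair of cosimplicial algebras
with this commutation property is an `RL_2`-algebra (`CosimplicialPair.rlAlg`), and the structure
maps of `(M_B, Z_{B,C})` are found by reading the maps `pos i` off the words in question
(`isCobarAlg_rlAlg`).

The remaining part holds for an arbitrary `RL_d`-algebra. The chains of the simplices have the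
monotone maps as a basis, so by the Yoneda lemma the totalization of a cosimplicial module is the
module itself (`RLAlg.yon`, `RLAlg.bijective_evalFund`). The action of an operation `f` on
totalizations is composition with `f`, followed by the evaluation of the coend at given elements
of the totalizations (`RLAlg.evalXi`). On the cochain complexes this becomes
`RLAlg.coendFun`, where the degrees of homogeneous elements are read off from those of the chains;
`RLAlg.yon_coendFun` relates the two descriptions. The laws of an algebra follow from this by
comparing the evaluations on the generators of the coend (`RLAlg.coendFun_symm`,
`RLAlg.coendFun_comp`, `RLAlg.coendFun_diff`), where the signs are governed by the quadratic form
`cross`. Finally, the differentials of the cobar constructions are the alternating sums of the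
cofaces (`cosimpD_rlAlg_cobarPair`).
-/

namespace SwissCheese

/-! ### Lists -/

section Lists
variable {α β : Type*}

/-- In a list without repetitions, that `[a, b]` is a sublist means that `a` occurs before `b`; a
sublist which begins with `b` can then be extended by `a`. -/
theorem pair_sublist_extend {l : List α} (hl : l.Nodup) {a b : α} {s : List α}
    (h1 : [a, b].Sublist l) (h2 : (b :: s).Sublist l) : (a :: b :: s).Sublist l := by
  induction l with
  | nil => simp at h1
  | cons x l ih =>
    have hx := List.nodup_cons.1 hl
    cases h2 with
    | cons _ h2 =>
      cases h1 with
      | cons _ h1 => exact (ih hx.2 h1 h2).cons _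
      | cons_cons _ h1 => exact h2.cons_cons _
    | cons_cons _ h2 =>
      refine absurd ?_ hx.1
      cases h1 with
      | cons _ h1 => exact h1.subset (by simp)
      | cons_cons _ h1 => exact h1.subset (by simp)

theorem pair_sublist_asymm {l : List α} (hl : l.Nodup) {a b : α} (h1 : [a, b].Sublist l) :
    ¬ [b, a].Sublist l := fun h2 => by
  have := (pair_sublist_extend hl h1 h2).nodup hl
  simp at this

theorem pair_sublist_total {l : List α} {a b : α} (ha : a ∈ l) (hb : b ∈ l) (hab : a ≠ b) :
    [a, b].Sublist l ∨ [b, a].Sublist l := by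
  induction l with
  | nil => simp at ha
  | cons x l ih =>
    rcases List.mem_cons.1 ha with rfl | ha'
    · rcases List.mem_cons.1 hb with rfl | hb'
      · exact absurd rfl hab
      · exact Or.inl ((List.singleton_sublist.2 hb').cons_cons _)
    · rcases List.mem_cons.1 hb with rfl | hb'
      · exact Or.inr ((List.singleton_sublist.2 ha').cons_cons _)
      · exact (ih ha' hb').imp (fun h => h.cons _) (fun h => h.cons _)

theorem pair_sublist_flatMap {E : List α} {Y : α → List β} {a b : α} {x y : β}
    (h : [a, b].Sublist E) (hx : x ∈ Y a) (hy : y ∈ Y b) : [x, y].Sublist (E.flatMap Y) := by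
  refine List.Sublist.trans ?_ (h.flatMap Y)
  simpa using (List.singleton_sublist.2 hx).append (List.singleton_sublist.2 hy)

/-- Products of the same elements in two orders agree if any two of the elements which occur in
different orders commute. -/
theorem prod_map_eq_of_perm {M : Type*} [Monoid M] (f : α → M) {l l' : List α} (hl : l.Nodup)
    (h : l.Perm l')
    (hc : ∀ a b, [a, b].Sublist l → [b, a].Sublist l' → Commute (f a) (f b)) :
    (l.map f).prod = (l'.map f).prod := by
  induction l generalizing l' with
  | nil => rw [List.nil_perm.1 h]
  | cons a t ih =>
    obtain ⟨u, v, rfl⟩ := List.append_of_mem (h.subset List.mem_cons_self)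
    have ht : t.Perm (u ++ v) := (List.perm_cons a).1 (h.trans List.perm_middle)
    rw [List.map_cons, List.prod_cons, ih (List.nodup_cons.1 hl).2 ht fun x y hx hy =>
      hc x y (hx.cons _) (hy.trans ((List.sublist_cons_self _ _).append_left _))]
    have hu : Commute (f a) (u.map f).prod := by
      refine Commute.list_prod_right _ _ fun x hx => ?_
      obtain ⟨b, hb, rfl⟩ := List.mem_map.1 hx
      refine hc a b ((List.singleton_sublist.2 (ht.symm.subset (by simp [hb]))).cons_cons _) ?_
      have h1 := (List.singleton_sublist.2 hb).append
        ((List.nil_sublist v).cons_cons a)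
      simpa using h1
    simp only [List.map_append, List.prod_append, List.map_cons, List.prod_cons]
    rw [← mul_assoc, hu.eq, mul_assoc]

end Lists

/-! ### The positions of the edges and the order of the inputs of an operation -/

namespace LatticePath
variable {ι : Type} [LinearOrder ι] {n : ι → ℕ} {m : ℕ}

/-- The list of all edges, in the order in which the path traverses them. -/
def edgeList (x : LatticePath n m) : List (Σ i, Fin (n i + 1)) :=
  (List.finRange (m + 1)).flatMap x.seg

theorem edge_sublist (x : LatticePath n m) (i : ι) :
    ((List.finRange (n i + 1)).map (Sigma.mk i)).Sublist x.edgeList := by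
  rw [← x.edges i]; exact List.filter_sublist

theorem mem_edgeList (x : LatticePath n m) (a : Σ i, Fin (n i + 1)) : a ∈ x.edgeList :=
  (x.edge_sublist a.1).subset (List.mem_map.2 ⟨a.2, List.mem_finRange _, rfl⟩)

theorem nodup_edgeList (x : LatticePath n m) : x.edgeList.Nodup := by
  rw [List.nodup_iff_count_le_one]
  intro a
  have h : List.count a x.edgeList = List.count a (x.edgeList.filter fun b => b.1 = a.1) := by
    rw [List.count_filter]; simp
  rw [h, edgeList, x.edges]
  refine List.nodup_iff_count_le_one.1 ?_ a
  exact (List.nodup_finRange _).map sigma_mk_injective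

theorem exists_mem_seg (x : LatticePath n m) (a : Σ i, Fin (n i + 1)) : ∃ j, a ∈ x.seg j := by
  obtain ⟨j, -, h⟩ := List.mem_flatMap.1 (x.mem_edgeList a)
  exact ⟨j, h⟩

theorem pair_sublist_of_lt (x : LatticePath n m) {a b : Σ i, Fin (n i + 1)} {j k : Fin (m + 1)}
    (ha : a ∈ x.seg j) (hb : b ∈ x.seg k) (h : j < k) : [a, b].Sublist x.edgeList := by
  refine pair_sublist_flatMap ?_ ha hb
  rcases pair_sublist_total (List.mem_finRange j) (List.mem_finRange k) h.ne with h' | h'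
  · exact h'
  · have := (List.pairwise_lt_finRange (m + 1)).sublist h'
    simp only [List.pairwise_cons, List.mem_singleton, forall_eq] at this
    exact absurd h this.1.asymm

theorem le_of_pair_sublist (x : LatticePath n m) {a b : Σ i, Fin (n i + 1)} {j k : Fin (m + 1)}
    (ha : a ∈ x.seg j) (hb : b ∈ x.seg k) (h : [a, b].Sublist x.edgeList) : j ≤ k := by
  by_contra hjk
  exact pair_sublist_asymm x.nodup_edgeList h (x.pair_sublist_of_lt hb ha (not_le.1 hjk))

theorem edge_pair_sublist (x : LatticePath n m) (i : ι) {r s : Fin (n i + 1)} (h : r < s) :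
    [(⟨i, r⟩ : Σ i, Fin (n i + 1)), ⟨i, s⟩].Sublist x.edgeList := by
  refine List.Sublist.trans ?_ (x.edge_sublist i)
  refine List.Sublist.map (Sigma.mk (β := fun i => Fin (n i + 1)) i) (l₁ := [r, s]) ?_
  rcases pair_sublist_total (List.mem_finRange r) (List.mem_finRange s) h.ne with h' | h'
  · exact h'
  · have := (List.pairwise_lt_finRange (n i + 1)).sublist h'
    simp only [List.pairwise_cons, List.mem_singleton, forall_eq] at this
    exact absurd h this.1.asymm

theorem seg_unique (x : LatticePath n m) {a : Σ i, Fin (n i + 1)} {j k : Fin (m + 1)}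
    (hj : a ∈ x.seg j) (hk : a ∈ x.seg k) : j = k := by
  by_contra h
  have key : ∀ {j k}, a ∈ x.seg j → a ∈ x.seg k → ¬ j < k := fun hj hk h => by
    have := (x.pair_sublist_of_lt hj hk h).nodup x.nodup_edgeList
    simp at this
  rcases lt_or_gt_of_ne h with h | h
  · exact key hj hk h
  · exact key hk hj h

/-- The monotone map which sends `r` to the number of marked points before the `r`-th edge in the
direction `i`. -/
noncomputable def pos (x : LatticePath n m) (i : ι) : Fin (n i + 1) →o Fin (m + 1) where
  toFun r := (x.exists_mem_seg ⟨i, r⟩).choose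
  monotone' r s h := by
    rcases h.eq_or_lt with rfl | h
    · exact le_rfl
    · exact x.le_of_pair_sublist (x.exists_mem_seg ⟨i, r⟩).choose_spec
        (x.exists_mem_seg ⟨i, s⟩).choose_spec (x.edge_pair_sublist i h)

theorem mem_seg_pos (x : LatticePath n m) (i : ι) (r : Fin (n i + 1)) :
    ⟨i, r⟩ ∈ x.seg (x.pos i r) := (x.exists_mem_seg ⟨i, r⟩).choose_spec

theorem pos_eq (x : LatticePath n m) {i : ι} {r : Fin (n i + 1)} {j : Fin (m + 1)}
    (h : ⟨i, r⟩ ∈ x.seg j) : x.pos i r = j := x.seg_unique (x.mem_seg_pos i r) h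

/-- The first edge in the direction `i` precedes the first edge in the direction `j`. -/
def Before (x : LatticePath n m) (i j : ι) : Prop :=
  [(⟨i, 0⟩ : Σ i, Fin (n i + 1)), ⟨j, 0⟩].Sublist x.edgeList

theorem Before.asymm {x : LatticePath n m} {i j : ι} (h : x.Before i j) : ¬ x.Before j i :=
  pair_sublist_asymm x.nodup_edgeList h

theorem before_total (x : LatticePath n m) {i j : ι} (h : i ≠ j) : x.Before i j ∨ x.Before j i :=
  pair_sublist_total (x.mem_edgeList _) (x.mem_edgeList _) fun h' => h (congrArg Sigma.fst h')

theorem Before.sublist {x : LatticePath n m} {i j : ι} (h : x.Before i j) (r : Fin (n j + 1)) :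
    [(⟨i, 0⟩ : Σ i, Fin (n i + 1)), ⟨j, r⟩].Sublist x.edgeList := by
  rcases (Fin.zero_le r).eq_or_lt with h' | h'
  · rw [← h']; exact h
  · exact ((List.sublist_cons_self _ _).cons_cons _).trans
      (pair_sublist_extend x.nodup_edgeList h (x.edge_pair_sublist j h'))

/-- All directions, in the order in which they occur for the first time. -/
def firsts (x : LatticePath n m) : List ι :=
  (x.edgeList.filter fun a => a.2 = 0).map Sigma.fst

theorem mem_firsts (x : LatticePath n m) (i : ι) : i ∈ x.firsts :=
  List.mem_map.2 ⟨⟨i, 0⟩, List.mem_filter.2 ⟨x.mem_edgeList _, by simp⟩, rfl⟩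

theorem pairwise_firsts (x : LatticePath n m) : x.firsts.Pairwise x.Before := by
  rw [firsts, List.pairwise_map, List.pairwise_iff_forall_sublist]
  rintro ⟨i, r⟩ ⟨j, s⟩ h
  have hr := (List.mem_filter.1 (h.subset (by simp : (⟨i, r⟩ : Σ i, Fin (n i + 1)) ∈ _))).2
  have hs := (List.mem_filter.1 (h.subset (by simp : (⟨j, s⟩ : Σ i, Fin (n i + 1)) ∈ _))).2
  simp only [decide_eq_true_eq] at hr hs
  rw [hr, hs] at h
  exact h.trans List.filter_sublist

theorem Before.ne {x : LatticePath n m} {i j : ι} (h : x.Before i j) : i ≠ j := by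
  rintro rfl
  exact h.asymm h

end LatticePath

/-- Decides whether a colour is `closed`. -/
def Clr.isClosed : Clr → Bool
  | .closed => true
  | .opn => false

namespace RL
variable {ι : Type} [LinearOrder ι] {d : ℕ} {c : ι → Clr} {n : ι → ℕ} {c₀ : Clr} {m : ℕ}

/-- The order in which the inputs of an operation are multiplied: the closed ones in the order of
their first occurrences, and then the open ones in the reverse order of their first
occurrences. -/
def order (o : RL d c n c₀ m) : List ι :=
  (o.firsts.filter fun i => (c i).isClosed) ++ (o.firsts.filter fun i => !(c i).isClosed).reverse

theorem mem_order (o : RL d c n c₀ m) (i : ι) : i ∈ o.order := by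
  have := o.mem_firsts i
  cases h : (c i).isClosed <;> simp [order, this, h]

/-- The input `i` comes before the input `j` in the order of the inputs. -/
def Precedes (o : RL d c n c₀ m) (i j : ι) : Prop :=
  (c i = .closed ∧ c j = .closed ∧ o.Before i j) ∨ (c i = .closed ∧ c j = .opn) ∨
    (c i = .opn ∧ c j = .opn ∧ o.Before j i)

theorem Precedes.asymm {o : RL d c n c₀ m} {i j : ι} (h : o.Precedes i j) : ¬ o.Precedes j i := by
  rintro h'
  rcases h with ⟨h1, h2, h⟩ | ⟨h1, h2⟩ | ⟨h1, h2, h⟩ <;>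
  rcases h' with ⟨h3, h4, h'⟩ | ⟨h3, h4⟩ | ⟨h3, h4, h'⟩ <;>
  first
  | exact h.asymm h'
  | simp_all

theorem Precedes.ne {o : RL d c n c₀ m} {i j : ι} (h : o.Precedes i j) : i ≠ j := by
  rintro rfl
  exact h.asymm h

theorem pairwise_order (o : RL d c n c₀ m) : o.order.Pairwise o.Precedes := by
  have hcl : ∀ k, (c k).isClosed = true → c k = .closed := fun k h => by
    cases hk : c k <;> simp_all [Clr.isClosed]
  have hop : ∀ k, (!(c k).isClosed) = true → c k = .opn := fun k h => by
    cases hk : c k <;> simp_all [Clr.isClosed]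
  rw [order, List.pairwise_append]
  refine ⟨?_, ?_, ?_⟩
  · refine (List.Pairwise.and_mem.1 (o.pairwise_firsts.filter _)).imp ?_
    intro a b ⟨ha, hb, h⟩
    exact Or.inl ⟨hcl _ (List.mem_filter.1 ha).2, hcl _ (List.mem_filter.1 hb).2, h⟩
  · rw [List.pairwise_reverse]
    refine (List.Pairwise.and_mem.1 (o.pairwise_firsts.filter _)).imp ?_
    intro a b ⟨ha, hb, h⟩
    exact Or.inr (Or.inr ⟨hop _ (List.mem_filter.1 hb).2, hop _ (List.mem_filter.1 ha).2, h⟩)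
  · intro a ha b hb
    exact Or.inr (Or.inl ⟨hcl _ (List.mem_filter.1 ha).2,
      hop _ (List.mem_filter.1 (List.mem_reverse.1 hb)).2⟩)

theorem nodup_order (o : RL d c n c₀ m) : o.order.Nodup := o.pairwise_order.imp Precedes.ne

theorem precedes_of_sublist (o : RL d c n c₀ m) {i j : ι} (h : [i, j].Sublist o.order) :
    o.Precedes i j := List.pairwise_iff_forall_sublist.1 o.pairwise_order h

theorem order_perm (o : RL d c n c₀ m) {l : List ι} (hl : l.Nodup) (h : ∀ i, i ∈ l) :
    l.Perm o.order :=
  (List.perm_ext_iff_of_nodup hl o.nodup_order).2 fun i => ⟨fun _ => o.mem_order i, fun _ => h i⟩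

end RL

/-! ### Composites of lattice paths -/

namespace RL
variable {ι : Type} [LinearOrder ι] {c : ι → Clr} {n : ι → ℕ} {c₀ : Clr} {d m : ℕ}

theorem pos_unary (c₀ : Clr) {k l : ℕ} (f : Fin (k + 1) →o Fin (l + 1)) :
    (unary d c₀ f).pos () = f := by
  ext r : 2
  refine (unary d c₀ f).pos_eq ?_
  exact List.mem_map.2 ⟨r, List.mem_filter.2 ⟨List.mem_finRange _, by simp⟩, rfl⟩

theorem edgeList_reindex {ι' : Type} [LinearOrder ι'] (e : ι' ≃ ι) (o : RL d c n c₀ m) :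
    (o.reindex e).edgeList =
      o.edgeList.map (Equiv.sigmaCongrLeft (β := fun i => Fin (n i + 1)) e).symm := by
  have h : ∀ j, (o.reindex e).seg j = (o.seg j).map
      (Equiv.sigmaCongrLeft (β := fun i => Fin (n i + 1)) e).symm := fun j => by
    rw [seg_reindex, ← List.map_eq_flatMap]
  rw [LatticePath.edgeList, funext h, ← List.map_flatMap]
  rfl

theorem symm_edge {ι ι' : Type} {n : ι → ℕ} (e : ι' ≃ ι) (i : ι') (r : Fin (n (e i) + 1)) :
    (Equiv.sigmaCongrLeft (β := fun i => Fin (n i + 1)) e).symm ⟨e i, r⟩ = ⟨i, r⟩ :=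
  (Equiv.symm_apply_eq _).2 rfl

theorem pos_reindex {ι' : Type} [LinearOrder ι'] (e : ι' ≃ ι) (o : RL d c n c₀ m) (i : ι') :
    (o.reindex e).pos i = o.pos (e i) := by
  ext r : 2
  refine (o.reindex e).pos_eq ?_
  rw [seg_reindex]
  exact List.mem_flatMap.2 ⟨_, o.mem_seg_pos (e i) r, by rw [symm_edge]; simp⟩

theorem before_reindex {ι' : Type} [LinearOrder ι'] (e : ι' ≃ ι) (o : RL d c n c₀ m) {i j : ι'}
    (h : o.Before (e i) (e j)) : (o.reindex e).Before i j := by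
  have := List.Sublist.map (Equiv.sigmaCongrLeft (β := fun i => Fin (n i + 1)) e).symm h
  rw [← edgeList_reindex] at this
  simp only [List.map_cons, List.map_nil, symm_edge] at this
  exact this

theorem precedes_reindex {ι' : Type} [LinearOrder ι'] (e : ι' ≃ ι) (o : RL d c n c₀ m) {i j : ι'}
    (h : o.Precedes (e i) (e j)) : (o.reindex e).Precedes i j := by
  rcases h with ⟨h1, h2, h⟩ | ⟨h1, h2⟩ | ⟨h1, h2, h⟩
  · exact Or.inl ⟨h1, h2, before_reindex e o h⟩
  · exact Or.inr (Or.inl ⟨h1, h2⟩)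
  · exact Or.inr (Or.inr ⟨h1, h2, before_reindex e o h⟩)

section Comp
variable {κ : ι → Type} [∀ i, LinearOrder (κ i)] {c' : ∀ i, κ i → Clr} {n' : ∀ i, κ i → ℕ}
  (o : RL d c n c₀ m) (y : ∀ i, RL d (c' i) (n' i) (c i) (n i))

theorem edgeList_comp : (o.comp y).edgeList =
    o.edgeList.flatMap fun a => ((y a.1).seg a.2).map (lexEdge a.1) := by
  rw [LatticePath.edgeList, funext (seg_comp o y), ← List.flatMap_assoc]
  rfl

theorem pos_comp (i : ι) (j : κ i) :
    (o.comp y).pos (toLex ⟨i, j⟩) = (o.pos i).comp ((y i).pos j) := by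
  ext r : 2
  refine (o.comp y).pos_eq ?_
  rw [seg_comp]
  exact List.mem_flatMap.2 ⟨_, o.mem_seg_pos i ((y i).pos j r),
    List.mem_map.2 ⟨⟨j, r⟩, (y i).mem_seg_pos j r, rfl⟩⟩

/-- The order of the edges of a composite at edges which replace different edges of the outer
path. -/
theorem comp_pair_sublist {a b : Σ i, Fin (n i + 1)} (h : [a, b].Sublist o.edgeList)
    {j : κ a.1} {r : Fin (n' a.1 j + 1)} (hr : ⟨j, r⟩ ∈ (y a.1).seg a.2)
    {k : κ b.1} {s : Fin (n' b.1 k + 1)} (hs : ⟨k, s⟩ ∈ (y b.1).seg b.2) :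
    [(⟨toLex ⟨a.1, j⟩, r⟩ : Σ t : Σₗ i, κ i, Fin (n' (ofLex t).1 (ofLex t).2 + 1)),
      ⟨toLex ⟨b.1, k⟩, s⟩].Sublist (o.comp y).edgeList := by
  rw [edgeList_comp]
  exact pair_sublist_flatMap h (List.mem_map.2 ⟨⟨j, r⟩, hr, rfl⟩)
    (List.mem_map.2 ⟨⟨k, s⟩, hs, rfl⟩)

theorem before_comp_of_before {i : ι} {j k : κ i} (h : (y i).Before j k) :
    (o.comp y).Before (toLex ⟨i, j⟩) (toLex ⟨i, k⟩) := by
  have h1 : ((y i).edgeList.map (lexEdge i)).Sublist (o.comp y).edgeList := by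
    rw [edgeList_comp]
    have := (o.edge_sublist i).flatMap fun a => ((y a.1).seg a.2).map (lexEdge a.1)
    rw [List.flatMap_map] at this
    have h2 : (y i).edgeList.map (lexEdge i) =
        (List.finRange (n i + 1)).flatMap fun r => ((y i).seg r).map (lexEdge i) :=
      List.map_flatMap ..
    rw [h2]
    exact this
  exact (List.Sublist.map (lexEdge i) h).trans h1

theorem before_comp_iff (i : ι) (j k : κ i) :
    (o.comp y).Before (toLex ⟨i, j⟩) (toLex ⟨i, k⟩) ↔ (y i).Before j k := by
  refine ⟨fun h => ?_, before_comp_of_before o y⟩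
  by_cases hjk : j = k
  · subst hjk
    exact absurd rfl h.ne
  · exact ((y i).before_total hjk).resolve_right fun h' => h.asymm (before_comp_of_before o y h')

/-- The first edges of a composite in two directions which belong to different inner paths occur
in the same order as the edges of the outer path which they replace. -/
theorem sublist_of_before_comp {i i' : ι} (hi : i ≠ i') {j : κ i} {j' : κ i'}
    (h : (o.comp y).Before (toLex ⟨i, j⟩) (toLex ⟨i', j'⟩)) :
    [(⟨i, (y i).pos j 0⟩ : Σ i, Fin (n i + 1)), ⟨i', (y i').pos j' 0⟩].Sublist o.edgeList := by
  refine (pair_sublist_total (o.mem_edgeList _) (o.mem_edgeList _)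
    fun h' => hi (congrArg Sigma.fst h')).resolve_right fun h' => h.asymm ?_
  exact comp_pair_sublist o y h' ((y i').mem_seg_pos j' 0) ((y i).mem_seg_pos j 0)

end Comp

/-- An alternating sequence of edges in two directions is an alternating sequence of letters. -/
theorem letters_sublist (o : RL d c n c₀ m) {s : List (Σ i, Fin (n i + 1))}
    (h : s.Sublist o.edgeList) : (s.map Sigma.fst).Sublist o.letters := h.map _

/-- In the second filtration stage, let `i` precede `i'` in the order of the inputs. If an edge in
the direction `i'` occurs before an edge `e` in the direction `i`, then all edges in the direction
`i'` occur before `e`: otherwise the word has the subword `i' i i'`, or even `i i' i i'` if both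
letters are closed, which is excluded by the filtration. -/
theorem all_before (o : RL 2 c n c₀ m) {i i' : ι} (h : o.Precedes i i') {r : Fin (n i + 1)}
    {r' : Fin (n i' + 1)}
    (h' : [(⟨i', r'⟩ : Σ i, Fin (n i + 1)), ⟨i, r⟩].Sublist o.edgeList) (s : Fin (n i' + 1)) :
    [(⟨i', s⟩ : Σ i, Fin (n i + 1)), ⟨i, r⟩].Sublist o.edgeList := by
  have hne := h.ne
  refine (pair_sublist_total (o.mem_edgeList _) (o.mem_edgeList _)
    fun h' => hne (congrArg Sigma.fst h').symm).resolve_right fun h2 => ?_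
  have hf := (filtered_iff 2 c _ o.mem_letters).1 o.filtered
  have h3 := pair_sublist_extend o.nodup_edgeList h' h2
  have l3 := o.letters_sublist h3
  simp only [List.map_cons, List.map_nil] at l3
  have c3 : [i', i, i'].IsChain (· ≠ ·) := by simp [hne, hne.symm]
  have m3 : ∀ a ∈ [i', i, i'], a = i ∨ a = i' := by simp
  rcases h with ⟨c1, c2, hb⟩ | ⟨c1, c2⟩ | ⟨c1, c2, hb⟩
  · have h0 : [(⟨i, 0⟩ : Σ i, Fin (n i + 1)), ⟨i', r'⟩].Sublist o.edgeList := hb.sublist r'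
    have l4 := o.letters_sublist (pair_sublist_extend o.nodup_edgeList h0 h3)
    have := (hf i i' hne _ l4 (by simp [hne, hne.symm]) (by simp)).1 c1 c2
    simp at this
  · have := (hf i i' hne _ l3 c3 m3).2.2 c1 c2 rfl
    simp at this
  · have := (hf i i' hne _ l3 c3 m3).2.1 c1 c2
    simp at this

end RL

/-! ### Algebras over `RL_2` from pairs of cosimplicial algebras -/

/-- Two cosimplicial algebras `X closed` and `X opn` with a map of cosimplicial algebras from the
first to the second one. The maps `map c c₀ ψ` combine the cosimplicial structures with this map;
`map opn closed ψ` carries no information. Elements which come from a closed one and from another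
one commute if the former are moved entirely to the left of the latter. -/
structure CosimplicialPair (R : Type u) [CommRing R] (X : Clr → ℕ → Type u)
    [∀ c n, AddCommGroup (X c n)] [∀ c n, Module R (X c n)] [∀ c n, Monoid (X c n)] where
  add_mul : ∀ {c n} (x y z : X c n), (x + y) * z = x * z + y * z
  mul_add : ∀ {c n} (x y z : X c n), x * (y + z) = x * y + x * z
  smul_mul : ∀ {c n} (r : R) (x y : X c n), (r • x) * y = r • (x * y)
  mul_smul : ∀ {c n} (r : R) (x y : X c n), x * (r • y) = r • (x * y)
  map : ∀ c c₀ {n m : ℕ}, (Fin (n + 1) →o Fin (m + 1)) → (X c n →ₗ[R] X c₀ m)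
  map_one : ∀ {c c₀ n m} (ψ : Fin (n + 1) →o Fin (m + 1)), (c₀ = .closed → c = .closed) →
    map c c₀ ψ 1 = 1
  map_mul : ∀ {c c₀ n m} (ψ : Fin (n + 1) →o Fin (m + 1)) (x y : X c n),
    (c₀ = .closed → c = .closed) → map c c₀ ψ (x * y) = map c c₀ ψ x * map c c₀ ψ y
  map_id : ∀ {c n} (x : X c n), map c c OrderHom.id x = x
  map_map : ∀ {c c' c₀ k n m} (φ : Fin (n + 1) →o Fin (m + 1)) (ψ : Fin (k + 1) →o Fin (n + 1))
    (x : X c k), (c₀ = .closed → c' = .closed) → (c' = .closed → c = .closed) →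
    map c' c₀ φ (map c c' ψ x) = map c c₀ (φ.comp ψ) x
  commute : ∀ {c c₀ k n m} (ψ : Fin (k + 1) →o Fin (m + 1)) (φ : Fin (n + 1) →o Fin (m + 1))
    (x : X .closed k) (y : X c n), (c₀ = .closed → c = .closed) → (∀ r s, ψ r ≤ φ s) →
    Commute (map .closed c₀ ψ x) (map c c₀ φ y)

namespace CosimplicialPair
variable {R : Type u} [CommRing R] {X : Clr → ℕ → Type u}
  [∀ c n, AddCommGroup (X c n)] [∀ c n, Module R (X c n)] [∀ c n, Monoid (X c n)]
  (P : CosimplicialPair R X)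

section
variable {ι : Type} [LinearOrder ι] {c : ι → Clr} {n : ι → ℕ} {c₀ : Clr} {d m : ℕ}

/-- The factor of the value of an operation which belongs to the input `i`. -/
noncomputable def factor (o : RL d c n c₀ m) (x : ∀ i, X (c i) (n i)) (i : ι) : X c₀ m :=
  P.map (c i) c₀ (o.pos i) (x i)

/-- The value of an operation: the product of its factors. -/
noncomputable def actFun (o : RL d c n c₀ m) (x : ∀ i, X (c i) (n i)) : X c₀ m :=
  (o.order.map (P.factor o x)).prod

/-- The product may be taken in any other order, if any two factors which change their order
commute. -/
theorem actFun_eq_of_perm (o : RL d c n c₀ m) (x : ∀ i, X (c i) (n i)) {l : List ι}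
    (hl : l.Nodup) (h : ∀ i, i ∈ l) (hc : ∀ i j, [i, j].Sublist l → o.Precedes j i →
      Commute (P.factor o x i) (P.factor o x j)) :
    P.actFun o x = (l.map (P.factor o x)).prod :=
  (prod_map_eq_of_perm _ hl (o.order_perm hl h) fun i j h1 h2 =>
    hc i j h1 (o.precedes_of_sublist h2)).symm

theorem factor_update [DecidableEq ι] (o : RL d c n c₀ m) (x : ∀ i, X (c i) (n i)) (i : ι)
    (v : X (c i) (n i)) : P.factor o (Function.update x i v) =
      Function.update (P.factor o x) i (P.map (c i) c₀ (o.pos i) v) := by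
  funext j
  by_cases h : j = i
  · subst h; simp [factor]
  · simp [factor, h]

/-- As a function of its `i`-th argument, an operation is `v ↦ a * P.map _ _ _ v * b`. -/
theorem exists_actFun_update [DecidableEq ι] (o : RL d c n c₀ m) (x : ∀ i, X (c i) (n i))
    (i : ι) : ∃ a b : X c₀ m, ∀ v, P.actFun o (Function.update x i v) =
      a * P.map (c i) c₀ (o.pos i) v * b := by
  obtain ⟨s, t, h⟩ := List.append_of_mem (o.mem_order i)
  have hn := o.nodup_order
  rw [h, List.nodup_middle] at hn
  have hi := (List.nodup_cons.1 hn).1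
  refine ⟨(s.map (P.factor o x)).prod, (t.map (P.factor o x)).prod, fun v => ?_⟩
  have hs : s.map (P.factor o (Function.update x i v)) = s.map (P.factor o x) :=
    List.map_congr_left fun j hj => by
      rw [factor_update, Function.update_of_ne]
      rintro rfl
      exact hi (List.mem_append_left _ hj)
  have ht : t.map (P.factor o (Function.update x i v)) = t.map (P.factor o x) :=
    List.map_congr_left fun j hj => by
      rw [factor_update, Function.update_of_ne]
      rintro rfl
      exact hi (List.mem_append_right _ hj)
  rw [actFun, h, List.map_append, List.map_cons, hs, ht, factor_update, Function.update_self,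
    List.prod_append, List.prod_cons, mul_assoc]

/-- The value of an operation, as a multilinear map. -/
noncomputable def act (o : RL d c n c₀ m) : MultilinearMap R (fun i => X (c i) (n i)) (X c₀ m) :=
  MultilinearMap.mk' (P.actFun o)
    (fun x i v w => by
      obtain ⟨a, b, h⟩ := P.exists_actFun_update o x i
      rw [h, h, h, _root_.map_add, P.mul_add, P.add_mul])
    (fun x i r v => by
      obtain ⟨a, b, h⟩ := P.exists_actFun_update o x i
      rw [h, h, _root_.map_smul, P.mul_smul, P.smul_mul])

theorem act_apply (o : RL d c n c₀ m) (x : ∀ i, X (c i) (n i)) : P.act o x = P.actFun o x := rfl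

theorem map_prod {c c₀ : Clr} {n m : ℕ} (ψ : Fin (n + 1) →o Fin (m + 1))
    (h : c₀ = .closed → c = .closed) (l : List (X c n)) :
    P.map c c₀ ψ l.prod = (l.map (P.map c c₀ ψ)).prod := by
  induction l with
  | nil => rw [List.prod_nil, P.map_one ψ h]; rfl
  | cons a l ih => rw [List.prod_cons, P.map_mul ψ _ _ h, ih, List.map_cons, List.prod_cons]

end

theorem act_unary (c₀ : Clr) {k m d : ℕ} (ψ : Fin (k + 1) →o Fin (m + 1)) (x : Unit → X c₀ k) :
    P.act (RL.unary d c₀ ψ) x = P.map c₀ c₀ ψ (x ()) := by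
  rw [act_apply, P.actFun_eq_of_perm (l := [()]) _ _ (by simp) (by simp)
    (fun i j h h' => absurd (Subsingleton.elim _ _) h'.ne)]
  simp [factor, RL.pos_unary]

theorem act_reindex {ι ι' : Type} [LinearOrder ι] [LinearOrder ι'] {c : ι → Clr} {n : ι → ℕ}
    {c₀ : Clr} {d m : ℕ} (e : ι' ≃ ι) (o : RL d c n c₀ m) (x : ∀ i, X (c i) (n i)) :
    P.act (o.reindex e) (fun i => x (e i)) = P.act o x := by
  rw [act_apply, act_apply, P.actFun_eq_of_perm (l := o.order.map e.symm)]
  · rw [List.map_map, actFun]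
    congr 1
    refine List.map_congr_left fun i _ => ?_
    have h : ∀ j, P.factor (o.reindex e) (fun i => x (e i)) j = P.factor o x (e j) := fun j => by
      rw [factor, factor, RL.pos_reindex]
    rw [Function.comp_apply, h, Equiv.apply_symm_apply]
  · exact o.nodup_order.map e.symm.injective
  · exact fun i => List.mem_map.2 ⟨e i, o.mem_order _, by simp⟩
  · intro i j h h'
    obtain ⟨s, hs, hs'⟩ := List.sublist_map_iff.1 h
    have h1 : s = [e i, e j] := by
      have := congrArg (List.map e) hs'
      simpa using this.symm
    subst h1
    exact absurd h' (RL.precedes_reindex e o (o.precedes_of_sublist hs)).asymm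

/-- The values of a composite and of its constituents are products of the same factors, but in
different orders: one is the order of the inputs of the composite, the other one is
lexicographic. Two factors whose order differs commute, because one of them is closed and is moved
entirely to the left of the other one, by `RL.all_before`. -/
theorem act_comp {ι : Type} [LinearOrder ι] {κ : ι → Type} [∀ i, LinearOrder (κ i)]
    {c : ι → Clr} {n : ι → ℕ} {c₀ : Clr} {m : ℕ} {c' : ∀ i, κ i → Clr}
    {n' : ∀ i, κ i → ℕ} (o : RL 2 c n c₀ m) (y : ∀ i, RL 2 (c' i) (n' i) (c i) (n i))
    (x : ∀ i j, X (c' i j) (n' i j)) :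
    P.act (o.comp y) (fun t => x (ofLex t).1 (ofLex t).2) = P.act o fun i => P.act (y i) (x i) := by
  have hfac : ∀ i j, P.factor (o.comp y) (fun t => x (ofLex t).1 (ofLex t).2) (toLex ⟨i, j⟩) =
      P.map (c i) c₀ (o.pos i) (P.factor (y i) (x i) j) := by
    intro i j
    rw [factor, factor, RL.pos_comp, P.map_map]
    · rfl
    · exact fun h => o.split h i
    · exact fun h => (y i).split h j
  rw [act_apply, act_apply, P.actFun_eq_of_perm
    (l := o.order.flatMap fun i => (y i).order.map fun j => (toLex ⟨i, j⟩ : Σₗ i, κ i))]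
  · rw [actFun, List.map_flatMap, List.flatMap_def, List.prod_flatten, List.map_map]
    congr 1
    refine List.map_congr_left fun i _ => ?_
    rw [factor, act_apply, actFun, P.map_prod _ fun h => o.split h i]
    simp only [Function.comp_apply, List.map_map]
    congr 1
    exact List.map_congr_left fun j _ => hfac i j
  · rw [List.nodup_flatMap]
    refine ⟨fun i _ => (y i).nodup_order.map fun a b h => ?_, o.nodup_order.imp ?_⟩
    · have h' : (⟨i, a⟩ : Σ i, κ i) = ⟨i, b⟩ := toLex.injective h
      simpa using h'
    · intro i i' hi t ht ht'
      obtain ⟨j, -, rfl⟩ := List.mem_map.1 ht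
      obtain ⟨j', -, h⟩ := List.mem_map.1 ht'
      have h' : (⟨i', j'⟩ : Σ i, κ i) = ⟨i, j⟩ := toLex.injective h
      exact hi (congrArg Sigma.fst h').symm
  · rintro ⟨i, j⟩
    exact List.mem_flatMap.2 ⟨i, o.mem_order i, List.mem_map.2 ⟨j, (y i).mem_order j, rfl⟩⟩
  · suffices H : (o.order.flatMap fun i => (y i).order.map fun j =>
        (toLex ⟨i, j⟩ : Σₗ i, κ i)).Pairwise fun s t => (o.comp y).Precedes t s →
        Commute (P.factor (o.comp y) (fun t => x (ofLex t).1 (ofLex t).2) s)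
          (P.factor (o.comp y) (fun t => x (ofLex t).1 (ofLex t).2) t) from
      fun i j h => List.pairwise_iff_forall_sublist.1 H h
    rw [List.pairwise_flatMap]
    refine ⟨fun i _ => ?_, o.pairwise_order.imp fun {i i'} hii => ?_⟩
    · -- Within one inner path, the two orders agree.
      rw [List.pairwise_map]
      refine (y i).pairwise_order.imp fun {j j'} h h' => absurd h ?_
      suffices (y i).Precedes j' j from this.asymm
      rcases h' with ⟨h1, h2, h⟩ | ⟨h1, h2⟩ | ⟨h1, h2, h⟩
      · exact Or.inl ⟨h1, h2, (RL.before_comp_iff o y i _ _).1 h⟩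
      · exact Or.inr (Or.inl ⟨h1, h2⟩)
      · exact Or.inr (Or.inr ⟨h1, h2, (RL.before_comp_iff o y i _ _).1 h⟩)
    · intro s hs t ht h'
      obtain ⟨j, -, rfl⟩ := List.mem_map.1 hs
      obtain ⟨j', -, rfl⟩ := List.mem_map.1 ht
      have hop : ∀ i j, c' i j = .opn → c i = .opn := fun i j h => by
        cases hc : c i with
        | closed => rw [(y i).split hc j] at h; cases h
        | opn => rfl
      -- In every case, the second factor is closed, and its path begins before the first one.
      have key : c' i' j' = .closed ∧
          (o.comp y).Before (toLex ⟨i', j'⟩) (toLex ⟨i, j⟩) := by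
        rcases h' with ⟨h1, h2, h⟩ | ⟨h1, h2⟩ | ⟨h1, h2, h⟩
        · exact ⟨h1, h⟩
        · refine ⟨h1, ?_⟩
          have hi := hop i j h2
          rcases hii with ⟨h3, _, _⟩ | ⟨h3, _⟩ | ⟨h3, h4, h5⟩
          · rw [h3] at hi; cases hi
          · rw [h3] at hi; cases hi
          · refine RL.comp_pair_sublist o y (RL.all_before o (Or.inr (Or.inr ⟨h3, h4, h5⟩))
              (h5.sublist ((y i).pos j 0)) _) ((y i').mem_seg_pos j' 0) ((y i).mem_seg_pos j 0)
        · exfalso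
          have hi := hop i j h2
          rcases hii with ⟨h3, _, _⟩ | ⟨h3, _⟩ | ⟨h3, h4, h5⟩
          · rw [h3] at hi; cases hi
          · rw [h3] at hi; cases hi
          · have h6 := RL.sublist_of_before_comp o y h5.ne.symm h
            have h7 := RL.all_before o (Or.inr (Or.inr ⟨h3, h4, h5⟩))
              (h5.sublist ((y i).pos j 0)) ((y i').pos j' 0)
            exact pair_sublist_asymm o.nodup_edgeList h7 h6
      obtain ⟨hcl, hb⟩ := key
      have hb := RL.sublist_of_before_comp o y hii.ne.symm hb
      have hall := RL.all_before o hii hb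
      have hpos : ∀ r s, (o.comp y).pos (toLex ⟨i', j'⟩) r ≤
          (o.comp y).pos (toLex ⟨i, j⟩) s := by
        intro r s
        refine le_trans ?_ ((o.comp y).pos _ |>.monotone (Fin.zero_le s))
        rw [RL.pos_comp, RL.pos_comp]
        exact o.le_of_pair_sublist (o.mem_seg_pos _ _) (o.mem_seg_pos _ _) (hall _)
      refine Commute.symm ?_
      -- The colour is generalized, so that it can be replaced by `closed`.
      have hg : ∀ (c₁ : Clr) (ψ : Fin (n' i' j' + 1) →o Fin (m + 1)) (z : X c₁ (n' i' j')),
          c₁ = .closed → (∀ r s, ψ r ≤ (o.comp y).pos (toLex ⟨i, j⟩) s) →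
          Commute (P.map c₁ c₀ ψ z)
            (P.factor (o.comp y) (fun t => x (ofLex t).1 (ofLex t).2) (toLex ⟨i, j⟩)) := by
        rintro c₁ ψ z rfl hz
        exact P.commute ψ _ z _ (fun h => (o.comp y).split h _) hz
      exact hg _ _ _ hcl hpos

/-- A pair of cosimplicial algebras is an algebra over the second filtration stage of the operad of
lattice paths. -/
noncomputable def rlAlg : RLAlg R 2 X where
  act o := P.act o
  act_unit c₀ n x := by rw [act_unary, P.map_id]
  act_reindex e o x := P.act_reindex e o x
  act_comp o y x := P.act_comp o y x

theorem rlAlg_cosimp (c : Clr) {k l : ℕ} (ψ : Fin (k + 1) →o Fin (l + 1)) :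
    P.rlAlg.cosimp c ψ = P.map c c ψ := by
  ext x
  change P.act (RL.unary 2 c ψ) _ = _
  rw [act_unary]
  simp

end CosimplicialPair

open TensorProduct

/-! ### Iterated coproducts as convolutions -/

section Convolution
variable {R B M A A' : Type*} [CommRing R] [Ring B] [Bialgebra R B] [AddCommGroup M] [Module R M]
  [Ring A] [Algebra R A] [Ring A'] [Algebra R A']

/-- The convolution of a linear map on `B` with a linear map on a module `M`, along a map
`ρ : M → B ⊗ M`. -/
noncomputable def conv (ρ : M →ₗ[R] B ⊗[R] M) (f : B →ₗ[R] A) (h : M →ₗ[R] A) : M →ₗ[R] A :=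
  LinearMap.mul' R A ∘ₗ TensorProduct.map f h ∘ₗ ρ

theorem conv_assoc (ρ : M →ₗ[R] B ⊗[R] M)
    (hρ : (TensorProduct.assoc R B B M).toLinearMap ∘ₗ
      (Coalgebra.comul (R := R) (A := B)).rTensor M ∘ₗ ρ = ρ.lTensor B ∘ₗ ρ)
    (f g : B →ₗ[R] A) (h : M →ₗ[R] A) :
    conv ρ (conv Coalgebra.comul f g) h = conv ρ f (conv ρ g h) := by
  ext x
  have h1 : ∀ t : B ⊗[R] M, LinearMap.mul' R A (TensorProduct.map f (conv ρ g h) t) =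
      LinearMap.mul' R A (TensorProduct.map f (LinearMap.mul' R A ∘ₗ TensorProduct.map g h)
        (ρ.lTensor B t)) := fun t => by
    induction t using TensorProduct.induction_on with
    | zero => simp
    | add a b ha hb => simp only [map_add, ha, hb]
    | tmul b m => simp [conv]
  have h2 : ∀ t : B ⊗[R] M, LinearMap.mul' R A
      (TensorProduct.map (conv Coalgebra.comul f g) h t) =
      LinearMap.mul' R A (TensorProduct.map (LinearMap.mul' R A ∘ₗ TensorProduct.map f g) h
        ((Coalgebra.comul (R := R) (A := B)).rTensor M t)) := fun t => by
    induction t using TensorProduct.induction_on with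
    | zero => simp
    | add a b ha hb => simp only [map_add, ha, hb]
    | tmul b m => simp [conv]
  have h3 : ∀ t : (B ⊗[R] B) ⊗[R] M, LinearMap.mul' R A
      (TensorProduct.map (LinearMap.mul' R A ∘ₗ TensorProduct.map f g) h t) =
      LinearMap.mul' R A (TensorProduct.map f (LinearMap.mul' R A ∘ₗ TensorProduct.map g h)
        (TensorProduct.assoc R B B M t)) := fun t => by
    induction t using TensorProduct.induction_on with
    | zero => simp
    | add a b ha hb => simp only [map_add, ha, hb]
    | tmul s m =>
      induction s using TensorProduct.induction_on with
      | zero => simp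
      | add a b ha hb => simp only [map_add, TensorProduct.add_tmul, ha, hb]
      | tmul a b => simp [mul_assoc]
  have h4 := LinearMap.congr_fun hρ x
  simp only [LinearMap.comp_apply, LinearEquiv.coe_coe] at h4
  calc conv ρ (conv Coalgebra.comul f g) h x = _ := h2 (ρ x)
    _ = _ := h3 _
    _ = _ := by rw [h4]
    _ = _ := (h1 (ρ x)).symm

theorem counit_conv (ρ : M →ₗ[R] B ⊗[R] M)
    (hρ : (TensorProduct.lid R M).toLinearMap ∘ₗ
      (Coalgebra.counit (R := R) (A := B)).rTensor M ∘ₗ ρ = LinearMap.id)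
    (h : M →ₗ[R] A) : conv ρ (Algebra.linearMap R A ∘ₗ Coalgebra.counit) h = h := by
  ext x
  have h1 : ∀ t : B ⊗[R] M, LinearMap.mul' R A
      (TensorProduct.map (Algebra.linearMap R A ∘ₗ Coalgebra.counit) h t) =
      h (TensorProduct.lid R M ((Coalgebra.counit (R := R) (A := B)).rTensor M t)) := fun t => by
    induction t using TensorProduct.induction_on with
    | zero => simp
    | add a b ha hb => simp only [map_add, ha, hb]
    | tmul b m => simp [Algebra.smul_def]
  exact (h1 (ρ x)).trans (congrArg h (LinearMap.congr_fun hρ x))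

theorem conv_counit (f : B →ₗ[R] A) :
    conv Coalgebra.comul f (Algebra.linearMap R A ∘ₗ Coalgebra.counit) = f := by
  ext x
  have h1 : ∀ t : B ⊗[R] B, LinearMap.mul' R A
      (TensorProduct.map f (Algebra.linearMap R A ∘ₗ Coalgebra.counit) t) =
      f (TensorProduct.rid R B ((Coalgebra.counit (R := R) (A := B)).lTensor B t)) := fun t => by
    induction t using TensorProduct.induction_on with
    | zero => simp
    | add a b ha hb => simp only [map_add, ha, hb]
    | tmul b m =>
      simp only [TensorProduct.map_tmul, LinearMap.mul'_apply, LinearMap.comp_apply,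
        Algebra.linearMap_apply, LinearMap.lTensor_tmul, TensorProduct.rid_tmul]
      rw [map_smul, Algebra.smul_def, Algebra.commutes]
  refine (h1 (Coalgebra.comul x)).trans (congrArg f ?_)
  simp

theorem comp_conv (ρ : M →ₗ[R] B ⊗[R] M) (f : B →ₗ[R] A) (h : M →ₗ[R] A) (φ : A →ₗ[R] A')
    (hφ : ∀ x y, φ (x * y) = φ x * φ y) : φ ∘ₗ conv ρ f h = conv ρ (φ ∘ₗ f) (φ ∘ₗ h) := by
  ext x
  simp only [conv, LinearMap.comp_apply]
  generalize ρ x = t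
  induction t using TensorProduct.induction_on with
  | zero => simp
  | add a b ha hb => simp only [map_add, ha, hb]
  | tmul b m => simp [hφ]

theorem commute_conv (ρ : M →ₗ[R] B ⊗[R] M) (f : B →ₗ[R] A) (h : M →ₗ[R] A) (z : A)
    (hf : ∀ b, Commute z (f b)) (hh : ∀ x, Commute z (h x)) (x : M) :
    Commute z (conv ρ f h x) := by
  simp only [conv, LinearMap.comp_apply]
  generalize ρ x = t
  induction t using TensorProduct.induction_on with
  | zero => simp
  | add a b ha hb => simpa only [map_add] using ha.add_right hb
  | tmul b m => simpa using (hf b).mul_right (hh m)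

/-- The convolution of two multiplicative maps with commuting images is multiplicative. -/
theorem conv_mul {C : Type*} [Ring C] [Algebra R C] (ρ : C →ₐ[R] B ⊗[R] C) (f : B →ₗ[R] A)
    (h : C →ₗ[R] A) (hf : ∀ a b, f (a * b) = f a * f b) (hh : ∀ a b, h (a * b) = h a * h b)
    (hc : ∀ b c, Commute (f b) (h c)) (x y : C) :
    conv ρ.toLinearMap f h (x * y) = conv ρ.toLinearMap f h x * conv ρ.toLinearMap f h y := by
  simp only [conv, LinearMap.comp_apply, AlgHom.toLinearMap_apply, map_mul]
  generalize ρ x = s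
  generalize ρ y = t
  induction s using TensorProduct.induction_on with
  | zero => simp
  | add a b ha hb => simp only [map_add, _root_.add_mul, ha, hb]
  | tmul b m =>
    induction t using TensorProduct.induction_on with
    | zero => simp
    | add a b ha hb => simp only [map_add, _root_.mul_add, ha, hb]
    | tmul b' m' =>
      simp only [Algebra.TensorProduct.tmul_mul_tmul, TensorProduct.map_tmul,
        LinearMap.mul'_apply, hf, hh]
      rw [mul_assoc, mul_assoc, ← mul_assoc (f b'), (hc b' m).eq, mul_assoc]

theorem conv_one {C : Type*} [Ring C] [Algebra R C] (ρ : C →ₐ[R] B ⊗[R] C) (f : B →ₗ[R] A)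
    (h : C →ₗ[R] A) (hf : f 1 = 1) (hh : h 1 = 1) : conv ρ.toLinearMap f h 1 = 1 := by
  simp [conv, Algebra.TensorProduct.one_def, hf, hh]

end Convolution

section OfFn

theorem prod_ofFn_mul {A : Type*} [Monoid A] {k : ℕ} (f g : Fin k → A)
    (h : ∀ i j, i ≠ j → Commute (f i) (g j)) :
    (List.ofFn fun j => f j * g j).prod = (List.ofFn f).prod * (List.ofFn g).prod := by
  induction k with
  | zero => simp
  | succ k ih =>
    simp only [List.ofFn_succ, List.prod_cons]
    rw [ih _ _ fun i j hij => h i.succ j.succ fun h' => hij (Fin.succ_injective _ h')]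
    have hc : Commute (g 0) (List.ofFn fun j : Fin k => f j.succ).prod := by
      refine Commute.list_prod_right _ _ fun x hx => ?_
      obtain ⟨j, rfl⟩ := (List.mem_ofFn' _ _).1 hx
      exact (h j.succ 0 (Fin.succ_ne_zero _)).symm
    rw [mul_assoc, ← mul_assoc (g 0), hc.eq]
    simp only [mul_assoc]

theorem prod_ofFn_one {A : Type*} [Monoid A] {k : ℕ} (f : Fin k → A) (h : ∀ j, f j = 1) :
    (List.ofFn f).prod = 1 := by
  refine List.prod_eq_one fun x hx => ?_
  obtain ⟨j, rfl⟩ := (List.mem_ofFn' _ _).1 hx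
  exact h j

theorem prod_ofFn_single {A : Type*} [Monoid A] {k : ℕ} (f : Fin k → A) (i : Fin k)
    (h : ∀ j, j ≠ i → f j = 1) : (List.ofFn f).prod = f i := by
  induction k with
  | zero => exact i.elim0
  | succ k ih =>
    rw [List.ofFn_succ, List.prod_cons]
    induction i using Fin.cases with
    | zero => rw [prod_ofFn_one _ fun j => h _ (Fin.succ_ne_zero j), mul_one]
    | succ i =>
      rw [h 0 (Fin.succ_ne_zero i).symm, one_mul]
      exact ih _ i fun j hj => h _ fun h' => hj (Fin.succ_injective _ h')

end OfFn

noncomputable section Spread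
variable {R B C : Type u} [CommRing R] [Ring B] [Bialgebra R B] [Ring C] [Algebra R C]

/-- The algebra map which places an element at the position `p` of `B^{⊗ N}`. -/
abbrev single {N : ℕ} (p : Fin N) : B →ₐ[R] ⨂[R]^N B :=
  PiTensorProduct.singleAlgHom (R := R) (A := fun _ : Fin N => B) p

variable (R B C) in
/-- The inclusion of `B^{⊗ N}` in `B^{⊗ N} ⊗ C`. -/
abbrev inclL {N : ℕ} : (⨂[R]^N B) →ₐ[R] (⨂[R]^N B) ⊗[R] C :=
  Algebra.TensorProduct.includeLeft (S := R)

theorem commute_single {N : ℕ} {p q : Fin N} (h : p ≠ q) (b b' : B) :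
    Commute (single (R := R) p b) (single q b') := by
  simp only [PiTensorProduct.singleAlgHom_apply]
  refine Commute.tprod ?_
  exact Pi.mulSingle_commute (f := fun _ : Fin N => B) h b b'

theorem spread_cons {N : ℕ} (p : Fin N) (P : List (Fin N)) :
    spread (R := R) (B := B) (p :: P) =
      conv Coalgebra.comul (single p).toLinearMap (spread P) := rfl

theorem spread_nil {N : ℕ} : spread (R := R) (B := B) ([] : List (Fin N)) =
    Algebra.linearMap R _ ∘ₗ Coalgebra.counit := rfl

theorem comul_coassoc : (TensorProduct.assoc R B B B).toLinearMap ∘ₗ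
    (Coalgebra.comul (R := R) (A := B)).rTensor B ∘ₗ Coalgebra.comul =
    (Coalgebra.comul (R := R) (A := B)).lTensor B ∘ₗ Coalgebra.comul := Coalgebra.coassoc

theorem comul_counit : (TensorProduct.lid R B).toLinearMap ∘ₗ
    (Coalgebra.counit (R := R) (A := B)).rTensor B ∘ₗ Coalgebra.comul = LinearMap.id := by
  ext x
  simp

/-- Coassociativity of the iterated coproduct. -/
theorem spread_append {N : ℕ} (P Q : List (Fin N)) :
    spread (R := R) (B := B) (P ++ Q) = conv Coalgebra.comul (spread P) (spread Q) := by
  induction P with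
  | nil => rw [List.nil_append, spread_nil, counit_conv _ comul_counit]
  | cons p P ih => rw [List.cons_append, spread_cons, ih, spread_cons, conv_assoc _ comul_coassoc]

theorem spread_one {N : ℕ} (P : List (Fin N)) : spread (R := R) (B := B) P 1 = 1 := by
  induction P with
  | nil => simp [spread_nil]
  | cons p P ih =>
    exact conv_one (Bialgebra.comulAlgHom R B) _ _ (map_one (single p)) ih

/-- An element commutes with the values of `spread P` if it commutes with the elements at the
positions in `P`. -/
theorem commute_spread {N : ℕ} (P : List (Fin N)) {A : Type*} [Ring A] [Algebra R A]
    (φ : (⨂[R]^N B) →ₐ[R] A) (z : A) (h : ∀ p ∈ P, ∀ b, Commute z (φ (single p b))) (b : B) :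
    Commute z (φ (spread P b)) := by
  induction P generalizing b with
  | nil =>
    simp only [spread_nil, LinearMap.comp_apply, Algebra.linearMap_apply, AlgHom.commutes]
    exact (Algebra.commutes _ z).symm
  | cons p P ih =>
    have := LinearMap.congr_fun (comp_conv (Coalgebra.comul (R := R) (A := B))
      (single p).toLinearMap (spread P) φ.toLinearMap (map_mul φ)) b
    rw [spread_cons]
    refine Eq.subst (motive := fun y => Commute z y) this.symm ?_
    exact commute_conv _ _ _ _ (fun b => h p List.mem_cons_self b)
      (fun b => ih (fun q hq => h q (List.mem_cons_of_mem _ hq)) b) b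

theorem commute_spread_spread {N : ℕ} {P Q : List (Fin N)} (h : P.Disjoint Q) (a b : B) :
    Commute (spread (R := R) P a) (spread Q b) := by
  refine commute_spread Q (AlgHom.id R _) _ (fun q hq b => ?_) b
  refine (commute_spread P (AlgHom.id R _) _ (fun p hp a => ?_) a).symm
  exact commute_single (fun h' : q = p => h (h' ▸ hp) hq) _ _

theorem spread_mul {N : ℕ} {P : List (Fin N)} (hP : P.Nodup) (a b : B) :
    spread (R := R) P (a * b) = spread P a * spread P b := by
  induction P generalizing a b with
  | nil => simp [spread_nil]
  | cons p P ih =>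
    have hp := List.nodup_cons.1 hP
    refine conv_mul (Bialgebra.comulAlgHom R B) _ _ (map_mul (single p)) (ih hp.2) ?_ a b
    intro b c
    refine commute_spread P (AlgHom.id R _) _ (fun q hq c => ?_) c
    exact commute_single (fun h : p = q => hp.1 (h ▸ hq)) _ _

theorem distribute_tprod {k N : ℕ} (P : Fin k → List (Fin N)) (b : Fin k → B) :
    distribute P (PiTensorProduct.tprod R b) = (List.ofFn fun j => spread (P j) (b j)).prod := by
  rw [distribute, PiTensorProduct.lift.tprod]
  rfl

/-- The lists of positions have no repetitions and are pairwise disjoint. -/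
def Separated {k N : ℕ} (P : Fin k → List (Fin N)) : Prop :=
  (∀ j, (P j).Nodup) ∧ ∀ i j, i ≠ j → (P i).Disjoint (P j)

theorem distribute_one {k N : ℕ} (P : Fin k → List (Fin N)) :
    distribute (R := R) (B := B) P 1 = 1 := by
  rw [PiTensorProduct.one_def, distribute_tprod]
  exact prod_ofFn_one _ fun j => spread_one _

theorem distribute_mul {k N : ℕ} {P : Fin k → List (Fin N)} (hP : Separated P)
    (x y : ⨂[R]^k B) : distribute P (x * y) = distribute P x * distribute P y := by
  induction x using PiTensorProduct.induction_on with
  | add a b ha hb => simp only [_root_.add_mul, map_add, ha, hb]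
  | smul_tprod r a =>
    induction y using PiTensorProduct.induction_on with
    | add a b ha hb => simp only [_root_.mul_add, map_add, ha, hb]
    | smul_tprod s b =>
      simp only [smul_mul_assoc, mul_smul_comm, map_smul, PiTensorProduct.tprod_mul_tprod,
        distribute_tprod]
      rw [← prod_ofFn_mul]
      · simp only [Pi.mul_apply, spread_mul (hP.1 _)]
      · exact fun i j hij => commute_spread_spread (hP.2 i j hij) _ _

/-- The map `distribute P` as a map of algebras. -/
def distributeAlg {k N : ℕ} (P : Fin k → List (Fin N)) (hP : Separated P) :
    (⨂[R]^k B) →ₐ[R] ⨂[R]^N B :=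
  AlgHom.ofLinearMap (distribute P) (distribute_one P) (distribute_mul hP)

theorem commute_distribute {k N : ℕ} (P : Fin k → List (Fin N)) {A : Type*} [Ring A] [Algebra R A]
    (φ : (⨂[R]^N B) →ₐ[R] A) (z : A)
    (h : ∀ j, ∀ p ∈ P j, ∀ b, Commute z (φ (single p b))) (x : ⨂[R]^k B) :
    Commute z (φ (distribute P x)) := by
  induction x using PiTensorProduct.induction_on with
  | add a b ha hb => simpa only [map_add] using ha.add_right hb
  | smul_tprod r a =>
    rw [map_smul, map_smul, distribute_tprod, map_list_prod]
    refine Commute.smul_right (Commute.list_prod_right _ _ fun x hx => ?_) r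
    obtain ⟨y, hy, rfl⟩ := List.mem_map.1 hx
    obtain ⟨j, rfl⟩ := (List.mem_ofFn' _ _).1 hy
    exact commute_spread (P j) φ z (h j) _

theorem distribute_single {k N : ℕ} (P : Fin k → List (Fin N)) (p : Fin k) (b : B) :
    distribute (R := R) P (single p b) = spread (P p) b := by
  rw [PiTensorProduct.singleAlgHom_apply, distribute_tprod, prod_ofFn_single _ p]
  · simp
  · intro j hj
    simp [hj, spread_one]

theorem distribute_spread {k N : ℕ} {Q : Fin k → List (Fin N)} (hQ : Separated Q)
    (P : List (Fin k)) (b : B) :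
    distribute (R := R) Q (spread P b) = spread (P.flatMap Q) b := by
  induction P generalizing b with
  | nil => simp [spread_nil, Algebra.algebraMap_eq_smul_one, distribute_one]
  | cons p P ih =>
    rw [List.flatMap_cons, spread_append, spread_cons]
    refine (LinearMap.congr_fun (comp_conv (Coalgebra.comul (R := R) (A := B))
      (single p).toLinearMap (spread P) (distribute Q) (distribute_mul hQ)) b).trans ?_
    congr 2
    · ext b
      exact distribute_single Q p b
    · ext b
      exact ih b

/-- Distributing twice is distributing along the composite, by coassociativity. -/
theorem distribute_distribute {k l N : ℕ} (P : Fin k → List (Fin l)) {Q : Fin l → List (Fin N)}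
    (hQ : Separated Q) (x : ⨂[R]^k B) :
    distribute Q (distribute P x) = distribute (fun j => (P j).flatMap Q) x := by
  induction x using PiTensorProduct.induction_on with
  | add a b ha hb => simp only [map_add, ha, hb]
  | smul_tprod r a =>
    rw [map_smul, map_smul, map_smul, distribute_tprod, distribute_tprod]
    change r • distributeAlg Q hQ _ = _
    rw [map_list_prod, List.map_ofFn]
    congr 3
    funext j
    exact distribute_spread hQ _ _

theorem spread_singleton {N : ℕ} (p : Fin N) : spread (R := R) (B := B) [p] =
    (single p).toLinearMap := conv_counit _

theorem separated_singleton (k : ℕ) : Separated fun j : Fin k => [j] :=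
  ⟨fun _ => List.nodup_singleton _, fun i j h => by simpa using h.symm⟩

theorem distribute_singleton {k : ℕ} (x : ⨂[R]^k B) : distribute (fun j => [j]) x = x := by
  have : distributeAlg (R := R) (B := B) (fun j : Fin k => [j]) (separated_singleton k) =
      AlgHom.id R _ := by
    refine PiTensorProduct.algHom_ext fun j => ?_
    ext b
    refine (distribute_single _ _ _).trans ?_
    rw [spread_singleton]
    rfl
  exact DFunLike.congr_fun this x

end Spread
/-! ### Iterated coactions -/

noncomputable section SpreadC
variable {R B C : Type u} [CommRing R] [Ring B] [Bialgebra R B] [Ring C] [Algebra R C]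
variable (S : LeftCoaction R B C)

theorem spreadC_nil {N : ℕ} : spreadC S ([] : List (Fin N)) =
    (Algebra.TensorProduct.includeRight : C →ₐ[R] (⨂[R]^N B) ⊗[R] C).toLinearMap := rfl

theorem spreadC_cons {N : ℕ} (p : Fin N) (P : List (Fin N)) :
    spreadC S (p :: P) = conv S.coact.toLinearMap
      ((inclL R B C).toLinearMap ∘ₗ (single p).toLinearMap) (spreadC S P) := rfl

theorem spreadC_append {N : ℕ} (P Q : List (Fin N)) :
    spreadC S (P ++ Q) =
      conv S.coact.toLinearMap ((inclL R B C).toLinearMap ∘ₗ spread P) (spreadC S Q) := by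
  induction P with
  | nil =>
    have h : (inclL R B C (N := N)).toLinearMap ∘ₗ spread [] =
        Algebra.linearMap R _ ∘ₗ Coalgebra.counit := by
      ext b
      exact AlgHom.commutes (inclL R B C) _
    rw [List.nil_append, h, counit_conv _ S.counit_coact]
  | cons p P ih =>
    rw [List.cons_append, spreadC_cons, ih, spread_cons,
      comp_conv _ _ _ _ (fun x y => map_mul (inclL R B C) x y), conv_assoc _ S.coassoc]

theorem spreadC_one {N : ℕ} (P : List (Fin N)) : spreadC S P 1 = 1 := by
  induction P with
  | nil => rfl
  | cons p P ih => exact conv_one S.coact _ _ (map_one ((inclL R B C).comp (single p))) ih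

theorem commute_spreadC {N : ℕ} (P : List (Fin N)) (z : ⨂[R]^N B)
    (h : ∀ p ∈ P, ∀ b, Commute z (single p b)) (c : C) :
    Commute (inclL R B C z) (spreadC S P c) := by
  induction P generalizing c with
  | nil =>
    change inclL R B C z * _ = _
    simp [spreadC_nil]
  | cons p P ih =>
    rw [spreadC_cons]
    exact commute_conv _ _ _ _ (fun b => (h p List.mem_cons_self b).map (inclL R B C))
      (fun b => ih (fun q hq => h q (List.mem_cons_of_mem _ hq)) b) c

theorem spreadC_mul {N : ℕ} {P : List (Fin N)} (hP : P.Nodup) (a b : C) :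
    spreadC S P (a * b) = spreadC S P a * spreadC S P b := by
  induction P generalizing a b with
  | nil => exact map_mul Algebra.TensorProduct.includeRight a b
  | cons p P ih =>
    have hp := List.nodup_cons.1 hP
    refine conv_mul S.coact _ _ (fun x y => map_mul ((inclL R B C).comp (single p)) x y) (ih hp.2)
      ?_ a b
    intro b c
    refine commute_spreadC S P _ (fun q hq c => ?_) c
    exact commute_single (fun h : p = q => hp.1 (h ▸ hq)) _ _

/-- The map `g ⊗ c ↦ (distribute P g ⊗ 1) (spreadC T c)`. -/
def distributeC {k N : ℕ} (P : Fin k → List (Fin N)) (T : List (Fin N)) :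
    (⨂[R]^k B) ⊗[R] C →ₗ[R] (⨂[R]^N B) ⊗[R] C :=
  LinearMap.mul' R _ ∘ₗ TensorProduct.map ((inclL R B C).toLinearMap ∘ₗ distribute P) (spreadC S T)

theorem distributeC_tmul {k N : ℕ} (P : Fin k → List (Fin N)) (T : List (Fin N)) (g : ⨂[R]^k B)
    (c : C) : distributeC S P T (g ⊗ₜ c) = inclL R B C (distribute P g) * spreadC S T c := rfl

theorem distributeC_nil {k N : ℕ} (P : Fin k → List (Fin N)) :
    distributeC S P [] = (distribute P).rTensor C := by
  refine TensorProduct.ext' fun g c => ?_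
  rw [distributeC_tmul, spreadC_nil]
  simp

theorem distributeC_inclL {k N : ℕ} (P : Fin k → List (Fin N)) (T : List (Fin N))
    (g : ⨂[R]^k B) : distributeC S P T (inclL R B C g) = inclL R B C (distribute P g) := by
  change distributeC S P T (g ⊗ₜ 1) = _
  rw [distributeC_tmul, spreadC_one, mul_one]

theorem distributeC_one {k N : ℕ} (P : Fin k → List (Fin N)) (T : List (Fin N)) :
    distributeC S P T 1 = 1 := by
  have := distributeC_inclL S P T 1
  rwa [distribute_one, map_one] at this

theorem distributeC_mul {k N : ℕ} {P : Fin k → List (Fin N)} {T : List (Fin N)}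
    (hP : Separated P) (hT : T.Nodup) (hPT : ∀ j, (P j).Disjoint T)
    (x y : (⨂[R]^k B) ⊗[R] C) :
    distributeC S P T (x * y) = distributeC S P T x * distributeC S P T y := by
  have hc : ∀ g c, Commute (inclL R B C (distribute P g)) (spreadC S T c) := fun g c => by
    refine commute_spreadC S T _ (fun p hp b => ?_) c
    refine (commute_distribute P (AlgHom.id R _) _ (fun j q hq b' => ?_) g).symm
    exact commute_single (fun h : p = q => hPT j hq (h ▸ hp)) _ _
  induction x using TensorProduct.induction_on with
  | zero => simp
  | add a b ha hb => simp only [map_add, _root_.add_mul, ha, hb]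
  | tmul g c =>
    induction y using TensorProduct.induction_on with
    | zero => simp
    | add a b ha hb => simp only [map_add, _root_.mul_add, ha, hb]
    | tmul g' c' =>
      rw [Algebra.TensorProduct.tmul_mul_tmul, distributeC_tmul, distributeC_tmul,
        distributeC_tmul, distribute_mul hP, spreadC_mul S hT, map_mul, mul_assoc, mul_assoc,
        ← mul_assoc (inclL R B C (distribute P g')), (hc g' c).eq, mul_assoc]

theorem distributeC_spreadC {k N : ℕ} {Q : Fin k → List (Fin N)} {T : List (Fin N)}
    (hQ : Separated Q) (hT : T.Nodup) (hQT : ∀ j, (Q j).Disjoint T) (P : List (Fin k)) (c : C) :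
    distributeC S Q T (spreadC S P c) = spreadC S (P.flatMap Q ++ T) c := by
  induction P generalizing c with
  | nil =>
    change distributeC S Q T (1 ⊗ₜ c) = _
    rw [distributeC_tmul, distribute_one, map_one, one_mul]
    rfl
  | cons p P ih =>
    rw [List.flatMap_cons, List.append_assoc, spreadC_append, spreadC_cons]
    refine (LinearMap.congr_fun (comp_conv S.coact.toLinearMap _ (spreadC S P)
      (distributeC S Q T) (distributeC_mul S hQ hT hQT)) c).trans ?_
    congr 2
    · ext b
      refine (distributeC_inclL S Q T _).trans ?_
      exact congrArg _ (distribute_single Q p b)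
    · ext b
      exact ih b

theorem distributeC_distributeC {k l N : ℕ} (P : Fin k → List (Fin l)) (U : List (Fin l))
    {Q : Fin l → List (Fin N)} {T : List (Fin N)} (hQ : Separated Q) (hT : T.Nodup)
    (hQT : ∀ j, (Q j).Disjoint T) (x : (⨂[R]^k B) ⊗[R] C) :
    distributeC S Q T (distributeC S P U x) =
      distributeC S (fun j => (P j).flatMap Q) (U.flatMap Q ++ T) x := by
  induction x using TensorProduct.induction_on with
  | zero => simp
  | add a b ha hb => simp only [map_add, ha, hb]
  | tmul g c =>
    rw [distributeC_tmul, distributeC_mul S hQ hT hQT, distributeC_inclL,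
      distribute_distribute P hQ, distributeC_spreadC S hQ hT hQT, distributeC_tmul]

theorem distributeC_singleton {k : ℕ} (x : (⨂[R]^k B) ⊗[R] C) :
    distributeC S (fun j => [j]) [] x = x := by
  rw [distributeC_nil]
  have : distribute (R := R) (B := B) (fun j : Fin k => [j]) = LinearMap.id :=
    LinearMap.ext distribute_singleton
  rw [this, LinearMap.rTensor_id]
  rfl

end SpreadC

/-! ### The cosimplicial algebras `B^{⊗ n}` and `B^{⊗ n} ⊗ C` -/

section Gaps

theorem mem_interval {N a b : ℕ} {p : Fin N} :
    p ∈ interval (N := N) a b ↔ a ≤ p ∧ (p : ℕ) < b := by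
  simp [interval]

theorem pairwise_interval {N : ℕ} (a b : ℕ) : (interval (N := N) a b).Pairwise (· < ·) :=
  (List.pairwise_lt_finRange _).filter _

theorem eq_interval {N a b : ℕ} {l : List (Fin N)} (hl : l.Pairwise (· < ·))
    (h : ∀ p, p ∈ l ↔ a ≤ p ∧ (p : ℕ) < b) : l = interval a b := by
  refine List.Perm.eq_of_pairwise (le := (· < ·)) (fun a b _ _ h1 h2 => absurd h1 h2.asymm) hl
    (pairwise_interval a b) ?_
  rw [List.perm_ext_iff_of_nodup hl.nodup (pairwise_interval a b).nodup]
  intro p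
  rw [h, mem_interval]

theorem interval_eq_nil {N a b : ℕ} (h : b ≤ a) : interval (N := N) a b = [] := by
  refine (eq_interval List.Pairwise.nil fun p => ?_).symm
  simp only [List.not_mem_nil, false_iff]
  omega

theorem interval_eq_singleton {N : ℕ} (p : Fin N) (a b : ℕ) (ha : a = p) (hb : b = p + 1) :
    interval a b = [p] := by
  refine (eq_interval (List.pairwise_singleton _ _) fun q => ?_).symm
  rw [List.mem_singleton, Fin.ext_iff]
  omega

/-- The positions between the `j`-th and the `(j + 1)`-th value of a monotone map. -/
def gap {n m : ℕ} (ψ : Fin (n + 1) →o Fin (m + 1)) (j : Fin n) : List (Fin m) :=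
  interval (ψ j.castSucc) (ψ j.succ)

/-- The positions after the last value of a monotone map. -/
def tail {n m : ℕ} (ψ : Fin (n + 1) →o Fin (m + 1)) : List (Fin m) :=
  interval (ψ (Fin.last n)) m

theorem separated_gap {n m : ℕ} (ψ : Fin (n + 1) →o Fin (m + 1)) : Separated (gap ψ) := by
  refine ⟨fun j => (pairwise_interval _ _).nodup, ?_⟩
  have key : ∀ i j : Fin n, i < j → (gap ψ i).Disjoint (gap ψ j) := by
    intro i j h p hi hj
    have hi := (mem_interval.1 hi).2
    have hj := (mem_interval.1 hj).1
    have : ψ i.succ ≤ ψ j.castSucc := ψ.monotone (Fin.succ_le_castSucc_iff.2 h)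
    have : (ψ i.succ : ℕ) ≤ ψ j.castSucc := this
    omega
  intro i j h
  rcases lt_or_gt_of_ne h with h | h
  · exact key i j h
  · exact (key j i h).symm

theorem disjoint_gap_tail {n m : ℕ} (ψ : Fin (n + 1) →o Fin (m + 1)) (j : Fin n) :
    (gap ψ j).Disjoint (tail ψ) := by
  intro p h1 h2
  have h1 := (mem_interval.1 h1).2
  have h2 := (mem_interval.1 h2).1
  have : (ψ j.succ : ℕ) ≤ ψ (Fin.last n) := ψ.monotone (Fin.le_last _)
  omega

theorem nodup_tail {n m : ℕ} (ψ : Fin (n + 1) →o Fin (m + 1)) : (tail ψ).Nodup :=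
  (pairwise_interval _ _).nodup

/-- The gaps of a monotone map between `a` and `b` fill the interval between its values. -/
theorem interval_flatMap_gap {n m : ℕ} (ψ : Fin (n + 1) →o Fin (m + 1)) {a b : Fin (n + 1)}
    (h : a ≤ b) : (interval (a : ℕ) (b : ℕ)).flatMap (gap ψ) = interval (ψ a) (ψ b) := by
  induction b using Fin.induction with
  | zero =>
    rw [interval_eq_nil (by simp), interval_eq_nil]
    · rfl
    · exact ψ.monotone (Fin.zero_le _)
  | succ b ih =>
    rcases h.eq_or_lt with rfl | h
    · rw [interval_eq_nil le_rfl, interval_eq_nil le_rfl]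
      rfl
    · have hab : a ≤ b.castSucc := Fin.le_castSucc_iff.2 h
      have hab' : (a : ℕ) ≤ b := hab
      have h1 : interval (N := n) (a : ℕ) (b.succ : Fin (n + 1)) =
          interval (a : ℕ) (b.castSucc : Fin (n + 1)) ++ [b] := by
        refine (eq_interval ?_ fun p => ?_).symm
        · rw [List.pairwise_append]
          refine ⟨pairwise_interval _ _, List.pairwise_singleton _ _, fun p hp q hq => ?_⟩
          have := (mem_interval.1 hp).2
          rw [List.mem_singleton.1 hq]
          exact this
        · rw [List.mem_append, mem_interval, List.mem_singleton, Fin.ext_iff]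
          simp only [Fin.val_castSucc, Fin.val_succ]
          omega
      have h2 : interval (N := m) (ψ a) (ψ b.succ) =
          interval (ψ a) (ψ b.castSucc) ++ gap ψ b := by
        have m1 : (ψ a : ℕ) ≤ ψ b.castSucc := ψ.monotone hab
        have m2 : (ψ b.castSucc : ℕ) ≤ ψ b.succ := ψ.monotone (Fin.castSucc_lt_succ).le
        refine (eq_interval ?_ fun p => ?_).symm
        · rw [List.pairwise_append]
          refine ⟨pairwise_interval _ _, pairwise_interval _ _, fun p hp q hq => ?_⟩
          have h3 := (mem_interval.1 hp).2
          have h4 := (mem_interval.1 hq).1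
          exact Fin.lt_def.2 (lt_of_lt_of_le h3 h4)
        · rw [List.mem_append, mem_interval, gap, mem_interval]
          omega
      rw [h1, h2, List.flatMap_append, ih hab]
      simp

theorem gap_comp {k n m : ℕ} (φ : Fin (n + 1) →o Fin (m + 1)) (ψ : Fin (k + 1) →o Fin (n + 1))
    (j : Fin k) : (gap ψ j).flatMap (gap φ) = gap (φ.comp ψ) j :=
  interval_flatMap_gap φ (ψ.monotone (Fin.castSucc_lt_succ).le)

theorem tail_comp {k n m : ℕ} (φ : Fin (n + 1) →o Fin (m + 1)) (ψ : Fin (k + 1) →o Fin (n + 1)) :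
    (tail ψ).flatMap (gap φ) ++ tail φ = tail (φ.comp ψ) := by
  have h1 : tail ψ = interval (ψ (Fin.last k)) (Fin.last n : Fin (n + 1)) := rfl
  rw [h1, interval_flatMap_gap φ (Fin.le_last _)]
  have m1 : (φ (ψ (Fin.last k)) : ℕ) ≤ φ (Fin.last n) := φ.monotone (Fin.le_last _)
  refine eq_interval ?_ fun p => ?_
  · rw [List.pairwise_append]
    refine ⟨pairwise_interval _ _, pairwise_interval _ _, fun p hp q hq => ?_⟩
    exact Fin.lt_def.2 (lt_of_lt_of_le (mem_interval.1 hp).2 (mem_interval.1 hq).1)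
  · rw [List.mem_append, mem_interval, tail, mem_interval]
    have := p.2
    have : (φ (Fin.last n) : ℕ) ≤ m := Nat.lt_succ_iff.1 (φ (Fin.last n)).2
    simp only [OrderHom.comp_coe, Function.comp_apply]
    omega

theorem gap_id {n : ℕ} (j : Fin n) : gap (OrderHom.id : Fin (n + 1) →o _) j = [j] :=
  interval_eq_singleton j _ _ rfl rfl

theorem tail_id {n : ℕ} : tail (OrderHom.id : Fin (n + 1) →o _) = [] := interval_eq_nil le_rfl

end Gaps

noncomputable section CobarPair
variable {R B C : Type u} [CommRing R] [Ring B] [Bialgebra R B] [Ring C] [Algebra R C]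

/-- The multiplications of the algebras `B^{⊗ n}` and `B^{⊗ n} ⊗ C`. -/
instance instMonoidCobar : ∀ c n, Monoid (Cobar R B C c n)
  | .closed, n => inferInstanceAs (Monoid (⨂[R]^n B))
  | .opn, n => inferInstanceAs (Monoid ((⨂[R]^n B) ⊗[R] C))

variable (S : LeftCoaction R B C)

/-- The maps of the cosimplicial pair of the cobar constructions: the iterated coproduct of the
`j`-th factor is placed in the `j`-th gap of `ψ`, and the iterated coaction of the factor in `C`
after the last value of `ψ`. The zero map is a placeholder, since no operation has an open input
and a closed output. -/
def cobarMap : ∀ c c₀ {n m : ℕ}, (Fin (n + 1) →o Fin (m + 1)) →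
    (Cobar R B C c n →ₗ[R] Cobar R B C c₀ m)
  | .closed, .closed, _, _, ψ => distribute (gap ψ)
  | .closed, .opn, _, _, ψ => (inclL R B C).toLinearMap ∘ₗ distribute (gap ψ)
  | .opn, .closed, _, _, _ => 0
  | .opn, .opn, _, _, ψ => distributeC S (gap ψ) (tail ψ)

theorem commute_distribute_distribute {k l N : ℕ} {P : Fin k → List (Fin N)}
    {Q : Fin l → List (Fin N)} (h : ∀ i j, (P i).Disjoint (Q j)) (x : ⨂[R]^k B) (y : ⨂[R]^l B) :
    Commute (distribute P x) (distribute Q y) := by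
  refine commute_distribute Q (AlgHom.id R _) _ (fun j q hq b => ?_) y
  refine (commute_distribute P (AlgHom.id R _) _ (fun i p hp b' => ?_) x).symm
  exact commute_single (fun h' : q = p => h i j hp (h' ▸ hq)) _ _

/-- The cosimplicial algebras `B^{⊗ n}` and `B^{⊗ n} ⊗ C`. -/
def cobarPair : CosimplicialPair R (Cobar R B C) where
  add_mul {c n} x y z := by
    cases c
    · exact _root_.add_mul (R := ⨂[R]^n B) x y z
    · exact _root_.add_mul (R := (⨂[R]^n B) ⊗[R] C) x y z
  mul_add {c n} x y z := by
    cases c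
    · exact _root_.mul_add (R := ⨂[R]^n B) x y z
    · exact _root_.mul_add (R := (⨂[R]^n B) ⊗[R] C) x y z
  smul_mul {c n} r x y := by
    cases c
    · exact smul_mul_assoc (β := ⨂[R]^n B) r x y
    · exact smul_mul_assoc (β := (⨂[R]^n B) ⊗[R] C) r x y
  mul_smul {c n} r x y := by
    cases c
    · exact mul_smul_comm (β := ⨂[R]^n B) r x y
    · exact mul_smul_comm (β := (⨂[R]^n B) ⊗[R] C) r x y
  map c c₀ _ _ ψ := cobarMap S c c₀ ψ
  map_one {c c₀ n m} ψ h := by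
    cases c₀ with
    | closed =>
      cases c with
      | closed => exact distribute_one (gap ψ)
      | opn => cases h rfl
    | opn =>
      cases c with
      | closed => exact congrArg (inclL R B C) (distribute_one (gap ψ))
      | opn => exact distributeC_one S (gap ψ) (tail ψ)
  map_mul {c c₀ n m} ψ x y h := by
    cases c₀ with
    | closed =>
      cases c with
      | closed => exact distribute_mul (separated_gap ψ) x y
      | opn => cases h rfl
    | opn =>
      cases c with
      | closed =>
        exact (congrArg (inclL R B C) (distribute_mul (separated_gap ψ) x y)).trans
          (map_mul (inclL R B C) _ _)
      | opn => exact distributeC_mul S (separated_gap ψ) (nodup_tail ψ) (disjoint_gap_tail ψ) x y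
  map_id {c n} x := by
    cases c with
    | closed =>
      change distribute (gap OrderHom.id) x = x
      rw [funext gap_id]
      exact distribute_singleton x
    | opn =>
      change distributeC S (gap OrderHom.id) (tail OrderHom.id) x = x
      rw [funext gap_id, tail_id]
      exact distributeC_singleton S x
  map_map {c c' c₀ k n m} φ ψ x h h' := by
    have hd : ∀ x : ⨂[R]^k B, distribute (gap φ) (distribute (gap ψ) x) =
        distribute (gap (φ.comp ψ)) x := fun x => by
      rw [distribute_distribute _ (separated_gap φ), funext (gap_comp φ ψ)]
    cases c₀ with
    | closed =>
      cases c' with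
      | opn => cases h rfl
      | closed =>
        cases c with
        | opn => cases h' rfl
        | closed => exact hd x
    | opn =>
      cases c' with
      | closed =>
        cases c with
        | opn => cases h' rfl
        | closed => exact congrArg (inclL R B C) (hd x)
      | opn =>
        cases c with
        | closed => exact (distributeC_inclL S _ _ _).trans (congrArg (inclL R B C) (hd x))
        | opn =>
          refine (distributeC_distributeC S _ _ (separated_gap φ) (nodup_tail φ)
            (disjoint_gap_tail φ) x).trans ?_
          rw [funext (gap_comp φ ψ), tail_comp]
          rfl
  commute {c c₀ k n m} ψ φ x y h hψ := by
    have hgg : ∀ i j, (gap ψ i).Disjoint (gap φ j) := fun i j p h1 h2 => by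
      have h1 := (mem_interval.1 h1).2
      have h2 := (mem_interval.1 h2).1
      have : (ψ i.succ : ℕ) ≤ φ j.castSucc := hψ _ _
      omega
    cases c₀ with
    | closed =>
      cases c with
      | closed => exact commute_distribute_distribute hgg x y
      | opn => cases h rfl
    | opn =>
      cases c with
      | closed => exact Commute.map (commute_distribute_distribute hgg x y) (inclL R B C)
      | opn =>
        change Commute (inclL R B C (distribute (gap ψ) x)) (distributeC S (gap φ) (tail φ) y)
        change (⨂[R]^n B) ⊗[R] C at y
        induction y using TensorProduct.induction_on with
        | zero => rw [_root_.map_zero]; exact Commute.zero_right _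
        | add a b ha hb => rw [_root_.map_add]; exact ha.add_right hb
        | tmul g c =>
          rw [distributeC_tmul]
          refine ((commute_distribute_distribute hgg x g).map (inclL R B C)).mul_right ?_
          refine commute_spreadC S _ _ (fun p hp b => ?_) c
          refine (commute_distribute _ (AlgHom.id R _) _ (fun j q hq b' => ?_) x).symm
          refine commute_single (fun h : p = q => ?_) _ _
          have h1 := (mem_interval.1 hq).2
          have h2 := (mem_interval.1 hp).1
          have : (ψ j.succ : ℕ) ≤ φ (Fin.last n) := hψ _ _
          rw [h] at h2
          omega

end CobarPair

/-! ### Reading the positions of the edges off the word of a path -/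

section Words
variable {ι : Type} [DecidableEq ι]

/-- The numbers of bars before the occurrences of the letter `i` in a word, if there are `k` bars
before the word. -/
def barsBefore (i : ι) : ℕ → List (Option ι) → List ℕ
  | _, [] => []
  | k, none :: w => barsBefore i (k + 1) w
  | k, some j :: w => if j = i then k :: barsBefore i k w else barsBefore i k w

theorem barsBefore_append (i : ι) (k : ℕ) (u v : List (Option ι)) :
    barsBefore i k (u ++ v) = barsBefore i k u ++ barsBefore i (k + u.count none) v := by
  induction u generalizing k with
  | nil => simp [barsBefore]
  | cons a u ih =>
    cases a with
    | none =>
      rw [List.cons_append, barsBefore, barsBefore, ih, List.count_cons_self]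
      congr 2
      omega
    | some j =>
      rw [List.cons_append, barsBefore, barsBefore, ih]
      split_ifs <;> simp

theorem barsBefore_of_not_mem (i : ι) (k : ℕ) {u : List (Option ι)} (h : some i ∉ u) :
    barsBefore i k u = [] := by
  induction u generalizing k with
  | nil => rfl
  | cons a u ih =>
    rw [List.mem_cons, not_or] at h
    cases a with
    | none => exact ih _ h.2
    | some j =>
      rw [barsBefore, if_neg (fun hj : j = i => h.1 (hj ▸ rfl)), ih _ h.2]

theorem corolla_succ {ι : Type} (t : ι) (l : ℕ) :
    corolla t (l + 1) = some t :: none :: corolla t l := rfl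

theorem barsBefore_corolla (t : ι) (k l : ℕ) :
    barsBefore t k (corolla t l) = (List.range (l + 1)).map fun r => k + r := by
  induction l generalizing k with
  | zero => simp [corolla, barsBefore]
  | succ l ih =>
    rw [corolla_succ, List.range_succ_eq_map, List.map_cons, List.map_map]
    simp only [barsBefore, if_true, ih]
    congr 1
    refine List.map_congr_left fun r _ => ?_
    simp only [Function.comp_apply]
    omega

theorem count_corolla (t : ι) (l : ℕ) : (corolla t l).count none = l := by
  induction l with
  | zero => simp [corolla]
  | succ l ih => simp [corolla_succ, ih]

theorem mem_corolla {ι : Type} {t i : ι} {l : ℕ} : some i ∈ corolla t l ↔ i = t := by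
  induction l with
  | zero => simp [corolla]
  | succ l ih => simp [corolla_succ, ih]

theorem count_blocks {α : Type} (t : ι) (w : α → List (Option ι)) (L : List α) :
    (L.flatMap fun j => some t :: w j).count none = (L.map fun j => (w j).count none).sum := by
  induction L with
  | nil => rfl
  | cons a L ih => simp [List.flatMap_cons, ih]

theorem barsBefore_blocks {α : Type} (t : ι) (w : α → List (Option ι)) (hw : ∀ j, some t ∉ w j)
    (L : List α) (k : ℕ) : barsBefore t k ((L.flatMap fun j => some t :: w j) ++ [some t]) =
      (List.range (L.length + 1)).map fun r =>
        k + ((L.take r).map fun j => (w j).count none).sum := by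
  induction L generalizing k with
  | nil => simp [barsBefore]
  | cons a L ih =>
    rw [List.flatMap_cons, List.append_assoc, List.cons_append, barsBefore, if_pos rfl,
      barsBefore_append, barsBefore_of_not_mem t k (hw a), List.nil_append, ih, List.length_cons,
      List.range_succ_eq_map (n := L.length + 1), List.map_cons, List.map_map]
    congr 1
    refine List.map_congr_left fun r _ => ?_
    simp [add_assoc]

/-- The partial sums of a sequence of lengths. -/
def partialSum {k : ℕ} (l : Fin k → ℕ) (r : ℕ) : ℕ :=
  ∑ i ∈ Finset.univ.filter fun i : Fin k => (i : ℕ) < r, l i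

theorem sum_take_finRange {k : ℕ} (l : Fin k → ℕ) (r : ℕ) :
    (((List.finRange k).take r).map l).sum = partialSum l r := by
  rw [List.map_take, ← List.ofFn_eq_map, List.sum_take_ofFn]
  rfl

theorem offset_eq {k : ℕ} (l : Fin k → ℕ) (j : Fin k) : offset l j = partialSum l j := rfl

theorem partialSum_succ {k : ℕ} (l : Fin k → ℕ) (j : Fin k) :
    partialSum l (j + 1) = offset l j + l j := by
  have h : (Finset.univ.filter fun i : Fin k => (i : ℕ) < j + 1) =
      insert j (Finset.univ.filter fun i : Fin k => (i : ℕ) < j) := by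
    ext i
    simp only [Finset.mem_filter, Finset.mem_univ, true_and, Finset.mem_insert, Fin.ext_iff]
    omega
  rw [partialSum, h, Finset.sum_insert (by simp), offset_eq, partialSum, add_comm]

theorem partialSum_all {k : ℕ} (l : Fin k → ℕ) : partialSum l k = ∑ i, l i := by
  rw [partialSum, Finset.filter_true_of_mem fun i _ => i.2]

theorem barsBefore_graft_root (t : ι) {k : ℕ} (w : Fin k → List (Option ι))
    (hw : ∀ j, some t ∉ w j) : barsBefore t 0 (graft t w) =
      (List.range (k + 1)).map (partialSum fun j => (w j).count none) := by
  rw [graft, barsBefore_blocks t w hw, List.length_finRange]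
  refine List.map_congr_left fun r _ => ?_
  rw [zero_add, sum_take_finRange]

theorem finRange_split {k : ℕ} (j : Fin k) : List.finRange k =
    (List.finRange k).take j ++ j :: (List.finRange k).drop (j + 1) := by
  conv_lhs => rw [← List.take_append_drop j (List.finRange k)]
  rw [List.drop_eq_getElem_cons (by simp)]
  simp

theorem mem_take_finRange {k : ℕ} {j : Fin k} {r : ℕ} :
    j ∈ (List.finRange k).take r ↔ (j : ℕ) < r := by
  rw [List.mem_take_iff_getElem]
  constructor
  · rintro ⟨i, hi, rfl⟩
    simp at hi ⊢
    exact hi.1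
  · intro h
    exact ⟨j, by simp [h], by simp⟩

theorem mem_drop_finRange {k : ℕ} {j : Fin k} {r : ℕ} :
    j ∈ (List.finRange k).drop r ↔ r ≤ (j : ℕ) := by
  rw [List.mem_drop_iff_getElem]
  constructor
  · rintro ⟨i, hi, rfl⟩
    simp
  · intro h
    refine ⟨j - r, by simp; omega, ?_⟩
    simp only [List.getElem_finRange, Fin.ext_iff, Fin.val_cast]
    omega

theorem barsBefore_graft {t i : ι} (hti : i ≠ t) {k : ℕ} (w : Fin k → List (Option ι)) (j : Fin k)
    (hw : ∀ j', some i ∈ w j' → j' = j) : barsBefore i 0 (graft t w) =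
      barsBefore i (offset (fun j => (w j).count none) j) (w j) := by
  have hn : ∀ L : List (Fin k), j ∉ L → some i ∉ L.flatMap fun j => some t :: w j := by
    intro L hL h
    obtain ⟨j', hj', h⟩ := List.mem_flatMap.1 h
    rcases List.mem_cons.1 h with h | h
    · exact hti (Option.some.inj h)
    · exact hL (hw j' h ▸ hj')
  have h1 := hn ((List.finRange k).take j) fun h => lt_irrefl _ (mem_take_finRange.1 h)
  have h2 := hn ((List.finRange k).drop (j + 1)) fun h => by
    have := mem_drop_finRange.1 h
    omega
  rw [graft]
  conv_lhs => rw [finRange_split j]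
  rw [List.flatMap_append, List.flatMap_cons, List.append_assoc, barsBefore_append,
    barsBefore_of_not_mem _ _ h1, List.nil_append, count_blocks, sum_take_finRange,
    List.cons_append, List.cons_append, barsBefore, if_neg hti.symm, List.append_assoc,
    barsBefore_append, barsBefore_of_not_mem i _ (u := _ ++ [some t]), List.append_nil, zero_add]
  · rfl
  · rw [List.mem_append, not_or]
    exact ⟨h2, by simpa using hti⟩

theorem count_graft (t : ι) {k : ℕ} (w : Fin k → List (Option ι)) :
    (graft t w).count none = ∑ j, (w j).count none := by
  rw [graft, List.count_append, count_blocks, ← List.ofFn_eq_map, List.sum_ofFn]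
  simp

end Words

section Intercalate
variable {ι β : Type} [DecidableEq ι] (f : β → ι)

theorem barsBefore_intercalate {m : ℕ} (s : Fin (m + 1) → List β) (i : ι) (k : ℕ) :
    barsBefore i k ([none].intercalate (List.ofFn fun j => (s j).map fun a => some (f a))) =
      (List.finRange (m + 1)).flatMap fun j => ((s j).filter fun a => f a = i).map fun _ =>
        k + (j : ℕ) := by
  have h0 : ∀ (u : List β) (k : ℕ), barsBefore i k (u.map fun a => some (f a)) =
      (u.filter fun a => f a = i).map fun _ => k := fun u k => by
    induction u with
    | nil => rfl
    | cons a u ih =>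
      rw [List.map_cons, barsBefore, ih]
      by_cases h : f a = i
      · simp [h]
      · simp [h]
  induction m generalizing k with
  | zero => simp [h0, List.finRange_succ]
  | succ m ih =>
    rw [List.ofFn_succ, List.intercalate_cons_of_ne_nil (by simp), List.append_assoc,
      barsBefore_append, h0, List.finRange_succ, List.flatMap_cons]
    have h1 : ((s 0).map fun a => some (f a)).count none = 0 := by
      rw [List.count_eq_zero]; simp
    rw [h1, List.cons_append, barsBefore, List.nil_append, ih, List.flatMap_map]
    congr 1
    refine congrArg (fun F => List.flatMap F _) (funext fun j => ?_)
    refine List.map_congr_left fun _ _ => ?_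
    simp only [Fin.val_succ]
    omega

theorem count_intercalate {m : ℕ} (s : Fin (m + 1) → List β) :
    ([none].intercalate (List.ofFn fun j => (s j).map fun a => some (f a))).count none = m := by
  have h1 : ∀ u : List β, (u.map fun a => some (f a)).count none = 0 := fun u => by
    rw [List.count_eq_zero]; simp
  induction m with
  | zero => simp [h1]
  | succ m ih =>
    rw [List.ofFn_succ, List.intercalate_cons_of_ne_nil (by simp), List.count_append,
      List.count_append, h1, ih]
    simp [add_comm]

theorem reduceOption_intercalate {ι β : Type} (f : β → ι) {m : ℕ} (s : Fin (m + 1) → List β) :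
    ([none].intercalate (List.ofFn fun j => (s j).map fun a => some (f a))).reduceOption =
      ((List.finRange (m + 1)).flatMap s).map f := by
  have h1 : ∀ u : List β, (u.map fun a => some (f a)).reduceOption = u.map f := fun u => by
    induction u with
    | nil => rfl
    | cons a u ih => simp [ih]
  induction m with
  | zero => simp [h1, List.finRange_succ]
  | succ m ih =>
    rw [List.ofFn_succ, List.intercalate_cons_of_ne_nil (by simp), List.reduceOption_append,
      List.reduceOption_append, h1, List.finRange_succ, ih, List.flatMap_cons, List.flatMap_map,
      List.map_append]
    simp

end Intercalate

namespace LatticePath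
variable {ι : Type} [LinearOrder ι] {n : ι → ℕ} {m : ℕ} (x : LatticePath n m)

/-- The word of a path determines the positions of its edges. -/
theorem barsBefore_word (i : ι) :
    barsBefore i 0 x.word = (List.finRange (n i + 1)).map fun r => (x.pos i r : ℕ) := by
  have h1 : (List.finRange (n i + 1)).map (fun r => (x.pos i r : ℕ)) =
      (x.edgeList.filter fun a => a.1 = i).map fun a => (x.pos a.1 a.2 : ℕ) := by
    rw [edgeList, x.edges, List.map_map]
    rfl
  rw [h1, word, barsBefore_intercalate, edgeList, List.filter_flatMap, List.map_flatMap]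
  refine congrArg (fun F => List.flatMap F _) (funext fun j => ?_)
  refine List.map_congr_left fun a ha => ?_
  rw [x.pos_eq (List.mem_filter.1 ha).1, zero_add]

theorem count_word : x.word.count none = m := count_intercalate Sigma.fst x.seg

theorem reduceOption_word : x.word.reduceOption = x.letters :=
  reduceOption_intercalate Sigma.fst x.seg

theorem pos_of_barsBefore (i : ι) {F : ℕ → ℕ}
    (h : barsBefore i 0 x.word = (List.range (n i + 1)).map F) (r : Fin (n i + 1)) :
    (x.pos i r : ℕ) = F r := by
  rw [barsBefore_word, ← List.map_coe_finRange_eq_range, List.map_map] at h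
  exact List.map_inj_left.1 h r (List.mem_finRange r)

theorem before_of_letters {i j : ι} {u v : List ι} (h : x.letters = u ++ v) (hi : i ∈ u)
    (hj : j ∉ u) : x.Before i j := by
  obtain ⟨U, V, hUV, rfl, rfl⟩ := List.map_eq_append_iff.1 h
  obtain ⟨⟨i, r⟩, hr, rfl⟩ := List.mem_map.1 hi
  have hjV : (⟨j, 0⟩ : Σ i, Fin (n i + 1)) ∈ V := by
    have := x.mem_edgeList ⟨j, 0⟩
    rw [edgeList, hUV, List.mem_append] at this
    exact this.resolve_left fun h => hj (List.mem_map.2 ⟨_, h, rfl⟩)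
  have h1 : [(⟨i, r⟩ : Σ i, Fin (n i + 1)), ⟨j, 0⟩].Sublist x.edgeList := by
    rw [edgeList, hUV]
    exact (List.singleton_sublist.2 hr).append (List.singleton_sublist.2 hjV)
  rcases (Fin.zero_le r).eq_or_lt with h0 | h0
  · rw [← h0] at h1
    exact h1
  · exact ((List.sublist_cons_self _ _).cons_cons _).trans
      (pair_sublist_extend x.nodup_edgeList (x.edge_pair_sublist i h0) h1)

theorem before_of_word {i j : ι} {u v : List (Option ι)} (h : x.word = u ++ v) (hi : some i ∈ u)
    (hj : some j ∉ u) : x.Before i j := by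
  have h' := x.reduceOption_word
  rw [h, List.reduceOption_append] at h'
  exact x.before_of_letters h'.symm (List.reduceOption_mem_iff.2 hi) fun h =>
    hj (List.reduceOption_mem_iff.1 h)

theorem before_root {t : ι} {k : ℕ} {w : Fin k → List (Option ι)} (h : x.word = graft t w) {i : ι}
    (hi : i ≠ t) : x.Before t i := by
  obtain ⟨v, hv⟩ : ∃ v, graft t w = [some t] ++ v := by
    cases k with
    | zero => exact ⟨[], rfl⟩
    | succ k => exact ⟨_, by rw [graft, List.finRange_succ, List.flatMap_cons]; rfl⟩
  exact x.before_of_word (h.trans hv) (by simp) (by simpa using hi)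

theorem before_graft {t : ι} {k : ℕ} {w : Fin k → List (Option ι)} (h : x.word = graft t w)
    {i i' : ι} {j j' : Fin k} (hj : j < j') (hi : some i ∈ w j) (hi' : i' ≠ t)
    (hw : ∀ j, some i' ∈ w j → j = j') : x.Before i i' := by
  rw [graft, ← List.take_append_drop j' (List.finRange k), List.flatMap_append,
    List.append_assoc] at h
  refine x.before_of_word h ?_ ?_
  · exact List.mem_flatMap.2 ⟨j, mem_take_finRange.2 hj, List.mem_cons_of_mem _ hi⟩
  · intro h
    obtain ⟨j₁, hj₁, h⟩ := List.mem_flatMap.1 h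
    rcases List.mem_cons.1 h with h | h
    · exact hi' (Option.some.inj h)
    · rw [hw _ h] at hj₁
      exact lt_irrefl _ (mem_take_finRange.1 hj₁)

/-- The positions of the edges in the direction `t`, for the word `t w_1 t ⋯ t w_k t`. -/
theorem pos_root {t : ι} {k : ℕ} {w : Fin k → List (Option ι)} (h : x.word = graft t w)
    (hw : ∀ j, some t ∉ w j) (hk : n t = k) (r : Fin (n t + 1)) :
    (x.pos t r : ℕ) = partialSum (fun j => (w j).count none) r :=
  x.pos_of_barsBefore t (by rw [h, barsBefore_graft_root t w hw, hk]) r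

/-- The positions of the edges in the direction `i`, if `i` only occurs in the `j`-th of the words
`w_1, …, w_k`, which is `i | i | ⋯ | i`. -/
theorem pos_leaf {t i : ι} (hti : i ≠ t) {k : ℕ} {w : Fin k → List (Option ι)}
    (h : x.word = graft t w) (j : Fin k) (hw : ∀ j', some i ∈ w j' → j' = j)
    (hj : w j = corolla i (n i)) (r : Fin (n i + 1)) :
    (x.pos i r : ℕ) = offset (fun j => (w j).count none) j + r := by
  refine x.pos_of_barsBefore i (F := fun r => _ + r) ?_ r
  rw [h, barsBefore_graft hti w j hw, hj, barsBefore_corolla]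

end LatticePath

section Preimg
variable {s k : ℕ} (β : Fin s ↪o Fin k)

theorem preimg_eq_some {j : Fin k} {r : Fin s} : preimg β j = some r ↔ β r = j := by
  constructor
  · intro h
    simpa using List.find?_some h
  · rintro rfl
    rw [preimg]
    cases h : (List.finRange s).find? fun r' => β r' = β r with
    | none =>
      rw [List.find?_eq_none] at h
      simpa using h r (List.mem_finRange r)
    | some r' =>
      have := List.find?_some h
      simp only [decide_eq_true_eq, EmbeddingLike.apply_eq_iff_eq] at this
      rw [this]

end Preimg

/-! ### The structure maps of the couple `(M_B, Z_{B,C})` -/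

noncomputable section CobarAlg
variable {R B C : Type u} [CommRing R] [Ring B] [Bialgebra R B] [Ring C] [Algebra R C]
variable (S : LeftCoaction R B C)

theorem gap_eq {n m : ℕ} (ψ : Fin (n + 1) →o Fin (m + 1)) (F : ℕ → ℕ)
    (h : ∀ r : Fin (n + 1), (ψ r : ℕ) = F r) (j : Fin n) :
    gap ψ j = interval (F j) (F (j + 1)) := by
  rw [gap, h, h]
  rfl

theorem tail_eq {n m : ℕ} (ψ : Fin (n + 1) →o Fin (m + 1)) (F : ℕ → ℕ)
    (h : ∀ r : Fin (n + 1), (ψ r : ℕ) = F r) : tail ψ = interval (F n) m := by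
  rw [tail, h]
  rfl

/-- If `ψ` has the partial sums of `l` as values, its gaps are consecutive blocks of lengths `l`. -/
theorem distribute_root {k N : ℕ} (ψ : Fin (k + 1) →o Fin (N + 1)) (l : Fin k → ℕ)
    (h : ∀ r : Fin (k + 1), (ψ r : ℕ) = partialSum l r) (f : ⨂[R]^k B) :
    distribute (gap ψ) f = blocks l f := by
  have : gap ψ = fun j => interval (offset l j) (offset l j + l j) := by
    funext j
    rw [gap_eq ψ _ h, partialSum_succ]
    rfl
  rw [this]
  rfl

theorem distribute_leaf {l N : ℕ} (ψ : Fin (l + 1) →o Fin (N + 1)) (a : ℕ)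
    (h : ∀ r : Fin (l + 1), (ψ r : ℕ) = a + r) (g : ⨂[R]^l B) :
    distribute (gap ψ) g = place a l g := by
  have : gap ψ = fun j : Fin l => interval (a + j) (a + j + 1) := by
    funext j
    rw [gap_eq ψ (fun r => a + r) h]
    rfl
  rw [this]
  rfl

theorem distributeC_leaf {l N : ℕ} (ψ : Fin (l + 1) →o Fin (N + 1)) (a : ℕ)
    (h : ∀ r : Fin (l + 1), (ψ r : ℕ) = a + r) (g : (⨂[R]^l B) ⊗[R] C) :
    distributeC S (gap ψ) (tail ψ) g = placeC S a l g := by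
  have h1 : gap ψ = fun j : Fin l => interval (a + j) (a + j + 1) := by
    funext j
    rw [gap_eq ψ (fun r => a + r) h]
    rfl
  rw [h1, tail_eq ψ (fun r => a + r) h]
  rfl

theorem distributeC_root {k N : ℕ} (ψ : Fin (k + 1) →o Fin (N + 1)) (l : Fin k → ℕ)
    (h : ∀ r : Fin (k + 1), (ψ r : ℕ) = partialSum l r) (hN : ∑ j, l j = N)
    (x : (⨂[R]^k B) ⊗[R] C) :
    distributeC S (gap ψ) (tail ψ) x = (blocks l).rTensor C x := by
  have h1 : gap ψ = fun j => interval (offset l j) (offset l j + l j) := by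
    funext j
    rw [gap_eq ψ _ h, partialSum_succ]
    rfl
  rw [h1, tail_eq ψ _ h, partialSum_all, hN, interval_eq_nil le_rfl, distributeC_nil]
  rfl

theorem isCobarAlg_gamma {k N : ℕ} (l : Fin k → ℕ)
    (o : RL 2 (fun _ : Fin (k + 1) => Clr.closed) (Fin.cons k l) Clr.closed N)
    (ho : o.word = graft 0 (fun j => corolla j.succ (l j)))
    (f : ⨂[R]^k B) (g : ∀ j, ⨂[R]^(l j) B) :
    (cobarPair S).actFun o
      (Fin.cons (α := fun i => Cobar R B C .closed (Fin.cons (α := fun _ => ℕ) k l i)) f g) =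
      (blocks l f * (List.ofFn fun j => place (offset l j) (l j) (g j)).prod : ⨂[R]^N B) := by
  have hcount : (fun j : Fin k => (corolla (j.succ : Fin (k + 1)) (l j)).count none) = l :=
    funext fun j => count_corolla _ _
  have hmem : ∀ j j' : Fin k, some j.succ ∈ corolla (j'.succ : Fin (k + 1)) (l j') → j' = j :=
    fun j j' h => (Fin.succ_injective _ (mem_corolla.1 h)).symm
  rw [CosimplicialPair.actFun_eq_of_perm (l := 0 :: (List.finRange k).map Fin.succ)]
  · rw [List.map_cons, List.prod_cons, List.map_map, ← List.ofFn_eq_map]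
    refine congrArg₂ (fun a b : ⨂[R]^N B => a * b) ?_ (congrArg List.prod (congrArg List.ofFn ?_))
    · refine distribute_root (k := k) (o.pos 0) l (fun r => ?_) f
      have := o.pos_root ho (fun j h => (Fin.succ_ne_zero j) (mem_corolla.1 h).symm) rfl r
      rwa [hcount] at this
    · funext j
      refine distribute_leaf (l := l j) (o.pos j.succ) _ (fun r => ?_) (g j)
      have := o.pos_leaf (Fin.succ_ne_zero j) ho j (hmem j) rfl r
      rwa [hcount] at this
  · rw [← List.finRange_succ]
    exact List.nodup_finRange _
  · rw [← List.finRange_succ]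
    exact List.mem_finRange
  · suffices H : ∀ i j : Fin (k + 1), i < j → ¬ o.Precedes j i by
      intro i j h h'
      refine absurd h' (H i j ?_)
      rw [← List.finRange_succ] at h
      exact List.pairwise_iff_forall_sublist.1 (List.pairwise_lt_finRange _) h
    intro i j hij h
    have hb : o.Before i j := by
      induction j using Fin.cases with
      | zero => exact absurd hij (Fin.not_lt_zero i)
      | succ j =>
        induction i using Fin.cases with
        | zero => exact o.before_root ho (Fin.succ_ne_zero j)
        | succ i =>
          exact o.before_graft ho (Fin.succ_lt_succ_iff.1 hij) (mem_corolla.2 rfl)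
            (Fin.succ_ne_zero j) (hmem j)
    rcases h with ⟨_, _, h⟩ | ⟨_, h⟩ | ⟨h, _⟩
    · exact hb.asymm h
    · cases h
    · cases h

theorem isCobarAlg_lambda {k s N : ℕ} (β : Fin s ↪o Fin k) (l : Fin s → ℕ)
    (o : RL 2 (Fin.cons Clr.closed fun _ : Fin s => Clr.opn) (Fin.cons k l) Clr.opn N)
    (ho : o.word = graft 0 (fun j => (preimg β j).elim [none] fun r => corolla r.succ (l r)))
    (f : ⨂[R]^k B) (g : ∀ r, (⨂[R]^(l r) B) ⊗[R] C) :
    (cobarPair S).actFun o (Fin.cons (α := fun i => Cobar R B C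
        (Fin.cons (α := fun _ => Clr) Clr.closed (fun _ : Fin s => Clr.opn) i)
        (Fin.cons (α := fun _ => ℕ) k l i)) f g) =
      ((blocks (wideLen β l) f ⊗ₜ[R] (1 : C)) * (List.ofFn fun r =>
        placeC S (offset (wideLen β l) (β r)) (l r) (g r)).reverse.prod :
        (⨂[R]^N B) ⊗[R] C) := by
  have hcount : (fun j : Fin k => ((preimg β j).elim [none] fun r =>
      corolla (r.succ : Fin (s + 1)) (l r)).count none) = wideLen β l := by
    funext j
    rw [wideLen]
    cases preimg β j with
    | none => rfl
    | some r => exact count_corolla _ _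
  have hβ : ∀ r, ((preimg β (β r)).elim [none] fun r => corolla (r.succ : Fin (s + 1)) (l r)) =
      corolla (r.succ : Fin (s + 1)) (l r) := fun r => by
    rw [(preimg_eq_some β).2 rfl]
    rfl
  have hmem : ∀ (i : Fin (s + 1)) (j : Fin k), some i ∈ ((preimg β j).elim [none] fun r =>
      corolla (r.succ : Fin (s + 1)) (l r)) → ∃ r, i = r.succ ∧ β r = j := by
    intro i j h
    cases hp : preimg β j with
    | none =>
      rw [hp] at h
      simp at h
    | some r =>
      rw [hp] at h
      exact ⟨r, mem_corolla.1 h, (preimg_eq_some β).1 hp⟩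
  have hmem' : ∀ (r : Fin s) (j : Fin k), some r.succ ∈ ((preimg β j).elim [none] fun r =>
      corolla (r.succ : Fin (s + 1)) (l r)) → j = β r := by
    intro r j h
    obtain ⟨r', h1, h2⟩ := hmem _ _ h
    rw [Fin.succ_injective _ h1, h2]
  rw [CosimplicialPair.actFun_eq_of_perm (l := 0 :: ((List.finRange s).map Fin.succ).reverse)]
  · rw [List.map_cons, List.prod_cons, List.map_reverse, List.map_map, ← List.ofFn_eq_map]
    refine congrArg₂ (fun a b : (⨂[R]^N B) ⊗[R] C => a * b) ?_
      (congrArg (fun L => (List.reverse (List.ofFn L)).prod) ?_)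
    · refine congrArg (inclL R B C) (distribute_root (k := k) (o.pos 0) _ (fun r => ?_) f)
      have := o.pos_root ho (fun j h => by
        obtain ⟨r, h, _⟩ := hmem _ _ h
        exact Fin.succ_ne_zero r h.symm) rfl r
      rwa [hcount] at this
    · funext j
      refine distributeC_leaf S (l := l j) (o.pos j.succ) _ (fun r => ?_) (g j)
      have := o.pos_leaf (Fin.succ_ne_zero j) ho (β j) (hmem' j) (hβ j) r
      rwa [hcount] at this
  · rw [List.nodup_cons, List.nodup_reverse]
    exact ⟨by simp [Fin.succ_ne_zero], (List.nodup_finRange s).map (Fin.succ_injective s)⟩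
  · intro i
    induction i using Fin.cases with
    | zero => simp
    | succ i => simp
  · suffices H : (0 :: ((List.finRange s).map Fin.succ).reverse).Pairwise
        fun i j => ¬ o.Precedes j i from
      fun i j h h' => absurd h' (List.pairwise_iff_forall_sublist.1 H h)
    rw [List.pairwise_cons, List.pairwise_reverse, List.pairwise_map]
    refine ⟨fun j hj h => ?_, (List.pairwise_lt_finRange s).imp fun {r r'} hr h => ?_⟩
    · obtain ⟨r, -, rfl⟩ := List.mem_map.1 (List.mem_reverse.1 hj)
      rcases h with ⟨h, _⟩ | ⟨h, _⟩ | ⟨_, h, _⟩ <;> cases h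
    · rcases h with ⟨h, _⟩ | ⟨h, _⟩ | ⟨_, _, h⟩
      · cases h
      · cases h
      · refine h.asymm (o.before_graft ho (j := β r) (j' := β r') (β.strictMono hr) ?_
          (Fin.succ_ne_zero r') (hmem' r'))
        rw [hβ]
        exact mem_corolla.2 rfl

theorem isCobarAlg_rho {k N : ℕ} (l : Fin k → ℕ)
    (o : RL 2 (fun _ : Unit => Clr.opn) (fun _ => k) Clr.opn N)
    (ho : o.word = graft () (fun j => List.replicate (l j) none)) (x : (⨂[R]^k B) ⊗[R] C) :
    (cobarPair S).actFun o (fun _ => x) = ((blocks l).rTensor C x : (⨂[R]^N B) ⊗[R] C) := by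
  refine (CosimplicialPair.actFun_eq_of_perm (l := [()]) _ _ _ (by simp) (by simp)
    (fun i j h h' => absurd (Subsingleton.elim _ _) h'.ne)).trans ?_
  refine (List.prod_singleton).trans ?_
  refine distributeC_root S (o.pos ()) l (fun r => ?_) ?_ x
  · have := o.pos_root ho (fun j h => by simp at h) rfl r
    simpa only [List.count_replicate_self] using this
  · have := o.count_word
    rw [ho, count_graft] at this
    simpa only [List.count_replicate_self] using this

theorem isCobarAlg_rlAlg : IsCobarAlg S (cobarPair S).rlAlg where
  gamma l o ho f g := isCobarAlg_gamma S l o ho f g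
  assoc {N} c n o x := by
    change (cobarPair S).actFun o x = 1
    rw [CosimplicialPair.actFun_eq_of_perm (l := []) _ _ _ (by simp) (fun i => i.elim0)
      (fun i => i.elim0)]
    rfl
  lambda β l o ho f g := isCobarAlg_lambda S β l o ho f g
  rho l o ho x := isCobarAlg_rho S l o ho x

end CobarAlg

open CategoryTheory

/-! ### The chains of the standard simplices -/

theorem coMap_coMap (δ : SimplexCategory ⥤ ChainComplex (ModuleCat.{0} ℤ) ℕ) {k l m : ℕ}
    (φ : Fin (l + 1) →o Fin (m + 1)) (ψ : Fin (k + 1) →o Fin (l + 1)) (p : ℕ) (x : El δ k p) :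
    coMap δ φ p (coMap δ ψ p x) = coMap δ (φ.comp ψ) p x := by
  have : SimplexCategory.mkHom (φ.comp ψ) =
    SimplexCategory.mkHom ψ ≫ SimplexCategory.mkHom φ := rfl
  unfold coMap
  rw [this, δ.map_comp]
  rfl

/-- Simplices of dimension `p` of the standard simplex, as monotone maps. -/
def simplexEquiv (n p : ℕ) : (SSet.stdSimplex.{0}.obj (SimplexCategory.mk n)).obj
    (Opposite.op (SimplexCategory.mk p)) ≃ (Fin (p + 1) →o Fin (n + 1)) :=
  SSet.stdSimplex.objEquiv.trans
    ⟨fun f => f.toOrderHom, fun f => SimplexCategory.mkHom f, fun _ => rfl, fun _ => rfl⟩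

/-- The basis of the chains of the standard simplex, indexed by monotone maps. -/
noncomputable def simplexBasis (n p : ℕ) :
    Module.Basis (Fin (p + 1) →o Fin (n + 1)) ℤ (El δZ n p) :=
  Module.Basis.reindex (M := El δZ n p) (Finsupp.basisSingleOne (R := ℤ)
    (ι := (SSet.stdSimplex.{0}.obj (SimplexCategory.mk n)).obj
      (Opposite.op (SimplexCategory.mk p)))) (simplexEquiv n p)

theorem simplexBasis_eq_freeMk (n p : ℕ) (ψ : Fin (p + 1) →o Fin (n + 1)) :
    simplexBasis n p ψ = (ModuleCat.freeMk (R := ℤ) ((simplexEquiv n p).symm ψ) :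
      (ModuleCat.free ℤ).obj _) := by
  refine (Module.Basis.reindex_apply (M := El δZ n p) _ _ _).trans ?_
  exact congrFun Finsupp.coe_basisSingleOne _

/-- The elements of the basis are the images of the fundamental simplex. -/
theorem simplexBasis_apply (n p : ℕ) (ψ : Fin (p + 1) →o Fin (n + 1)) :
    simplexBasis n p ψ = coMap δZ ψ p (fund p) := by
  rw [simplexBasis_eq_freeMk]
  refine Eq.trans ?_ (ModuleCat.free_map_apply (R := ℤ) _ _).symm
  rfl

theorem hom_sum_zsmul_apply {M N : ModuleCat.{0} ℤ} {k : ℕ} (a : Fin k → ℤ) (F : Fin k → (M ⟶ N))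
    (x : M) : (∑ i, a i • F i).hom x = ∑ i, a i • (F i).hom x := by
  rw [ModuleCat.hom_sum, LinearMap.sum_apply]
  rfl

theorem coD_fund (p : ℕ) : coD δZ (p + 1) (p + 1) (fund (p + 1)) =
    ∑ i : Fin (p + 2), (-1 : ℤ) ^ (i : ℕ) •
      coMap δZ (Fin.succAboveOrderEmb i).toOrderHom p (fund p) := by
  have h : (δZ.obj (SimplexCategory.mk (p + 1))).d (p + 1) p =
      ∑ i : Fin (p + 2), (-1 : ℤ) ^ (i : ℕ) • SimplicialObject.δ
        (((SimplicialObject.whiskering _ _).obj (ModuleCat.free ℤ)).obj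
          (SSet.stdSimplex.{0}.obj (SimplexCategory.mk (p + 1)))) i :=
    AlgebraicTopology.AlternatingFaceMapComplex.obj_d_eq _ _
  refine (congrArg (fun F => F.hom (fund (p + 1))) h).trans ?_
  refine (hom_sum_zsmul_apply _ _ _).trans (Finset.sum_congr rfl fun i _ => ?_)
  refine congrArg (fun z => (-1 : ℤ) ^ (i : ℕ) • z) ?_
  rw [← simplexBasis_apply, simplexBasis_eq_freeMk]
  refine (ModuleCat.free_map_apply (R := ℤ) _ _).trans ?_
  rfl

/-! ### Signs -/

theorem sgn_add (a b : ℤ) : sgn (a + b) = sgn a * sgn b := by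
  simp [sgn, Int.negOnePow_add]

theorem sgn_mul_self (a : ℤ) : sgn a * sgn a = 1 := by
  rw [← sgn_add]
  simp [sgn, Int.negOnePow_even _ ⟨a, rfl⟩]

theorem sgn_zero : sgn 0 = 1 := by simp [sgn]

theorem sgn_eq {a b : ℤ} (h : Even (a - b)) : sgn a = sgn b := by
  rw [sgn, sgn, (Int.negOnePow_eq_iff a b).2 h]

/-- The sign `(-1) ^ (q (q + 1) / 2)` in the comparison of the totalization with the cochain
complex. -/
def triSign (q : ℕ) : ℤ := sgn ((q * (q + 1) / 2 : ℕ) : ℤ)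

theorem triSign_mul_self (q : ℕ) : triSign q * triSign q = 1 := sgn_mul_self _

theorem triSign_succ (q : ℕ) : triSign (q + 1) = triSign q * sgn (q + 1) := by
  rw [triSign, triSign, ← sgn_add]
  congr 1
  have : (q + 1) * (q + 1 + 1) / 2 = q * (q + 1) / 2 + (q + 1) := by
    rw [show (q + 1) * (q + 1 + 1) = q * (q + 1) + (q + 1) * 2 by ring, Nat.add_mul_div_right]
    norm_num
  rw [this]
  push_cast
  ring

/-! ### Composition with unary operations -/

namespace RL
variable {ι : Type} [LinearOrder ι] {d : ℕ} {c : ι → Clr} {n : ι → ℕ} {c₀ : Clr} {m : ℕ}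

theorem flatMap_filter_eq {k l : ℕ} (f : Fin (k + 1) →o Fin (l + 1)) (P : Fin (l + 1) → Prop)
    [DecidablePred P] : (((List.finRange (l + 1)).filter fun j => P j).flatMap fun j =>
      (List.finRange (k + 1)).filter fun r => f r = j) =
      (List.finRange (k + 1)).filter fun r => P (f r) := by
  conv_rhs => rw [← flatMap_fiber f, List.filter_flatMap]
  generalize List.finRange (l + 1) = L
  induction L with
  | nil => rfl
  | cons a L ih =>
    rw [List.flatMap_cons, ← ih]
    by_cases h : P a
    · rw [List.filter_cons_of_pos (by simpa using h), List.flatMap_cons]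
      congr 1
      refine (List.filter_eq_self.2 fun r hr => ?_).symm
      have := (List.mem_filter.1 hr).2
      simp only [decide_eq_true_eq] at this ⊢
      rwa [this]
    · rw [List.filter_cons_of_neg (by simpa using h)]
      have : ((List.finRange (k + 1)).filter fun r => f r = a).filter (fun r => P (f r)) = [] := by
        rw [List.filter_eq_nil_iff]
        intro r hr
        have := (List.mem_filter.1 hr).2
        simp only [decide_eq_true_eq] at this ⊢
        rwa [this]
      rw [this, List.nil_append]

theorem post_unary {k l m : ℕ} (φ : Fin (l + 1) →o Fin (m + 1)) (ψ : Fin (k + 1) →o Fin (l + 1)) :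
    (unary d c₀ ψ).post φ = unary d c₀ (φ.comp ψ) := by
  refine ext_seg fun j => ?_
  rw [seg_post]
  simp only [unary]
  rw [← List.map_flatMap, flatMap_filter_eq ψ fun r => φ r = j]
  rfl

/-- The pairs of an element of `ι` and the element of `Unit`. -/
def pairUnit (ι : Type) : ι ≃ Σₗ _ : ι, Unit where
  toFun i := toLex ⟨i, ()⟩
  invFun t := (ofLex t).1
  left_inv _ := rfl
  right_inv _ := rfl

/-- The pairs of the element of `Unit` and an element of `ι`. -/
def unitPair (ι : Type) : ι ≃ Σₗ _ : Unit, ι where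
  toFun i := toLex ⟨(), i⟩
  invFun t := (ofLex t).2
  left_inv _ := rfl
  right_inv _ := rfl

theorem comp_unary_left {m' : ℕ} (ψ : Fin (m + 1) →o Fin (m' + 1)) (o : RL d c n c₀ m) :
    (((unary d c₀ ψ).comp fun _ => o).reindex (unitPair ι) : RL d c n c₀ m') = o.post ψ := by
  refine ext_seg fun j => ?_
  rw [seg_reindex, seg_comp, seg_post, List.flatMap_assoc]
  simp only [unary, List.flatMap_map]
  refine congrArg (fun F => List.flatMap F _) (funext fun r => ?_)
  refine Eq.trans ?_ (List.flatMap_singleton' _)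
  refine congrArg (fun F => List.flatMap F _) (funext fun a => ?_)
  exact congrArg (fun a => [a]) ((Equiv.symm_apply_eq _).2 rfl)

theorem comp_unary_right {n' : ι → ℕ} (o : RL d c n c₀ m)
    (f : ∀ i, Fin (n' i + 1) →o Fin (n i + 1)) :
    ((o.comp fun i => unary d (c i) (f i)).reindex (pairUnit ι) : RL d c n' c₀ m) = o.pre f := by
  refine ext_seg fun j => ?_
  rw [seg_reindex, seg_comp, seg_pre, List.flatMap_assoc]
  refine congrArg (fun F => List.flatMap F _) (funext fun a => ?_)
  simp only [unary, List.flatMap_map, List.map_map]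
  rw [← List.map_eq_flatMap]
  refine List.map_congr_left fun r _ => ?_
  exact (Equiv.symm_apply_eq _).2 rfl

end RL

/-! ### The totalization of an algebra over `RL_d` -/

namespace RLAlg
variable {R : Type u} [CommRing R] {d : ℕ} {X : Clr → ℕ → Type u}
  [∀ c n, AddCommGroup (X c n)] [∀ c n, Module R (X c n)] (A : RLAlg R d X)

theorem cosimp_apply (c : Clr) {k l : ℕ} (ψ : Fin (k + 1) →o Fin (l + 1)) (x : X c k) :
    A.cosimp c ψ x = A.act (RL.unary d c ψ) fun _ => x := by
  refine congrArg (A.act (RL.unary d c ψ)) (funext fun i => ?_)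
  exact Function.update_self (β := fun _ : Unit => X c k) () x 0

theorem cosimp_id (c : Clr) {k : ℕ} (x : X c k) : A.cosimp c OrderHom.id x = x := by
  rw [cosimp_apply, A.act_unit]

section
variable {ι : Type} [LinearOrder ι] [Fintype ι] {c : ι → Clr} {n : ι → ℕ} {c₀ : Clr} {m : ℕ}

theorem act_post {m' : ℕ} (ψ : Fin (m + 1) →o Fin (m' + 1)) (o : RL d c n c₀ m)
    (x : ∀ i, X (c i) (n i)) : A.act (o.post ψ) x = A.cosimp c₀ ψ (A.act o x) := by
  rw [← RL.comp_unary_left, cosimp_apply]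
  have h1 := A.act_reindex (RL.unitPair ι) ((RL.unary d c₀ ψ).comp fun _ => o)
    (fun t => x (ofLex t).2)
  have h2 := A.act_comp (RL.unary d c₀ ψ) (fun _ => o) (fun _ => x)
  exact h1.trans h2

theorem act_pre {n' : ι → ℕ} (o : RL d c n c₀ m) (f : ∀ i, Fin (n' i + 1) →o Fin (n i + 1))
    (x : ∀ i, X (c i) (n' i)) :
    A.act (o.pre f) x = A.act o fun i => A.cosimp (c i) (f i) (x i) := by
  rw [← RL.comp_unary_right]
  simp only [cosimp_apply]
  have h1 := A.act_reindex (RL.pairUnit ι) (o.comp fun i => RL.unary d (c i) (f i))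
    (fun t => x (ofLex t).1)
  have h2 := A.act_comp o (fun i => RL.unary d (c i) (f i)) (fun i _ => x i)
  exact h1.trans h2

end

theorem cosimp_cosimp (c : Clr) {k l m : ℕ} (φ : Fin (l + 1) →o Fin (m + 1))
    (ψ : Fin (k + 1) →o Fin (l + 1)) (x : X c k) :
    A.cosimp c φ (A.cosimp c ψ x) = A.cosimp c (φ.comp ψ) x := by
  rw [cosimp_apply _ _ ψ, ← act_post, RL.post_unary, cosimp_apply]

/-- The differential `∑ (-1) ^ i δ^i` of the cosimplicial module of `A`. -/
noncomputable def cosimpD (c : Clr) (n : ℕ) : X c n →ₗ[R] X c (n + 1) :=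
  ∑ i : Fin (n + 2), (-1 : ℤ) ^ (i : ℕ) • A.cosimp c (Fin.succAboveOrderEmb i).toOrderHom

theorem cosimpD_apply (c : Clr) (n : ℕ) (x : X c n) : A.cosimpD c n x =
    ∑ i : Fin (n + 2), (-1 : ℤ) ^ (i : ℕ) •
      A.cosimp c (Fin.succAboveOrderEmb i).toOrderHom x := by
  simp [cosimpD, LinearMap.sum_apply]

/-- The family of maps on the chains of the standard simplices, natural in the simplex, whose value
on the fundamental simplex of degree `q` is `± x q`, with the sign `triSign q`. -/
noncomputable def yon (c : Clr) (x : ∀ q, X c q) (n q : ℕ) : El δZ n q →ₗ[ℤ] X c n :=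
  (simplexBasis n q).constr ℤ fun ψ => triSign q • A.cosimp c ψ (x q)

theorem yon_coMap_fund (c : Clr) (x : ∀ q, X c q) (n q : ℕ) (ψ : Fin (q + 1) →o Fin (n + 1)) :
    A.yon c x n q (coMap δZ ψ q (fund q)) = triSign q • A.cosimp c ψ (x q) := by
  rw [← simplexBasis_apply, yon, Module.Basis.constr_basis]

theorem yon_fund (c : Clr) (x : ∀ q, X c q) (q : ℕ) :
    A.yon c x q q (fund q) = triSign q • x q := by
  have := A.yon_coMap_fund c x q q OrderHom.id
  rwa [coMap_id, cosimp_id] at this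

/-- Linear maps on the chains of a simplex are determined by their values on the basis. -/
theorem el_induction {n q : ℕ} {M : Type*} [AddCommGroup M] {F G : El δZ n q →ₗ[ℤ] M}
    (h : ∀ ψ, F (coMap δZ ψ q (fund q)) = G (coMap δZ ψ q (fund q))) : F = G :=
  (simplexBasis n q).ext fun ψ => by rw [simplexBasis_apply]; exact h ψ

theorem yon_coMap (c : Clr) (x : ∀ q, X c q) {k l : ℕ} (ψ : Fin (k + 1) →o Fin (l + 1)) (q : ℕ)
    (y : El δZ k q) : A.yon c x l q (coMap δZ ψ q y) = A.cosimp c ψ (A.yon c x k q y) := by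
  have : A.yon c x l q ∘ₗ coMap δZ ψ q =
      (A.cosimp c ψ).toAddMonoidHom.toIntLinearMap ∘ₗ A.yon c x k q := by
    refine el_induction fun φ => ?_
    simp only [LinearMap.comp_apply, coMap_coMap, yon_coMap_fund, AddMonoidHom.coe_toIntLinearMap,
      LinearMap.toAddMonoidHom_coe, map_zsmul, cosimp_cosimp]
  exact LinearMap.congr_fun this y

theorem yon_eq_zero (c : Clr) {x : ∀ q, X c q} {q : ℕ} (h : x q = 0) (n : ℕ) :
    A.yon c x n q = 0 :=
  el_induction fun ψ => by rw [yon_coMap_fund, h, map_zero, smul_zero]; rfl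

theorem yon_add (c : Clr) {x x' x'' : ∀ q, X c q} {q : ℕ} (h : x q = x' q + x'' q) (n : ℕ) :
    A.yon c x n q = A.yon c x' n q + A.yon c x'' n q :=
  el_induction fun ψ => by
    rw [LinearMap.add_apply, yon_coMap_fund, yon_coMap_fund, yon_coMap_fund, h, map_add, smul_add]

theorem yon_smul (c : Clr) (r : R) {x x' : ∀ q, X c q} {q : ℕ} (h : x q = r • x' q) (n : ℕ)
    (y : El δZ n q) : A.yon c x n q y = r • A.yon c x' n q y := by
  have : A.yon c x n q = (r • LinearMap.id (R := R) (M := X c n)).toAddMonoidHom.toIntLinearMap ∘ₗ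
      A.yon c x' n q := by
    refine el_induction fun ψ => ?_
    rw [LinearMap.comp_apply, yon_coMap_fund, yon_coMap_fund, h, map_smul]
    exact smul_comm _ _ _
  exact LinearMap.congr_fun this y

/-- The differential of the cosimplicial module corresponds to precomposition with the differential
of the chains; here `x'` is the image of `x` under the former. -/
theorem yon_coD (c : Clr) {x x' : ∀ q, X c q} (h0 : x' 0 = 0)
    (h : ∀ q, x' (q + 1) = A.cosimpD c q (x q)) (n q : ℕ) (y : El δZ n q) :
    A.yon c x' n q y = sgn q • A.yon c x n (q - 1) (coD δZ n q y) := by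
  cases q with
  | zero => rw [A.yon_eq_zero c h0, coD_zero]; simp
  | succ q =>
    have : A.yon c x' n (q + 1) = sgn (q + 1 : ℕ) • A.yon c x n q ∘ₗ coD δZ n (q + 1) := by
      refine el_induction fun ψ => ?_
      rw [LinearMap.smul_apply, LinearMap.comp_apply, ← coMap_coD, coD_fund, yon_coMap_fund, h,
        cosimpD_apply]
      simp only [map_sum, map_zsmul]
      rw [Finset.smul_sum, Finset.smul_sum]
      refine Finset.sum_congr rfl fun i _ => ?_
      have e := coMap_coMap δZ ψ (Fin.succAboveOrderEmb i).toOrderHom q (fund q)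
      refine Eq.trans ?_ (congrArg (fun z => sgn (q + 1 : ℕ) • (-1 : ℤ) ^ (i : ℕ) •
        A.yon c x n q z) e.symm)
      rw [yon_coMap_fund, cosimp_cosimp, triSign_succ]
      simp only [smul_smul]
      congr 1
      push_cast
      ring
    exact LinearMap.congr_fun this y

theorem yon_mem_Tot (c : Clr) (p : ℕ) {x : ∀ q, X c q} (h : ∀ q, q ≠ p → x q = 0) :
    A.yon c x ∈ Tot δZ A c p :=
  ⟨fun n q hq => A.yon_eq_zero c (h q fun h => hq (by rw [h])) n,
    fun _ _ ψ q y => A.yon_coMap c x ψ q y⟩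

/-- The Yoneda lemma: an element of the totalization is determined by its value on the fundamental
simplex. -/
theorem eq_yon_of_mem_Tot (c : Clr) {p : ℕ} {g : ∀ n q : ℕ, El δZ n q →ₗ[ℤ] X c n}
    (hg : g ∈ Tot δZ A c p) {x : ∀ q, X c q} (hx : ∀ q, q ≠ p → x q = 0)
    (hp : x p = evalFund p g) : g = A.yon c x := by
  funext n q
  by_cases h : q = p
  · subst h
    refine el_induction fun ψ => ?_
    rw [yon_coMap_fund, hg.2, hp, evalFund, map_zsmul, smul_smul]
    change _ = (triSign q * triSign q) • _
    rw [triSign_mul_self, one_smul]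
  · rw [hg.1 n q (by exact_mod_cast h), A.yon_eq_zero c (hx q h)]

theorem evalFund_yon (c : Clr) (p : ℕ) (x : ∀ q, X c q) : evalFund p (A.yon c x) = x p := by
  rw [evalFund, yon_fund, smul_smul]
  change (triSign p * triSign p) • _ = _
  rw [triSign_mul_self, one_smul]

theorem bijective_evalFund (c : Clr) (p : ℕ) :
    Function.Bijective fun g : Tot δZ A c p => evalFund p g.1 := by
  classical
  constructor
  · intro g g' h
    have h : evalFund p g.1 = evalFund p g'.1 := h
    refine Subtype.ext ?_
    have h0 : ∀ q, q ≠ p → Pi.single (M := X c) p (evalFund p g'.1) q = 0 := fun q hq =>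
      Pi.single_eq_of_ne hq _
    exact (A.eq_yon_of_mem_Tot c g.2 h0 ((Pi.single_eq_same p _).trans h.symm)).trans
      (A.eq_yon_of_mem_Tot c g'.2 h0 (Pi.single_eq_same p _)).symm
  · intro v
    refine ⟨⟨A.yon c (Pi.single p v), A.yon_mem_Tot c p fun q hq => Pi.single_eq_of_ne hq _⟩, ?_⟩
    change evalFund p (A.yon c (Pi.single p v)) = v
    rw [evalFund_yon, Pi.single_eq_same]

theorem totD_mem_Tot (c : Clr) (p : ℕ) {g : ∀ n q : ℕ, El δZ n q →ₗ[ℤ] X c n}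
    (hg : g ∈ Tot δZ A c p) : totD p g ∈ Tot δZ A c (p + 1) := by
  refine ⟨fun n q hq => ?_, fun k l ψ q x => ?_⟩
  · rw [totD]
    cases q with
    | zero => rw [coD_zero, LinearMap.comp_zero, smul_zero]
    | succ q =>
      rw [hg.1 n (q + 1 - 1) (by push_cast at hq ⊢; simpa using hq), LinearMap.zero_comp,
        smul_zero]
  · simp only [totD, LinearMap.smul_apply, LinearMap.comp_apply, map_zsmul]
    rw [← coMap_coD, hg.2]

theorem evalFund_totD (c : Clr) (p : ℕ) {g : ∀ n q : ℕ, El δZ n q →ₗ[ℤ] X c n}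
    (hg : g ∈ Tot δZ A c p) :
    evalFund (p + 1) (totD p g) = A.cosimpD c p (evalFund p g) := by
  rw [evalFund, totD, LinearMap.smul_apply, LinearMap.comp_apply, coD_fund, cosimpD_apply, map_sum,
    Finset.smul_sum, Finset.smul_sum]
  refine Finset.sum_congr rfl fun i _ => ?_
  rw [map_zsmul]
  refine Eq.trans (congrArg (fun z => triSign (p + 1) • sgn (p + 1) • (-1 : ℤ) ^ (i : ℕ) • z)
    (hg.2 _ _ (Fin.succAboveOrderEmb i).toOrderHom p (fund p))) ?_
  rw [evalFund, map_zsmul]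
  change _ = _ • triSign p • _
  rw [triSign_succ]
  simp only [smul_smul]
  congr 1
  have := sgn_mul_self (p + 1)
  linear_combination (triSign p * (-1) ^ (i : ℕ)) * this

end RLAlg

/-! ### Quadratic exponents of Koszul signs -/

section Signs
variable {ι : Type} [LinearOrder ι] [Fintype ι]

/-- The sum of the products `a i * b j` over all `j < i`: the exponent of the sign which arises when
a family of elements of degrees `a` is interchanged with one of degrees `b`. -/
def cross (a b : ι → ℤ) : ℤ := ∑ i, ∑ j with j < i, a i * b j

theorem cross_add_add (a b : ι → ℤ) : cross (fun i => a i + b i) (fun i => a i + b i) =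
    cross a a + cross a b + cross b a + cross b b := by
  simp only [cross, ← Finset.sum_add_distrib]
  refine Finset.sum_congr rfl fun i _ => Finset.sum_congr rfl fun j _ => ?_
  ring

theorem cross_add_right (a b b' : ι → ℤ) :
    cross a (fun i => b i + b' i) = cross a b + cross a b' := by
  simp only [cross, ← Finset.sum_add_distrib]
  refine Finset.sum_congr rfl fun i _ => Finset.sum_congr rfl fun j _ => ?_
  ring

theorem cross_add_cross (a b : ι → ℤ) :
    cross a b + cross b a + ∑ i, a i * b i = (∑ i, a i) * ∑ i, b i := by
  have h1 : cross b a = ∑ i, ∑ j with i < j, a i * b j := by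
    simp only [cross, Finset.sum_filter]
    rw [Finset.sum_comm]
    simp only [mul_comm]
  rw [h1, cross, Finset.sum_mul_sum, ← Finset.sum_add_distrib, ← Finset.sum_add_distrib]
  refine Finset.sum_congr rfl fun i _ => ?_
  have h2 : a i * b i = ∑ j, if j = i then a i * b j else 0 := by simp
  rw [h2, Finset.sum_filter, Finset.sum_filter, ← Finset.sum_add_distrib, ← Finset.sum_add_distrib]
  refine Finset.sum_congr rfl fun j _ => ?_
  rcases lt_trichotomy i j with h | h | h
  · simp [h, h.not_gt, h.ne']
  · simp [h]
  · simp [h, h.not_gt, h.ne]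

/-- Hence `cross a a` only depends on the multiset of the values of `a`. -/
theorem two_mul_cross_self (a : ι → ℤ) :
    2 * cross a a = (∑ i, a i) ^ 2 - ∑ i, a i ^ 2 := by
  have := cross_add_cross a a
  simp only [← sq] at this
  linarith

theorem cross_comp_equiv {ι' : Type} [LinearOrder ι'] [Fintype ι'] (e : ι' ≃ ι) (a : ι → ℤ) :
    cross (fun i => a (e i)) (fun i => a (e i)) = cross a a := by
  have h1 := two_mul_cross_self a
  have h2 := two_mul_cross_self fun i => a (e i)
  rw [Equiv.sum_comp e a, Equiv.sum_comp e fun i => a i ^ 2] at h2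
  linarith

/-- The pairs in one block contribute the first summand, those in different blocks the second
one. -/
theorem cross_lex {κ : ι → Type} [∀ i, LinearOrder (κ i)] [∀ i, Fintype (κ i)]
    (a : ∀ i, κ i → ℤ) :
    cross (fun t : Σₗ i, κ i => a (ofLex t).1 (ofLex t).2)
      (fun t => a (ofLex t).1 (ofLex t).2) =
    ∑ i, cross (a i) (a i) + cross (fun i => ∑ j, a i j) fun i => ∑ j, a i j := by
  have hs : ∀ F : (Σ i, κ i) → ℤ, ∑ t : Σₗ i, κ i, F (ofLex t) = ∑ i, ∑ j, F ⟨i, j⟩ := by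
    intro F
    rw [← Fintype.sum_sigma]
    exact (Fintype.sum_equiv (toLex : (Σ i, κ i) ≃ _root_.Lex (Σ i, κ i)) _ _ fun _ => rfl).symm
  have h1 := two_mul_cross_self fun t : Σₗ i, κ i => a (ofLex t).1 (ofLex t).2
  rw [hs fun t => a t.1 t.2, hs fun t => a t.1 t.2 ^ 2] at h1
  have h2 := two_mul_cross_self fun i => ∑ j, a i j
  have h3 : 2 * ∑ i, cross (a i) (a i) = ∑ i, (∑ j, a i j) ^ 2 - ∑ i, ∑ j, a i j ^ 2 := by
    rw [Finset.mul_sum, ← Finset.sum_sub_distrib]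
    exact Finset.sum_congr rfl fun i _ => two_mul_cross_self _
  linarith

theorem cross_update_sub_one (a : ι → ℤ) (i : ι) :
    cross (Function.update a i (a i - 1)) (Function.update a i (a i - 1)) =
      cross a a - ∑ j, a j + a i := by
  have h1 := two_mul_cross_self a
  have h2 := two_mul_cross_self (Function.update a i (a i - 1))
  have h3 : ∑ j, Function.update a i (a i - 1) j = ∑ j, a j - 1 := by
    rw [Finset.sum_update_of_mem (Finset.mem_univ i), ← Finset.add_sum_erase _ _
      (Finset.mem_univ i), Finset.sdiff_singleton_eq_erase]
    ring
  have h4 : ∑ j, Function.update a i (a i - 1) j ^ 2 = ∑ j, a j ^ 2 - 2 * a i + 1 := by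
    have : ∀ j, Function.update a i (a i - 1) j ^ 2 =
        Function.update (fun j => a j ^ 2) i ((a i - 1) ^ 2) j := by
      intro j
      by_cases h : j = i
      · subst h; simp
      · simp [h]
    rw [Finset.sum_congr rfl fun j _ => this j, Finset.sum_update_of_mem (Finset.mem_univ i),
      ← Finset.add_sum_erase _ (fun j => a j ^ 2) (Finset.mem_univ i),
      Finset.sdiff_singleton_eq_erase]
    ring
  rw [h3, h4] at h2
  linarith

end Signs

theorem sgn_sum {ι : Type} (s : Finset ι) (a : ι → ℤ) :
    sgn (∑ i ∈ s, a i) = ∏ i ∈ s, sgn (a i) := by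
  classical
  induction s using Finset.induction_on with
  | empty => simp [sgn_zero]
  | insert i s h ih => rw [Finset.sum_insert h, Finset.prod_insert h, sgn_add, ih]

theorem coD_coD (δ : SimplexCategory ⥤ ChainComplex (ModuleCat.{0} ℤ) ℕ) (k p : ℕ)
    (y : El δ k p) : coD δ k (p - 1) (coD δ k p y) = 0 := by
  have := (δ.obj (SimplexCategory.mk k)).d_comp_d p (p - 1) (p - 1 - 1)
  exact congrArg (fun F => F.hom y) this

theorem coD_eq_zero (δ : SimplexCategory ⥤ ChainComplex (ModuleCat.{0} ℤ) ℕ) (k : ℕ) {p : ℕ}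
    (hp : p = 0) (y : El δ k p) : coD δ k p y = 0 := by
  subst hp
  rw [coD_zero]
  rfl

/-! ### The action of operations on families of elements -/

/-- Two linear maps agree on the elements of degree `K` if they do on the generators of this
degree. -/
theorem Xi.eq_of_mem_deg {ι : Type} [LinearOrder ι] [Fintype ι] {d : ℕ}
    {c : ι → Clr} {c₀ : Clr} {n : ℕ} {M : Type*} [AddCommGroup M] {K : ℤ}
    {F G : Xi δZ d c c₀ n →ₗ[ℤ] M}
    (h : ∀ {k : ι → ℕ} (o : RL d c k c₀ n) (y : ∀ i, HomEl δZ (k i)),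
      ∑ i, ((y i).deg : ℤ) = K → F (Xi.mk o y) = G (Xi.mk o y))
    {z : Xi δZ d c c₀ n} (hz : z ∈ (Xi.deg K : Submodule ℤ (Xi δZ d c c₀ n))) : F z = G z := by
  have : (Xi.deg K : Submodule ℤ (Xi δZ d c c₀ n)) ≤ LinearMap.eqLocus F G := by
    refine Submodule.span_le.2 ?_
    rintro _ ⟨k, o, y, hy, rfl⟩
    exact h o y hy
  exact this hz

namespace RLAlg
variable {R : Type u} [CommRing R] {d : ℕ} {X : Clr → ℕ → Type u}
  [∀ c n, AddCommGroup (X c n)] [∀ c n, Module R (X c n)] (A : RLAlg R d X)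

/-- The map `x ↦ yon x y`, for a fixed chain `y`. -/
noncomputable def yonL (c : Clr) {n : ℕ} (y : HomEl δZ n) : (∀ q, X c q) →ₗ[R] X c n where
  toFun x := A.yon c x n y.deg y.val
  map_add' x x' := by rw [A.yon_add c (x := x + x') (x' := x) (x'' := x') rfl]; rfl
  map_smul' r x := A.yon_smul c r rfl n y.val

theorem yonL_add (c : Clr) {n p : ℕ} (a b : El δZ n p) :
    A.yonL c ⟨p, a + b⟩ = A.yonL c ⟨p, a⟩ + A.yonL c ⟨p, b⟩ :=
  LinearMap.ext fun x => map_add (A.yon c x n p) a b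

variable {ι : Type} [LinearOrder ι] [Fintype ι] {c : ι → Clr} {c₀ : Clr}

/-- The evaluation `o ⊗ y_1 ⊗ ⋯ ⊗ y_k ↦ ± o(x_1(y_1), …, x_k(y_k))` of the coend at elements `x_i`
of the totalizations, in which the degrees of the `x_i` are read off from those of the `y_i`. -/
noncomputable def evalXi (n : ℕ) :
    Xi δZ d c c₀ n →ₗ[ℤ] MultilinearMap R (fun i => ∀ q, X (c i) q) (X c₀ n) :=
  Xi.lift (fun o y => sgn (cross (fun i => ((y i).deg : ℤ)) fun i => ((y i).deg : ℤ)) •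
      (A.act o).compLinearMap fun i => A.yonL (c i) (y i))
    (by
      intro k o y i p a b
      simp only [Xi.deg_update]
      rw [← smul_add]
      congr 1
      ext x
      have h : ∀ v, (fun j => A.yonL (c j) (Function.update y i v j) (x j)) =
          Function.update (fun j => A.yonL (c j) (y j) (x j)) i (A.yonL (c i) v (x i)) := by
        intro v
        funext j
        by_cases h : j = i
        · subst h; simp
        · simp [h]
      simp only [_root_.add_apply, MultilinearMap.compLinearMap_apply, h, yonL_add,
        LinearMap.add_apply]
      exact (A.act o).map_update_add _ _ _ _)
    (by
      intro k k' o f y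
      refine congrArg (fun z => sgn (cross (fun i => ((y i).deg : ℤ)) fun i =>
        ((y i).deg : ℤ)) • z) ?_
      ext x
      simp only [MultilinearMap.compLinearMap_apply]
      rw [act_pre]
      refine congrArg (A.act o) (funext fun i => ?_)
      exact (A.yon_coMap (c i) (x i) (f i) (y i).deg (y i).val).symm)

theorem evalXi_mk {n : ℕ} {k : ι → ℕ} (o : RL d c k c₀ n) (y : ∀ i, HomEl δZ (k i))
    (x : ∀ i q, X (c i) q) : A.evalXi n (Xi.mk o y) x =
      sgn (cross (fun i => ((y i).deg : ℤ)) fun i => ((y i).deg : ℤ)) •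
        A.act o fun i => A.yon (c i) (x i) (k i) (y i).deg (y i).val := by
  exact congrArg (fun F : MultilinearMap R (fun i => ∀ q, X (c i) q) (X c₀ n) => F x)
    (Xi.lift_mk _ _ _ o y)

/-- The map `evalXi` at fixed elements `x i`. -/
noncomputable def evalXiAt (x : ∀ i q, X (c i) q) (n : ℕ) : Xi δZ d c c₀ n →ₗ[ℤ] X c₀ n where
  toFun z := A.evalXi n z x
  map_add' a b := by rw [map_add]; rfl
  map_smul' r a := by rw [map_smul]; rfl

theorem evalXiAt_apply (x : ∀ i q, X (c i) q) {n : ℕ} (z : Xi δZ d c c₀ n) :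
    A.evalXiAt x n z = A.evalXi n z x := rfl

theorem evalXi_map {n n' : ℕ} (ψ : Fin (n + 1) →o Fin (n' + 1)) (z : Xi δZ d c c₀ n)
    (x : ∀ i q, X (c i) q) :
    A.evalXi n' (Xi.map ψ z) x = A.cosimp c₀ ψ (A.evalXi n z x) := by
  have : A.evalXiAt x n' ∘ₗ Xi.map ψ =
      (A.cosimp c₀ ψ).toAddMonoidHom.toIntLinearMap ∘ₗ A.evalXiAt x n := by
    refine Xi.hom_ext fun o y => ?_
    simp only [LinearMap.comp_apply, evalXiAt_apply, Xi.map_mk, evalXi_mk, act_post,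
      AddMonoidHom.coe_toIntLinearMap, LinearMap.toAddMonoidHom_coe, map_zsmul]
  exact LinearMap.congr_fun this z

theorem act_eq_zero {n : ι → ℕ} {m : ℕ} (o : RL d c n c₀ m) {x : ∀ i, X (c i) (n i)} {i : ι}
    (h : x i = 0) : A.act o x = 0 := (A.act o).map_coord_zero i h

theorem evalXi_mk_eq_zero {n : ℕ} {k : ι → ℕ} (o : RL d c k c₀ n) (y : ∀ i, HomEl δZ (k i))
    {x : ∀ i q, X (c i) q} {i : ι} (h : x i (y i).deg = 0) : A.evalXi n (Xi.mk o y) x = 0 := by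
  rw [evalXi_mk, A.act_eq_zero o (i := i), smul_zero]
  rw [A.yon_eq_zero (c i) h]
  rfl

/-- The evaluation vanishes on an element of degree `K` if no degrees in which all the `x i` are
nonzero add up to `K`. -/
theorem evalXi_eq_zero {n : ℕ} {K : ℤ} {x : ∀ i q, X (c i) q}
    (h : ∀ k : ι → ℕ, ∑ i, (k i : ℤ) = K → ∃ i, x i (k i) = 0) {z : Xi δZ d c c₀ n}
    (hz : z ∈ (Xi.deg K : Submodule ℤ (Xi δZ d c c₀ n))) : A.evalXi n z x = 0 := by
  refine Xi.eq_of_mem_deg (F := A.evalXiAt x n) (G := 0) (fun o y hy => ?_) hz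
  obtain ⟨i, hi⟩ := h (fun i => (y i).deg) hy
  exact A.evalXi_mk_eq_zero o y hi

/-- The component of degree `q` of the action of an operation of degree `m`. If the arguments are
homogeneous, `q + m` is the sum of their degrees wherever the value is nonzero, so that the sign
`(-1) ^ (m (q + m))` is the one in the action on totalizations. -/
noncomputable def coendFun {m : ℤ} (f : Coend δZ d c c₀ m) (q : ℕ) :
    MultilinearMap R (fun i => ∀ q, X (c i) q) (X c₀ q) :=
  (triSign q * sgn (m * (q + m))) • A.evalXi q (f.1 q q (fund q))

/-- The action of `f` is composition with `f`, up to a sign. -/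
theorem yon_coendFun {m : ℤ} (f : Coend δZ d c c₀ m) (x : ∀ i q, X (c i) q) (n q : ℕ)
    (y : El δZ n q) : A.yon c₀ (fun q => A.coendFun f q x) n q y =
      sgn (m * (q + m)) • A.evalXi n (f.1 n q y) x := by
  have : A.yon c₀ (fun q => A.coendFun f q x) n q =
      sgn (m * (q + m)) • A.evalXiAt x n ∘ₗ f.1 n q := by
    refine el_induction fun ψ => ?_
    rw [yon_coMap_fund, LinearMap.smul_apply, LinearMap.comp_apply, f.2.2, evalXiAt_apply,
      evalXi_map, coendFun, _root_.smul_apply, map_zsmul, smul_smul, ← mul_assoc,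
      triSign_mul_self, one_mul]
  exact LinearMap.congr_fun this y

theorem eq_of_yon_eq (c : Clr) {x x' : ∀ q, X c q} {q : ℕ}
    (h : ∀ y : El δZ q q, A.yon c x q q y = A.yon c x' q q y) : x q = x' q := by
  have h1 := congrArg (fun z => triSign q • z) (h (fund q))
  simpa only [yon_fund, smul_smul, triSign_mul_self, one_smul] using h1

/-- The family `x` vanishes in all degrees other than `p`. -/
def Homog {c : Clr} (x : ∀ q, X c q) (p : ℤ) : Prop := ∀ q : ℕ, (q : ℤ) ≠ p → x q = 0

theorem homog_coendFun {m : ℤ} (f : Coend δZ d c c₀ m) {p : ι → ℤ} {x : ∀ i q, X (c i) q}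
    (hx : ∀ i, Homog (x i) (p i)) : Homog (fun q => A.coendFun f q x) (∑ i, p i - m) := by
  intro q hq
  change A.coendFun f q x = 0
  rw [coendFun, _root_.smul_apply, A.evalXi_eq_zero (K := q + m) ?_ (f.2.1 q q _),
    smul_zero]
  intro k hk
  by_contra hc
  push Not at hc
  refine hq (eq_sub_of_add_eq ?_)
  rw [← hk]
  refine Finset.sum_congr rfl fun i _ => ?_
  by_contra h
  exact hc i (hx i _ h)

theorem coendFun_bounded {m : ℤ} (f : Coend δZ d c c₀ m) {N : ι → ℕ} {x : ∀ i q, X (c i) q}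
    (hx : ∀ i q, N i ≤ q → x i q = 0) {q : ℕ} (hq : ∑ i, (N i : ℤ) < q + m) :
    A.coendFun f q x = 0 := by
  rw [coendFun, _root_.smul_apply, A.evalXi_eq_zero (K := q + m) ?_ (f.2.1 q q _),
    smul_zero]
  intro k hk
  by_contra hc
  push Not at hc
  rw [← hk] at hq
  refine absurd hq (not_lt.2 (Finset.sum_le_sum fun i _ => ?_))
  by_contra h
  exact hc i (hx i _ (by omega))

theorem coendFun_add {m : ℤ} (f g : Coend δZ d c c₀ m) (q : ℕ) :
    A.coendFun (f + g) q = A.coendFun f q + A.coendFun g q := by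
  rw [coendFun, coendFun, coendFun, ← smul_add, ← map_add]
  rfl

theorem coendFun_one (c₀ : Clr) (q : ℕ) (x : Unit → ∀ q, X c₀ q) :
    A.coendFun (Coend.one δZ d c₀) q x = x () q := by
  refine A.eq_of_yon_eq c₀ (x := fun q => A.coendFun (Coend.one δZ d c₀) q x) fun y => ?_
  rw [yon_coendFun]
  refine (congrArg (fun z => sgn (0 * (q + 0)) • z) (A.evalXi_mk (k := fun _ : Unit => q)
    (RL.unary d c₀ OrderHom.id) (fun _ => ⟨q, y⟩) x)).trans ?_
  rw [act_unit]
  simp [cross, sgn_zero]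

theorem coendFun_symm {ι' : Type} [LinearOrder ι'] [Fintype ι'] {m : ℤ} (f : Coend δZ d c c₀ m)
    (e : ι' ≃ ι) {p : ι → ℤ} {x : ∀ i q, X (c i) q} (hx : ∀ i, Homog (x i) (p i)) (q : ℕ) :
    A.coendFun (Coend.symm f e) q (fun i => x (e i)) = koszul e p • A.coendFun f q x := by
  have : A.evalXiAt (fun i => x (e i)) q ∘ₗ Xi.symm e =
      koszul e p • (A.evalXiAt x q : Xi δZ d c c₀ q →ₗ[ℤ] _) := by
    refine Xi.hom_ext fun {k} o y => ?_
    rw [LinearMap.comp_apply, Xi.symm_mk, map_zsmul, LinearMap.smul_apply, evalXiAt_apply,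
      evalXiAt_apply]
    by_cases h : ∀ i, ((y i).deg : ℤ) = p i
    · rw [show (fun i => ((y i).deg : ℤ)) = p from funext h, evalXi_mk, evalXi_mk]
      have h1 := cross_comp_equiv e fun i => ((y i).deg : ℤ)
      have h2 := A.act_reindex e o fun i => A.yon (c i) (x i) (k i) (y i).deg (y i).val
      rw [h1]
      exact congrArg (fun z => koszul e p • sgn _ • z) h2
    · push Not at h
      obtain ⟨i, hi⟩ := h
      obtain ⟨i, rfl⟩ := e.surjective i
      rw [A.evalXi_mk_eq_zero o y (hx _ _ hi),
        A.evalXi_mk_eq_zero (o.reindex e) (fun i => y (e i)) (x := fun i => x (e i)) (i := i)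
          (hx _ _ hi), smul_zero, smul_zero]
  rw [coendFun, coendFun, _root_.smul_apply, _root_.smul_apply,
    smul_comm (koszul e p)]
  exact congrArg (fun z => _ • z) (LinearMap.congr_fun this (f.1 q q (fund q)))

/-- The evaluation is compatible with the substitution of homogeneous elements of the coends. -/
theorem evalXi_subst {κ : ι → Type} [∀ i, LinearOrder (κ i)] [∀ i, Fintype (κ i)]
    {c' : ∀ i, κ i → Clr} {k : ι → ℕ} {n : ℕ} (o : RL d c k c₀ n) (K : ι → ℤ)
    (z : ∀ i, Xi δZ d (c' i) (c i) (k i))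
    (hz : ∀ i, z i ∈ (Xi.deg (K i) : Submodule ℤ (Xi δZ d (c' i) (c i) (k i))))
    (x : ∀ i j q, X (c' i j) q) :
    A.evalXi n (Xi.subst o z) (fun t : Σₗ i, κ i => x (ofLex t).1 (ofLex t).2) =
      sgn (cross K K) • A.act o fun i => A.evalXi (k i) (z i) (x i) := by
  let F : MultilinearMap ℤ (fun i => Xi δZ d (c' i) (c i) (k i)) (X c₀ n) :=
    (A.evalXiAt (fun t : Σₗ i, κ i => x (ofLex t).1 (ofLex t).2) n).compMultilinearMap
      (Xi.subst o)
  let G : MultilinearMap ℤ (fun i => Xi δZ d (c' i) (c i) (k i)) (X c₀ n) :=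
    sgn (cross K K) • ((A.act o).restrictScalars ℤ).compLinearMap
      fun i => A.evalXiAt (x i) (k i)
  have := multilinear_mem_of_span (F - G) _ ⊥ ?_ z hz
  · exact sub_eq_zero.1 this
  · intro u hu
    choose l y w hw hu using hu
    obtain rfl : u = fun i => Xi.mk (y i) (w i) := funext hu
    refine sub_eq_zero.2 ?_
    change A.evalXi n (Xi.subst o fun i => Xi.mk (y i) (w i))
      (fun t : Σₗ i, κ i => x (ofLex t).1 (ofLex t).2) =
      sgn (cross K K) • A.act o fun i => A.evalXi (k i) (Xi.mk (y i) (w i)) (x i)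
    rw [Xi.subst_mk, evalXi_mk]
    have h1 := cross_lex fun i j => ((w i j).deg : ℤ)
    have h2 := A.act_comp o y fun i j => A.yon (c' i j) (x i j) (l i j) (w i j).deg (w i j).val
    rw [h1, show (fun i => ∑ j, ((w i j).deg : ℤ)) = K from funext hw]
    refine (congrArg (fun z => sgn _ • z) h2).trans ?_
    simp only [evalXi_mk]
    have h3 := ((A.act o).restrictScalars ℤ).map_smul_univ
      (fun i => sgn (cross (fun j => ((w i j).deg : ℤ)) fun j => ((w i j).deg : ℤ)))
      (fun i => A.act (y i) fun j => A.yon (c' i j) (x i j) (l i j) (w i j).deg (w i j).val)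
    refine Eq.trans ?_ (congrArg (fun z => sgn (cross K K) • z) h3).symm
    rw [smul_smul, sgn_add, mul_comm, sgn_sum]
    rfl

/-- Compatibility with the composition of the operad. -/
theorem coendFun_comp {κ : ι → Type} [∀ i, LinearOrder (κ i)] [∀ i, Fintype (κ i)]
    {c' : ∀ i, κ i → Clr} {m : ℤ} {e : ι → ℤ} (f : Coend δZ d c c₀ m)
    (g : ∀ i, Coend δZ d (c' i) (c i) (e i)) {p : ∀ i, κ i → ℤ} {x : ∀ i j q, X (c' i j) q}
    (hx : ∀ i j, Homog (x i j) (p i j)) (q : ℕ) :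
    A.coendFun (Coend.comp f g) q (fun t => x (ofLex t).1 (ofLex t).2) =
      sgn (∑ i, ∑ i' with i' < i, e i * ∑ j, p i' j) •
        A.coendFun f q fun i q => A.coendFun (g i) q (x i) := by
  -- Both sides are determined by the evaluations of a single element of the coend, of degree
  -- `q + m`, and these can be compared on its generators.
  set E : ℤ := ∑ i, e i with hE
  let X' : ∀ t : Σₗ i, κ i, ∀ q, X (c' (ofLex t).1 (ofLex t).2) q :=
    fun t => x (ofLex t).1 (ofLex t).2
  have key : ∀ z ∈ (Xi.deg (q + m) : Submodule ℤ (Xi δZ d c c₀ q)),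
      sgn ((m + E) * (q + (m + E))) • sgn (m * E) • A.evalXi q (Coend.substMap g q z) X' =
      (sgn (cross e fun i => ∑ j, p i j) * sgn (m * (q + m))) •
        A.evalXi q z fun i q => A.coendFun (g i) q (x i) := by
    intro z hz
    refine Xi.eq_of_mem_deg
      (F := sgn ((m + E) * (q + (m + E))) • sgn (m * E) • A.evalXiAt X' q ∘ₗ
        Coend.substMap g q)
      (G := (sgn (cross e fun i => ∑ j, p i j) *
        sgn (m * (q + m))) • A.evalXiAt (fun i q => A.coendFun (g i) q (x i)) q)
      (fun {k} o y hy => ?_) hz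
    set a : ι → ℤ := fun i => ((y i).deg : ℤ) with ha
    have h1 : A.evalXi q (Xi.subst o fun i => Coend.eval (g i) (y i)) X' =
        sgn (cross (fun i => a i + e i) fun i => a i + e i) •
          A.act o fun i => A.evalXi (k i) (Coend.eval (g i) (y i)) (x i) :=
      A.evalXi_subst o (fun i => a i + e i) (fun i => Coend.eval (g i) (y i))
        (fun i => (g i).2.1 _ _ _) x
    have h2 : A.evalXi q (Xi.mk o y) (fun i q => A.coendFun (g i) q (x i)) =
        sgn (cross a a) • sgn (∑ i, e i * (a i + e i)) •
          A.act o fun i => A.evalXi (k i) (Coend.eval (g i) (y i)) (x i) := by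
      rw [evalXi_mk, sgn_sum]
      have := ((A.act o).restrictScalars ℤ).map_smul_univ (fun i => sgn (e i * (a i + e i)))
        (fun i => A.evalXi (k i) (Coend.eval (g i) (y i)) (x i))
      refine congrArg (fun z => sgn (cross a a) • z) (Eq.trans ?_ this)
      exact congrArg (A.act o) (funext fun i => A.yon_coendFun (g i) (x i) _ _ _)
    simp only [LinearMap.smul_apply, LinearMap.comp_apply, evalXiAt_apply, Coend.substMap_mk,
      map_zsmul]
    rw [h2]
    refine (congrArg (fun z => sgn ((m + E) * (q + (m + E))) • sgn (m * E) •
      sgn (cross e a) • z) h1).trans ?_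
    by_cases hd : ∀ i, a i + e i = ∑ j, p i j
    · simp only [smul_smul, ← sgn_add]
      congr 1
      refine sgn_eq ?_
      have hp : (fun i => ∑ j, p i j) = fun i => a i + e i := funext fun i => (hd i).symm
      rw [hp, cross_add_add, cross_add_right]
      have e1 := cross_add_cross a e
      have e2 := cross_add_cross e e
      have e3 : ∑ i, e i * (a i + e i) = ∑ i, a i * e i + ∑ i, e i * e i := by
        rw [← Finset.sum_add_distrib]
        exact Finset.sum_congr rfl fun i _ => by ring
      rw [← hE] at e1 e2
      rw [show ∑ i, a i = q + m from hy] at e1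
      rw [e3]
      refine ⟨2 * m * E + E * q + E * E - cross e e - ∑ i, e i * e i - ∑ i, a i * e i, ?_⟩
      linear_combination e1 + e2
    · -- Both sides vanish for degree reasons.
      push Not at hd
      obtain ⟨i, hi⟩ := hd
      have : A.evalXi (k i) (Coend.eval (g i) (y i)) (x i) = 0 := by
        refine A.evalXi_eq_zero (fun l hl => ?_) ((g i).2.1 _ _ _)
        by_contra hc
        push Not at hc
        refine hi (hl.symm.trans (Finset.sum_congr rfl fun j _ => ?_))
        by_contra h
        exact hc j (hx i j _ h)
      rw [A.act_eq_zero o (i := i) this]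
      simp only [smul_zero]
  have := key _ (f.2.1 q q (fund q))
  have h2 := congrArg (fun z => triSign q • z) this
  rw [coendFun, coendFun, _root_.smul_apply, _root_.smul_apply]
  refine Eq.trans ?_ (h2.trans ?_)
  · have : A.evalXi q ((Coend.comp f g).1 q q (fund q)) X' =
        sgn (m * E) • A.evalXi q (Coend.substMap g q (f.1 q q (fund q))) X' :=
      map_zsmul (A.evalXiAt X' q) _ _
    rw [mul_smul]
    exact congrArg (fun z => triSign q • sgn ((m + E) * (q + (m + E))) • z) this
  · simp only [smul_smul]
    congr 1
    rw [cross]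
    simp only [Finset.mul_sum]
    ring

/-- The evaluation turns the differential of the coend into the one of the arguments; here `x' i` is
the image of `x i` under the differential of the cosimplicial module. -/
theorem evalXi_diff {n : ℕ} {K : ℤ} {z : Xi δZ d c c₀ n}
    (hz : z ∈ (Xi.deg K : Submodule ℤ (Xi δZ d c c₀ n))) {p : ι → ℤ} {x x' : ∀ i q, X (c i) q}
    (hx : ∀ i, Homog (x i) (p i)) (h0 : ∀ i, x' i 0 = 0)
    (h : ∀ i q, x' i (q + 1) = A.cosimpD (c i) q (x i q)) :
    A.evalXi n (Xi.diff z) x =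
      sgn K • ∑ i, sgn (∑ j with j < i, p j) • A.evalXi n z (Function.update x i (x' i)) := by
  have : (sgn K • ∑ i, sgn (∑ j with j < i, p j) •
      A.evalXiAt (Function.update x i (x' i)) n : Xi δZ d c c₀ n →ₗ[ℤ] _) z =
      sgn K • ∑ i, sgn (∑ j with j < i, p j) • A.evalXi n z (Function.update x i (x' i)) := by
    simp only [LinearMap.smul_apply, LinearMap.sum_apply]
    rfl
  rw [← this]
  refine Xi.eq_of_mem_deg (F := A.evalXiAt x n ∘ₗ Xi.diff) (fun {k} o y hy => ?_) hz
  simp only [LinearMap.comp_apply, LinearMap.smul_apply, LinearMap.sum_apply, Xi.diff_mk, map_sum,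
    map_zsmul, Finset.smul_sum, evalXiAt_apply, evalXi_mk]
  refine Finset.sum_congr rfl fun i _ => ?_
  set a : ι → ℤ := fun i => ((y i).deg : ℤ) with ha
  set v : ∀ j, X (c j) (k j) := fun j => A.yon (c j) (x j) (k j) (y j).deg (y j).val with hv
  set u : X (c i) (k i) :=
    A.yon (c i) (x i) (k i) ((y i).deg - 1) (coD δZ (k i) (y i).deg (y i).val) with hu
  have h1 : (fun j => A.yon (c j) (x j) (k j) (Function.update y i (y i).diff j).deg
      (Function.update y i (y i).diff j).val) = Function.update v i u := by
    refine Function.eq_update_iff.2 ⟨?_, fun j hj => ?_⟩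
    · change A.yonL (c i) (Function.update y i (y i).diff i) (x i) = _
      rw [Function.update_self]
      rfl
    · change A.yonL (c j) (Function.update y i (y i).diff j) (x j) = _
      rw [Function.update_of_ne hj]
      rfl
  have h2 : (fun j => A.yon (c j) (Function.update x i (x' i) j) (k j) (y j).deg (y j).val) =
      Function.update v i (sgn (a i) • u) := by
    refine Function.eq_update_iff.2 ⟨?_, fun j hj => ?_⟩
    · simp only [Function.update_self]
      exact A.yon_coD (c i) (h0 i) (h i) _ _ _
    · simp only [Function.update_of_ne hj, hv]
  have h3 : A.act o (Function.update v i (sgn (a i) • u)) =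
      sgn (a i) • A.act o (Function.update v i u) :=
    ((A.act o).restrictScalars ℤ).map_update_smul v i (sgn (a i)) u
  rw [h1, h2, h3]
  by_cases hq : (y i).deg = 0
  · have : u = 0 := by
      rw [hu, coD_eq_zero _ _ hq, map_zero]
    rw [A.act_eq_zero o (i := i) (x := Function.update v i u) (by rw [this, Function.update_self])]
    simp only [smul_zero]
  by_cases hp : ∀ j, j ≠ i → a j = p j
  · have h4 : (fun j => ((Function.update y i (y i).diff j).deg : ℤ)) =
        Function.update a i (a i - 1) := by
      refine Function.eq_update_iff.2 ⟨?_, fun j hj => ?_⟩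
      · simp only [Function.update_self, HomEl.diff, ha]
        omega
      · simp only [Function.update_of_ne hj, ha]
    have h5 : ∑ j with j < i, p j = ∑ j with j < i, a j :=
      Finset.sum_congr rfl fun j hj => (hp j (Finset.mem_filter.1 hj).2.ne).symm
    rw [h4, h5, cross_update_sub_one, show ∑ j, a j = K from hy]
    simp only [smul_smul, ← sgn_add]
    congr 1
    exact sgn_eq ⟨-K, by ring⟩
  · push Not at hp
    obtain ⟨j, hj, hj'⟩ := hp
    rw [A.act_eq_zero o (i := j) (x := Function.update v i u)]
    · simp only [smul_zero]
    · rw [Function.update_of_ne hj, hv]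
      have := A.yon_eq_zero (c j) (hx j _ hj') (k j)
      exact congrArg (fun F => F (y j).val) this

/-- Compatibility with the differentials: `w` is the differential of the value of the operation `f`,
and `x' i` the one of `x i`. -/
theorem coendFun_diff {m : ℤ} (f : Coend δZ d c c₀ m) {p : ι → ℤ} {x x' : ∀ i q, X (c i) q}
    (hx : ∀ i, Homog (x i) (p i)) (h0 : ∀ i, x' i 0 = 0)
    (h : ∀ i q, x' i (q + 1) = A.cosimpD (c i) q (x i q)) {w : ∀ q, X c₀ q} (hw0 : w 0 = 0)
    (hw : ∀ q, w (q + 1) = A.cosimpD c₀ q (A.coendFun f q x)) (q : ℕ) :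
    w q = A.coendFun (Coend.diff f) q x +
      sgn m • ∑ i, sgn (∑ j with j < i, p j) • A.coendFun f q (Function.update x i (x' i)) := by
  have e1 : triSign q • A.yon c₀ w q q (fund q) = w q := by
    rw [yon_fund, smul_smul, triSign_mul_self, one_smul]
  have e2 : A.evalXi q ((Coend.diff f).1 q q (fund q)) x =
      A.evalXi q (Xi.diff (f.1 q q (fund q))) x -
        sgn m • A.evalXi q (f.1 q (q - 1) (coD δZ q q (fund q))) x := by
    refine (map_sub (A.evalXiAt x q) _ _).trans ?_
    exact congrArg (fun z => _ - z) (map_zsmul (A.evalXiAt x q) _ _)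
  rw [← e1, A.yon_coD c₀ hw0 hw, yon_coendFun]
  simp only [coendFun, _root_.smul_apply]
  rw [e2, A.evalXi_diff (f.2.1 q q (fund q)) hx h0 h]
  set S := fun i => A.evalXi q (f.1 q q (fund q)) (Function.update x i (x' i))
  set z := A.evalXi q (f.1 q (q - 1) (coD δZ q q (fund q))) x with hz
  -- The term `f ∘ d` of the differential of `f`.
  have e3 : (sgn q * sgn (m * ((q - 1 : ℕ) + m))) • z =
      -(sgn ((m - 1) * (q + (m - 1))) * sgn m) • z := by
    cases q with
    | zero =>
      have : z = 0 := by
        rw [hz, coD_zero, LinearMap.zero_apply, map_zero, map_zero]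
        rfl
      rw [this, smul_zero, smul_zero]
    | succ q =>
      congr 1
      have : (-1 : ℤ) = sgn 1 := by simp [sgn]
      rw [neg_eq_neg_one_mul, this]
      simp only [← sgn_add]
      refine sgn_eq ⟨q, ?_⟩
      push_cast
      simp
      ring
  -- The term `∂ ∘ f`.
  have e4 : sgn ((m - 1) * (q + (m - 1))) * sgn (q + m) = -(sgn m * sgn (m * (q + m))) := by
    have : (-1 : ℤ) = sgn 1 := by simp [sgn]
    rw [neg_eq_neg_one_mul, this]
    simp only [← sgn_add]
    exact sgn_eq ⟨-m, by ring⟩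
  have e5 : sgn m • ∑ i, sgn (∑ j with j < i, p j) • (triSign q * sgn (m * (q + m))) • S i =
      (triSign q * (sgn m * sgn (m * (q + m)))) • ∑ i, sgn (∑ j with j < i, p j) • S i := by
    rw [Finset.smul_sum, Finset.smul_sum]
    refine Finset.sum_congr rfl fun i _ => ?_
    simp only [smul_smul]
    congr 1
    ring
  rw [e5, smul_sub, smul_smul (_ * _) (sgn (q + m)), mul_assoc (triSign q), e4]
  rw [smul_smul (sgn q), e3]
  module

end RLAlg

/-! ### The algebra structure on the direct sum of the components -/

namespace RLAlg
variable {R : Type u} [CommRing R] {d : ℕ} {X : Clr → ℕ → Type u}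
  [∀ c n, AddCommGroup (X c n)] [∀ c n, Module R (X c n)] (A : RLAlg R d X)
  {ι : Type} [LinearOrder ι] [Fintype ι] {c : ι → Clr} {c₀ : Clr}

theorem exists_bound {c : Clr} (x : DirectSum ℕ (X c)) : ∃ N, ∀ q, N ≤ q → x q = 0 := by
  classical
  obtain ⟨N, hN⟩ := (DFinsupp.support x).finite_toSet.bddAbove
  refine ⟨N + 1, fun q hq => ?_⟩
  by_contra h
  have : q ≤ N := hN (DFinsupp.mem_support_iff.2 h)
  omega

/-- The element of the direct sum with the given components, if these vanish in large degrees. -/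
noncomputable def ofBounded {c : Clr} (F : ∀ q, X c q) (h : ∃ N, ∀ q, N ≤ q → F q = 0) :
    DirectSum ℕ (X c) :=
  DirectSum.mk (X c) (Finset.range h.choose) fun q => F q

theorem ofBounded_apply {c : Clr} (F : ∀ q, X c q) (h : ∃ N, ∀ q, N ≤ q → F q = 0) (q : ℕ) :
    ofBounded F h q = F q := by
  by_cases hq : q < h.choose
  · exact DirectSum.mk_apply_of_mem (Finset.mem_range.2 hq)
  · rw [h.choose_spec q (not_lt.1 hq)]
    exact DirectSum.mk_apply_of_notMem fun h => hq (Finset.mem_range.1 h)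

/-- The value of an operation at elements of the direct sums has finitely many components, since the
degrees of the chains in a nonzero term are bounded. -/
theorem coendFun_eventually {m : ℤ} (f : Coend δZ d c c₀ m) (x : ∀ i, DirectSum ℕ (X (c i))) :
    ∃ N, ∀ q, N ≤ q → A.coendFun f q (fun i q => x i q) = 0 := by
  choose N hN using fun i => exists_bound (x i)
  refine ⟨(∑ i, (N i : ℤ) - m + 1).toNat, fun q hq => A.coendFun_bounded f hN ?_⟩
  have := Int.self_le_toNat (∑ i, (N i : ℤ) - m + 1)
  have : ((∑ i, (N i : ℤ) - m + 1).toNat : ℤ) ≤ q := by exact_mod_cast hq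
  omega

theorem coe_update {ι : Type} [DecidableEq ι] {c : ι → Clr}
    (x : ∀ i, DirectSum ℕ (X (c i))) (i : ι) (v : DirectSum ℕ (X (c i))) :
    (fun j q => Function.update x i v j q) =
      Function.update (β := fun j => ∀ q, X (c j) q) (fun j q => x j q) i fun q => v q := by
  refine Function.eq_update_iff.2 ⟨?_, fun j hj => ?_⟩
  · rw [Function.update_self]
  · rw [Function.update_of_ne hj]

/-- The action of an operation of the coendomorphism operad on the direct sums. -/
noncomputable def coendAct {m : ℤ} (f : Coend δZ d c c₀ m) :
    MultilinearMap R (fun i => DirectSum ℕ (X (c i))) (DirectSum ℕ (X c₀)) :=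
  MultilinearMap.mk' (fun x => ofBounded _ (A.coendFun_eventually f x))
    (fun x i a b => DFinsupp.ext fun q => by
      refine (ofBounded_apply _ _ q).trans (Eq.trans ?_ (DirectSum.add_apply _ _ q).symm)
      rw [ofBounded_apply, ofBounded_apply, coe_update, coe_update, coe_update]
      exact (A.coendFun f q).map_update_add _ _ _ _)
    (fun x i r a => DFinsupp.ext fun q => by
      refine (ofBounded_apply _ _ q).trans (Eq.trans ?_ (DirectSum.smul_apply r _ q).symm)
      rw [ofBounded_apply, coe_update, coe_update]
      exact (A.coendFun f q).map_update_smul _ _ _ _)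

theorem coendAct_apply {m : ℤ} (f : Coend δZ d c c₀ m) (x : ∀ i, DirectSum ℕ (X (c i))) (q : ℕ) :
    A.coendAct f x q = A.coendFun f q fun i q => x i q :=
  ofBounded_apply _ _ q

theorem zsmul_component {c : Clr} (k : ℤ) (x : DirectSum ℕ (X c)) (q : ℕ) :
    (k • x) q = k • x q :=
  map_zsmul (DirectSum.component ℤ ℕ (X c) q) k x

/-- By `yon_coD`, this follows from the same identity for chains. -/
theorem cosimpD_cosimpD (c : Clr) (q : ℕ) (x : X c q) :
    A.cosimpD c (q + 1) (A.cosimpD c q x) = 0 := by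
  classical
  let x0 : ∀ n, X c n := Pi.single q x
  let D : (∀ n, X c n) → ∀ n, X c n := fun x n => match n with
    | 0 => 0
    | n + 1 => A.cosimpD c n (x n)
  have h : D (D x0) (q + 2) = (0 : ∀ n, X c n) (q + 2) := by
    refine A.eq_of_yon_eq c fun y => ?_
    rw [A.yon_coD c (x := D x0) rfl fun _ => rfl, A.yon_coD c (x := x0) rfl fun _ => rfl, coD_coD,
      A.yon_eq_zero c (x := 0) rfl, map_zero, smul_zero, smul_zero]
    rfl
  have h2 : D (D x0) (q + 2) = A.cosimpD c (q + 1) (A.cosimpD c q x) :=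
    congrArg (fun z => A.cosimpD c (q + 1) (A.cosimpD c q z)) (Pi.single_eq_same q x)
  rw [← h2, h]
  rfl

/-- The action of the coendomorphism operad on the complexes of the cosimplicial modules of an
`RL_d`-algebra. The grading and the differential are characterized by hypotheses, which allows
for other descriptions of them. -/
noncomputable def coendAlg (gr : ∀ c, ℤ → Submodule R (DirectSum ℕ (X c)))
    (hgr : ∀ c p x, x ∈ gr c p ↔ ∀ q : ℕ, (q : ℤ) ≠ p → x q = 0)
    (D : ∀ c, DirectSum ℕ (X c) →ₗ[R] DirectSum ℕ (X c)) (hD0 : ∀ c x, D c x 0 = 0)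
    (hD : ∀ c x q, D c x (q + 1) = A.cosimpD c q (x q)) :
    CoendAlg R δZ d (fun c => DirectSum ℕ (X c)) gr D where
  D_mem c p x hx := by
    rw [hgr] at hx ⊢
    intro q hq
    cases q with
    | zero => exact hD0 c x
    | succ q => rw [hD, hx q fun h => hq (by rw [← h]; push_cast; rfl), map_zero]
  D_D c x := DFinsupp.ext fun q => by
    rcases q with _ | _ | q
    · exact hD0 c _
    · exact (hD c _ _).trans (by rw [hD0, map_zero]; rfl)
    · exact (hD c _ _).trans (by rw [hD, cosimpD_cosimpD]; rfl)
  act f := A.coendAct f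
  act_add f g := MultilinearMap.ext fun x => DFinsupp.ext fun q => by
    refine (A.coendAct_apply _ x q).trans ?_
    rw [coendFun_add]
    exact (congrArg₂ (· + ·) (A.coendAct_apply f x q) (A.coendAct_apply g x q)).symm
  act_mem f p x hx := by
    rw [hgr]
    intro q hq
    rw [coendAct_apply]
    exact A.homog_coendFun f (fun i => (hgr _ _ _).1 (hx i)) q hq
  act_one c₀ x := DFinsupp.ext fun q =>
    (A.coendAct_apply _ x q).trans (A.coendFun_one c₀ q fun i q => x i q)
  act_symm f e p x hx := DFinsupp.ext fun q => by
    refine (A.coendAct_apply _ _ q).trans ?_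
    refine (A.coendFun_symm f e (fun i => (hgr _ _ _).1 (hx i)) q).trans ?_
    exact (congrArg (koszul e p • ·) (A.coendAct_apply f x q)).symm
  act_comp {ι _ _ κ _ _ c c₀ c' m e} f g p x hx := DFinsupp.ext fun q => by
    refine (A.coendAct_apply _ _ q).trans ?_
    refine (A.coendFun_comp f g (x := fun i j q => x i j q)
      (fun i j => (hgr _ _ _).1 (hx i j)) q).trans ?_
    refine Eq.trans ?_ (congrArg (sgn (∑ i, ∑ i' with i' < i, e i * ∑ j, p i' j) • ·)
      (A.coendAct_apply f (fun i => A.coendAct (g i) (x i)) q)).symm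
    simp only [coendAct_apply]
  act_diff {ι _ _ c c₀ m} f p x hx := DFinsupp.ext fun q => by
    refine (A.coendFun_diff f (w := fun q => D c₀ (A.coendAct f x) q)
      (x' := fun i q => D (c i) (x i) q) (fun i => (hgr _ _ _).1 (hx i)) (fun i => hD0 _ _)
      (fun i q => hD _ _ _) (hD0 _ _) (fun q => (hD _ _ _).trans (by rw [coendAct_apply]))
      q).trans ?_
    refine congrArg₂ (· + ·) (A.coendAct_apply _ x q).symm ?_
    refine Eq.trans ?_ (zsmul_component (sgn m) _ q).symm
    rw [DirectSum.sum_apply]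
    refine congrArg (sgn m • ·) (Finset.sum_congr rfl fun i _ => ?_)
    rw [zsmul_component, coendAct_apply, coe_update]

theorem yon_mem_Tot_of_homog (c : Clr) {p : ℤ} {x : ∀ q, X c q} (h : Homog x p) :
    A.yon c x ∈ Tot δZ A c p :=
  ⟨fun n q hq => A.yon_eq_zero c (h q hq) n, fun _ _ ψ q y => A.yon_coMap c x ψ q y⟩

/-- The action on the complexes corresponds to the one on the totalizations. -/
theorem isTotAction_yon {m : ℤ} (f : Coend δZ d c c₀ m) {p : ι → ℤ} {x : ∀ i q, X (c i) q}
    (hx : ∀ i, Homog (x i) (p i)) :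
    IsTotAction A f p (fun i => A.yon (c i) (x i)) (A.yon c₀ fun q => A.coendFun f q x) := by
  intro n
  refine ⟨A.evalXiAt x n, fun {k} o y => ?_, fun q y => ?_⟩
  · rw [evalXiAt_apply]
    by_cases h : ∀ i, ((y i).deg : ℤ) = p i
    · rw [evalXi_mk]
      simp only [cross, h]
    · push Not at h
      obtain ⟨i, hi⟩ := h
      rw [A.evalXi_mk_eq_zero o y (hx i _ hi), A.act_eq_zero o (i := i), smul_zero]
      exact congrArg (fun F => F (y i).val) (A.yon_eq_zero (c i) (hx i _ hi) (k i))
  · rw [yon_coendFun, evalXiAt_apply]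
    by_cases h : (q : ℤ) + m = ∑ i, p i
    · rw [h]
    · rw [A.evalXi_eq_zero (K := q + m) ?_ (f.2.1 n q y), smul_zero, smul_zero]
      intro k hk
      by_contra hc
      push Not at hc
      refine h (hk.symm.trans (Finset.sum_congr rfl fun i _ => ?_))
      by_contra h
      exact hc i (hx i _ h)

end RLAlg

/-! ### The differentials of the cobar constructions -/

section CobarDifferential

/-- The gaps of the `i`-th coface map. -/
theorem gap_succAbove {n : ℕ} (i : Fin (n + 2)) (j : Fin n) :
    gap (Fin.succAboveOrderEmb i).toOrderHom j = if (j : ℕ) + 1 < i then [j.castSucc]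
      else if (j : ℕ) + 1 = i then [j.castSucc, j.succ] else [j.succ] := by
  have h1 : ((Fin.succAboveOrderEmb i).toOrderHom j.castSucc : ℕ) =
      if (j : ℕ) < i then (j : ℕ) else j + 1 := by
    change ((i.succAbove j.castSucc : Fin (n + 2)) : ℕ) = _
    rw [Fin.succAbove]
    split_ifs <;> simp_all [Fin.lt_def]
  have h2 : ((Fin.succAboveOrderEmb i).toOrderHom j.succ : ℕ) =
      if (j : ℕ) + 1 < i then (j : ℕ) + 1 else j + 2 := by
    change ((i.succAbove j.succ : Fin (n + 2)) : ℕ) = _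
    rw [Fin.succAbove]
    split_ifs <;> simp_all [Fin.lt_def]
  rw [gap, h1, h2]
  split_ifs with h3 h4 h5 h6 <;> first | omega | skip
  · exact interval_eq_singleton _ _ _ (by simp) (by simp)
  · refine (eq_interval ?_ fun p => ?_).symm
    · simp
    · simp only [List.mem_cons, List.not_mem_nil, or_false, Fin.ext_iff, Fin.val_castSucc,
        Fin.val_succ]
      omega
  · exact interval_eq_singleton _ _ _ (by simp) (by simp)

theorem tail_succAbove_castSucc {n : ℕ} (i : Fin (n + 1)) :
    tail (Fin.succAboveOrderEmb i.castSucc).toOrderHom = [] := by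
  refine interval_eq_nil ?_
  change n + 1 ≤ ((i.castSucc.succAbove (Fin.last n) : Fin (n + 2)) : ℕ)
  rw [Fin.succAbove_of_le_castSucc _ _ (by simp [Fin.le_def]; omega)]
  simp

theorem tail_succAbove_last {n : ℕ} :
    tail (Fin.succAboveOrderEmb (Fin.last (n + 1))).toOrderHom = [Fin.last n] := by
  refine interval_eq_singleton _ _ _ ?_ (by simp)
  change (((Fin.last (n + 1)).succAbove (Fin.last n) : Fin (n + 2)) : ℕ) = _
  simp

variable {R B C : Type u} [CommRing R] [Ring B] [Bialgebra R B] [Ring C] [Algebra R C]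
variable (S : LeftCoaction R B C)

theorem distribute_gap_succAbove {n : ℕ} (i : Fin (n + 2)) :
    distribute (gap (Fin.succAboveOrderEmb i).toOrderHom) =
      (cobarFace n i : (⨂[R]^n B) →ₗ[R] ⨂[R]^(n + 1) B) := by
  rw [cobarFace, funext (gap_succAbove i)]

/-- The differentials of the cobar constructions are those of the cosimplicial modules. -/
theorem cosimpD_rlAlg_cobarPair (c : Clr) (n : ℕ) :
    (cobarPair S).rlAlg.cosimpD c n = Cobar.D S c n := by
  rw [RLAlg.cosimpD]
  simp only [CosimplicialPair.rlAlg_cosimp]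
  cases c with
  | closed =>
    change _ = cobarD n
    rw [cobarD, Finset.sum_range]
    refine Finset.sum_congr rfl fun i _ => ?_
    exact congrArg ((-1 : ℤ) ^ (i : ℕ) • ·) (distribute_gap_succAbove i)
  | opn =>
    change _ = relCobarD S n
    rw [relCobarD, Finset.sum_range, Fin.sum_univ_castSucc]
    refine congrArg₂ (· + ·) (Finset.sum_congr rfl fun i _ => ?_) ?_
    · refine congrArg ((-1 : ℤ) ^ (i : ℕ) • ·) ?_
      change distributeC S (gap _) (tail _) = _
      rw [tail_succAbove_castSucc, distributeC_nil, distribute_gap_succAbove]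
      rfl
    · refine congrArg ((-1 : ℤ) ^ (n + 1) • ·) ?_
      change distributeC S (gap _) (tail _) = _
      rw [tail_succAbove_last, distributeC, distribute_gap_succAbove]
      rfl

theorem cobarTotalD_zero (c : Clr) (x : CobarTotal R B C c) : cobarTotalD S c x 0 = 0 := by
  induction x using DirectSum.induction_on with
  | zero => rw [map_zero]; rfl
  | add a b ha hb => rw [map_add, DirectSum.add_apply, ha, hb, add_zero]
  | of n x =>
    refine (congrArg (fun z : CobarTotal R B C c => z 0) (DirectSum.toModule_lof R n x)).trans ?_
    exact DirectSum.of_eq_of_ne _ _ _ (by omega)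

theorem cobarTotalD_succ (c : Clr) (x : CobarTotal R B C c) (q : ℕ) :
    cobarTotalD S c x (q + 1) = Cobar.D S c q (x q) := by
  induction x using DirectSum.induction_on with
  | zero => rw [map_zero, DirectSum.zero_apply, DirectSum.zero_apply, map_zero]
  | add a b ha hb => rw [map_add, DirectSum.add_apply, ha, hb, DirectSum.add_apply, map_add]
  | of n x =>
    refine (congrArg (fun z : CobarTotal R B C c => z (q + 1))
      (DirectSum.toModule_lof R n x)).trans ?_
    change DirectSum.of _ (n + 1) (Cobar.D S c n x) (q + 1) = _
    by_cases h : n = q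
    · subst h
      rw [DirectSum.of_eq_same, DirectSum.of_eq_same]
    · rw [DirectSum.of_eq_of_ne _ _ _ (by omega), DirectSum.of_eq_of_ne _ _ _ (by omega), map_zero]

end CobarDifferential

end SwissCheese

theorem mainTheorem6 {R B C : Type u} [CommRing R] [Ring B] [Bialgebra R B] [Ring C]
    [Algebra R C] (S : LeftCoaction R B C) :
    ∃ A : RLAlg R 2 (Cobar R B C), IsCobarAlg S A ∧
      (∀ (c : Clr) (p : ℕ), Function.Bijective fun g : Tot δZ A c p => evalFund p g.1) ∧
      (∀ (c : Clr) (p : ℕ) (g : Tot δZ A c p), totD p g.1 ∈ Tot δZ A c (p + 1) ∧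
        evalFund (p + 1) (totD p g.1) = Cobar.D S c p (evalFund p g.1)) ∧
      ∃ E : CoendAlg R δZ 2 (CobarTotal R B C) cobarGr (cobarTotalD S),
        ∀ {ι : Type} [LinearOrder ι] [Fintype ι] {c : ι → Clr} {c₀ : Clr} {m : ℤ}
          (f : Coend δZ 2 c c₀ m) (p : ι → ℕ) (g : ∀ i, Tot δZ A (c i) (p i)),
          ∃ h ∈ Tot δZ A c₀ (∑ i, (p i : ℤ) - m),
            IsTotAction A f (fun i => p i) (fun i => (g i).1) h ∧
            ∀ q : ℕ, (q : ℤ) = ∑ i, (p i : ℤ) - m →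
              E.act f (fun i => cobarIncl (c i) (p i) (evalFund (p i) (g i).1)) =
                cobarIncl c₀ q (evalFund q h) := by
  classical
  set A := (cobarPair S).rlAlg
  let E : CoendAlg R δZ 2 (CobarTotal R B C) cobarGr (cobarTotalD S) :=
    A.coendAlg cobarGr (fun _ _ _ => Iff.rfl) (cobarTotalD S) (cobarTotalD_zero S)
      fun c x q => (cobarTotalD_succ S c x q).trans
        (LinearMap.congr_fun (cosimpD_rlAlg_cobarPair S c q).symm (x q))
  refine ⟨A, isCobarAlg_rlAlg S, A.bijective_evalFund, fun c p g => ⟨A.totD_mem_Tot c p g.2, ?_⟩,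
    E, ?_⟩
  · rw [← cosimpD_rlAlg_cobarPair]
    exact A.evalFund_totD c p g.2
  · intro ι _ _ c c₀ m f p g
    let x : ∀ i q, Cobar R B C (c i) q := fun i => Pi.single (p i) (evalFund (p i) (g i).1)
    have hx : ∀ i q, q ≠ p i → x i q = 0 := fun i q hq => Pi.single_eq_of_ne hq _
    have hx' : ∀ i, RLAlg.Homog (x i) (p i) := fun i q hq => hx i q fun h => hq (by rw [h])
    have hg : (fun i => (g i).1) = fun i => A.yon (c i) (x i) := funext fun i =>
      A.eq_yon_of_mem_Tot (c i) (g i).2 (hx i) (Pi.single_eq_same (p i) _)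
    have hw := A.homog_coendFun f hx'
    refine ⟨A.yon c₀ fun q => A.coendFun f q x, A.yon_mem_Tot_of_homog c₀ hw, ?_, fun q hq => ?_⟩
    · rw [hg]
      exact A.isTotAction_yon f hx'
    · have hxi : (fun i q => cobarIncl (c i) (p i) (evalFund (p i) (g i).1) q) = x := by
        funext i q
        by_cases h : q = p i
        · subst h
          exact (DirectSum.of_eq_same _ _).trans (Pi.single_eq_same _ _).symm
        · exact (DirectSum.of_eq_of_ne _ _ _ h).trans (hx i q h).symm
      refine DFinsupp.ext fun q' => (A.coendAct_apply f _ q').trans ?_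
      rw [hxi, RLAlg.evalFund_yon]
      by_cases h : q' = q
      · subst h
        exact (DirectSum.of_eq_same _ _).symm
      · exact (hw q' fun h' => h (by omega)).trans (DirectSum.of_eq_of_ne _ _ _ h).symm
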